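/- Identify $\mathbb{R}^4_1$ (with $\langle x,y\rangle=-x_0y_0+x_1y_1+x_2y_2+x_3y_3$) with the Hermitian $2\times2$ matrices by $x\leftrightarrow\begin{pmatrix}x_0+x_3&x_1+ix_2\\x_1-ix_2&x_0-x_3\end{pmatrix}$, put $e_3=\mathrm{diag}(1,-1)$, and let $\mathbb{S}^3_1=\{x:\langle x,x\rangle=1\}$ be de Sitter $3$-space. Let $M$ be a connected oriented smooth $2$-manifold. A smooth ($C^\infty$) map $f:M\to\mathbb{S}^3_1$ is a *CMC $1$ face*, with regular part $W$, if * $W\subset M$ is open and dense and $f|_W$ is a spacelike immersion (the induced metric $ds^2=\langle df,df\rangle$ is positive definite on $W$) with mean curvature $H=\tfrac12\,\mathrm{tr}_{ds^2}\langle D\,df,N\rangle=1$ (here $D\,df$ is formed with the flat connection of $\mathbb{R}^4_1$), where $N$ is the oriented timelike unit normal, that is $\langle N,N\rangle=-1$, $N\perp f$, $N\perp df$, and $\det(N,f_u,f_v,f)>0$ in positively oriented local coordinates $(u,v)$; * every singular point $p$ (a point where $ds^2$ is degenerate) is admissible: $df(p)\neq0$, and there are a neighborhood $U$ of $p$ and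 a positive $C^1$ function $\beta$ on $U\cap W$ such that $\beta\,ds^2$ extends to a $C^1$ Riemannian metric on $U$. **Proposition.** Let $f:M\to\mathbb{S}^3_1$ be a CMC $1$ face with regular part $W$, and let $\varrho:\widetilde M\to M$ be the universal cover. Then there is a unique complex structure $J$ on $M$ (a maximal holomorphic atlas whose charts are smooth charts of $M$) such that 1. $f|_W$ is conformal with respect to $J$, and 2. there is an immersion $F:\widetilde M\to SL(2,\mathbb{C})$, holomorphic with respect to (the lift to $\widetilde M$ of) $J$, with $\det(dF)=0$ and $f\circ\varrho=Fe_3F^*$. Moreover $J$ induces the given orientation of $M$, and it is the only complex structure inducing that orientation which satisfies (1). -/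

import Mathlib

open scoped Manifold ContDiff Matrix

noncomputable section

namespace CMCFace

/-! ### Lorentz space, de Sitter space and Hermitian matrices -/

/-- The Lorentz product of signature `(-,+,+,+)` on `ℝ⁴`. -/
def lorentz (x y : Fin 4 → ℝ) : ℝ :=
  -(x 0 * y 0) + x 1 * y 1 + x 2 * y 2 + x 3 * y 3

/-- De Sitter 3-space. -/
def deSitter : Set (Fin 4 → ℝ) := {x | lorentz x x = 1}

/-- The identification of `ℝ⁴` with the Hermitian `2 × 2` matrices. -/
def toHerm (x : Fin 4 → ℝ) : Matrix (Fin 2) (Fin 2) ℂ :=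
  !![(x 0 : ℂ) + x 3, x 1 + Complex.I * x 2; x 1 - Complex.I * x 2, (x 0 : ℂ) - x 3]

/-- The matrix `e₃ = diag(1, -1)`. -/
def e₃ : Matrix (Fin 2) (Fin 2) ℂ := !![1, 0; 0, -1]

/-- The coordinate plane `ℝ²`. -/
abbrev Plane : Type := EuclideanSpace ℝ (Fin 2)

/-- The standard basis vectors of the coordinate plane. -/
def bvec (i : Fin 2) : Plane := EuclideanSpace.single i 1

section Surfaces

variable {M : Type*} [TopologicalSpace M]

/-- The atlas of `M` is oriented: all coordinate changes have positive Jacobian. -/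
def IsOrientedAtlas (M : Type*) [TopologicalSpace M] [ChartedSpace Plane M] : Prop :=
  ∀ e ∈ atlas Plane M, ∀ e' ∈ atlas Plane M, ∀ x ∈ e.source ∩ e'.source,
    0 < (fderiv ℝ (e' ∘ e.symm) (e x)).det

/-- The partial derivative `∂ᵢ f` at `x`, in the chart `e`. -/
def pd (e : OpenPartialHomeomorph M Plane) (f : M → Fin 4 → ℝ) (i : Fin 2) (x : M) :
    Fin 4 → ℝ :=
  fderiv ℝ (f ∘ e.symm) (e x) (bvec i)

/-- The second partial derivative `∂ᵢ ∂ⱼ f` at `x`, in the chart `e`. -/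
def pd₂ (e : OpenPartialHomeomorph M Plane) (f : M → Fin 4 → ℝ) (i j : Fin 2) (x : M) :
    Fin 4 → ℝ :=
  fderiv ℝ (fun y => fderiv ℝ (f ∘ e.symm) y (bvec j)) (e x) (bvec i)

/-- The matrix of the induced metric `ds²` at `x`, in the chart `e`. -/
def firstForm (e : OpenPartialHomeomorph M Plane) (f : M → Fin 4 → ℝ) (x : M) :
    Matrix (Fin 2) (Fin 2) ℝ :=
  Matrix.of fun i j => lorentz (pd e f i x) (pd e f j x)

/-- `N` is the oriented unit normal vector at `x` of `f`, as a surface in de Sitter space: it is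
a unit timelike vector tangent to de Sitter space and normal to the surface, and
`(N, ∂₁ f, ∂₂ f, f)` is a positive basis of `ℝ⁴`. Here `e` is a positively oriented chart. -/
def IsUnitNormal (e : OpenPartialHomeomorph M Plane) (f : M → Fin 4 → ℝ) (x : M)
    (N : Fin 4 → ℝ) : Prop :=
  lorentz N N = -1 ∧ lorentz N (f x) = 0 ∧ (∀ i, lorentz N (pd e f i x) = 0) ∧
    0 < Matrix.det ![N, pd e f 0 x, pd e f 1 x, f x]

/-- The matrix of the second fundamental form at `x` with respect to `N`, in the chart `e`.
(The second derivatives in `ℝ⁴` may be used: their components along `f x` are orthogonal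
to `N`.) -/
def secondForm (e : OpenPartialHomeomorph M Plane) (f : M → Fin 4 → ℝ) (x : M)
    (N : Fin 4 → ℝ) : Matrix (Fin 2) (Fin 2) ℝ :=
  Matrix.of fun i j => lorentz (pd₂ e f i j x) N

/-- The mean curvature at `x` with respect to `N`: half the trace of the second fundamental form
with respect to the first one. -/
def meanCurvature (e : OpenPartialHomeomorph M Plane) (f : M → Fin 4 → ℝ) (x : M)
    (N : Fin 4 → ℝ) : ℝ :=
  ((firstForm e f x)⁻¹ * secondForm e f x N).trace / 2

variable [ChartedSpace Plane M]

/-- `f` is a spacelike immersion of constant mean curvature 1 on `W`: at each point of `W` the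
induced metric is positive definite and the mean curvature with respect to the oriented unit
normal is 1. -/
def IsSpacelikeCMC1On (f : M → Fin 4 → ℝ) (W : Set M) : Prop :=
  ∀ x ∈ W, ∀ e ∈ atlas Plane M, x ∈ e.source →
    (firstForm e f x).PosDef ∧ ∃ N, IsUnitNormal e f x N ∧ meanCurvature e f x N = 1

/-- The induced metric is degenerate at `p`. -/
def IsSingularPt (f : M → Fin 4 → ℝ) (p : M) : Prop :=
  (firstForm (chartAt Plane p) f p).det = 0

/-- `p` is an admissible singular point. The `C¹` Riemannian metric that extends `β ds²` is given
by its matrix `γ` in the chart at `p` (the neighborhood `U` may always be shrunk into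
the domain of this chart). -/
def IsAdmissiblePt (f : M → Fin 4 → ℝ) (W : Set M) (p : M) : Prop :=
  IsSingularPt f p ∧
  (∃ U : Set M, IsOpen U ∧ p ∈ U ∧ U ⊆ (chartAt Plane p).source ∧
    ∃ (β : M → ℝ) (γ : M → Matrix (Fin 2) (Fin 2) ℝ),
      ContMDiffOn (𝓡 2) 𝓘(ℝ) 1 β (U ∩ W) ∧ (∀ x ∈ U ∩ W, 0 < β x) ∧
      (∀ i j, ContMDiffOn (𝓡 2) 𝓘(ℝ) 1 (fun x => γ x i j) U) ∧ (∀ x ∈ U, (γ x).PosDef) ∧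
      ∀ x ∈ U ∩ W, γ x = β x • firstForm (chartAt Plane p) f x) ∧
  ∃ i, pd (chartAt Plane p) f i p ≠ 0

/-- `f` is a CMC 1 face, where `W` is an open dense set on which `f` is a spacelike
CMC 1 immersion. -/
structure IsCMC1Face (f : M → Fin 4 → ℝ) (W : Set M) : Prop where
  mem_deSitter : ∀ x, f x ∈ deSitter
  smooth : ContMDiff (𝓡 2) 𝓘(ℝ, Fin 4 → ℝ) ∞ f
  isOpen : IsOpen W
  dense : Dense W
  cmc1 : IsSpacelikeCMC1On f W
  admissible : ∀ p, IsSingularPt f p → IsAdmissiblePt f W p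

end Surfaces

/-! ### Complex structures on a smooth surface -/

/-- A complex structure on the smooth surface `M`: a maximal holomorphic atlas, whose charts are
smooth charts of `M`. -/
@[ext]
structure ComplexStructure (M : Type*) [TopologicalSpace M] [ChartedSpace Plane M] where
  charts : Set (OpenPartialHomeomorph M ℂ)
  cover : ∀ x, ∃ c ∈ charts, x ∈ c.source
  smooth : ∀ c ∈ charts, ContMDiffOn (𝓡 2) 𝓘(ℝ, ℂ) ∞ c c.source ∧
    ContMDiffOn 𝓘(ℝ, ℂ) (𝓡 2) ∞ c.symm c.target
  holo : ∀ c ∈ charts, ∀ c' ∈ charts, DifferentiableOn ℂ (c' ∘ c.symm) (c.symm.trans c').source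
  maximal : ∀ c : OpenPartialHomeomorph M ℂ,
    (∀ c' ∈ charts, DifferentiableOn ℂ (c' ∘ c.symm) (c.symm.trans c').source ∧
      DifferentiableOn ℂ (c ∘ c'.symm) (c'.symm.trans c).source) → c ∈ charts

namespace ComplexStructure

variable {M : Type*} [TopologicalSpace M] [ChartedSpace Plane M]

/-- The complex structure induces the orientation given by the oriented atlas of `M`. -/
def IsPositive (J : ComplexStructure M) : Prop :=
  ∀ c ∈ J.charts, ∀ e ∈ atlas Plane M, ∀ x ∈ c.source ∩ e.source,
    let D := fderiv ℝ (c ∘ e.symm) (e x)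
    0 < (D (bvec 0)).re * (D (bvec 1)).im - (D (bvec 0)).im * (D (bvec 1)).re

/-- `f` is conformal on `W` with respect to `J`: in each holomorphic coordinate `z`, the
induced metric at a point of `W` is a positive multiple of `|dz|²`. -/
def IsConformalOn (J : ComplexStructure M) (f : M → Fin 4 → ℝ) (W : Set M) : Prop :=
  ∀ c ∈ J.charts, ∀ x ∈ W ∩ c.source, ∃ l : ℝ, 0 < l ∧ ∀ v w : ℂ,
    lorentz (fderiv ℝ (f ∘ c.symm) (c x) v) (fderiv ℝ (f ∘ c.symm) (c x) w) = l * inner ℝ v w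

/-- `F` is a holomorphic null lift of `f` with respect to `J`, where `ϱ : Mt → M` is the universal
cover: a holomorphic immersion into `SL(2, ℂ)` with `det (dF) = 0` and `f ∘ ϱ = F e₃ F^*`.
The holomorphic coordinates of `Mt` are the compositions of the local inverses of the sheets,
that is, of the restrictions `s` of `ϱ`, with the holomorphic coordinates of `M`. -/
def IsNullLift (J : ComplexStructure M) (f : M → Fin 4 → ℝ)
    {Mt : Type*} [TopologicalSpace Mt] (ϱ : Mt → M)
    (F : Mt → Matrix.SpecialLinearGroup (Fin 2) ℂ) : Prop :=
  (∀ s : OpenPartialHomeomorph Mt M, Set.EqOn s ϱ s.source → ∀ c ∈ J.charts,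
    let k : OpenPartialHomeomorph Mt ℂ := s.trans c
    let G : ℂ → Matrix (Fin 2) (Fin 2) ℂ := fun z => (F (k.symm z)).1
    (∀ i j, DifferentiableOn ℂ (fun z => G z i j) k.target) ∧
    ∀ z ∈ k.target,
      let dG : Matrix (Fin 2) (Fin 2) ℂ := Matrix.of fun i j => deriv (fun u => G u i j) z
      dG ≠ 0 ∧ dG.det = 0) ∧
  ∀ y, toHerm (f (ϱ y)) = (F y).1 * e₃ * ((F y).1)ᴴ

end ComplexStructure

end CMCFace

end

namespace CMCFace

open Filter Topology Set MeasureTheory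

/-! ### Smooth division I: blow-up and zero branches of a function with a given leading term. -/

section SmoothDivision

/-! In a chart write `g` for the face and `h` for the conformal class of the induced metric,
normalised to determinant 1. Admissibility extends `h` across the singular set, but only as a `C¹`
object. The Hodge star of `h` gives the matrix-valued form `Ω = ½ (dg + i ⋆dg) g⁻¹ = ∂g g⁻¹`. Mean
curvature 1 amounts to `dΩ = 0` on `W` (`CMC1At.laplacian`, `CMC1At.curl_form`), and by density and
continuity `Ω` is closed everywhere (`PlanarFace.closed`).

Since `Ω` has type (1,0) and `Ω g + g Ω* = dg`, it vanishes only where `dg` does; a primitive of a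
nonzero entry is therefore an isothermal coordinate `z` (`PlanarFace.exists_coord`). Then `Ω = A dz`
with `A` holomorphic, trace-free and of determinant 0. A solution of `F' = A F` with a suitable
initial value lies in `SL(2, ℂ)` and is null, and `F⁻¹ g F⁻*` is constant, whence `g = F e₃ F*`
(`PlanarFace.exists_lift`).

The charts must be smooth, whereas `z` is so far only `C¹`. The delicate point is thus the
smoothness of `h` at singular points (`PlanarFace.contDiffOn_conf_of_singular`). Writing the
nilpotent matrix `F⁻¹F'` through holomorphic functions `w` and `γ`, the metric is `|w|² (|γ|² - 1)²
|dz|²`. A Wronskian of entries of `dg` yields a smooth function `R` that equals `|γ|² - 1` times a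
nonvanishing continuous factor, so the metric coefficients are `R²` times continuous functions. The
leading term of `R` is `Re (C ξ ^ k)`; its zero set consists of `k` transverse smooth branches, and
Hadamard's lemma along them shows that a continuous quotient by `R` of a smooth function is smooth
(`exists_contDiff_quotient`).

Smooth charts that are positively oriented and conformal on `W` have coordinate changes satisfying
the Cauchy-Riemann equations on a dense set, hence everywhere; they form `J` (`adaptedStructure`),
and every positive conformal structure equals it. If a conformal structure with a null lift reversed
the orientation somewhere, it would do so near a point of `W`; the lift would be antiholomorphic
there for the conformal structure with the given orientation, and `½ (dg - i ⋆dg) g⁻¹` would be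
closed. But its exterior derivative is a nonzero multiple of `N g⁻¹` (`isPositive_of_isNullLift`).

Two local lifts differ by a matrix stabilising `e₃` whose entries are both holomorphic and
antiholomorphic, hence locally constant. The local lifts thus define a flat bundle, and lifting `ϱ`
to this covering of `M` gives the global null lift (`exists_isNullLift`). -/

theorem contDiff_intervalIntegral_param {P : Type*} [NormedAddCommGroup P] [NormedSpace ℝ P]
    {G : P × ℝ → ℝ} (hG : ContDiff ℝ ∞ G) :
    ContDiff ℝ ∞ (fun p => ∫ t in (0 : ℝ)..1, G (p, t)) := by
  obtain ⟨b, hb1, hbc, hbs⟩ : ∃ b : ℝ → ℝ, (∀ t ∈ Icc (0 : ℝ) 1, b t = 1) ∧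
      HasCompactSupport b ∧ ContDiff ℝ ∞ b := by
    let φ : ContDiffBump (0 : ℝ) := ⟨2, 3, by norm_num, by norm_num⟩
    refine ⟨φ, fun t ht => φ.one_of_mem_closedBall ?_, φ.hasCompactSupport, φ.contDiff⟩
    simp only [Metric.mem_closedBall, dist_zero_right, Real.norm_eq_abs, abs_le]
    change -2 ≤ t ∧ t ≤ 2
    exact ⟨by linarith [ht.1], by linarith [ht.2]⟩
  -- The integral is the value at `1` of the convolution of the indicator of `[0, 1]` with `t ↦ b (1
  -- - t) * G (p, 1 - t)`. The cutoff `b` makes this family compactly supported without changing the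
  -- integral.
  have key := contDiffOn_convolution_left_with_param_comp (μ := volume) (n := ⊤)
    (ContinuousLinearMap.lsmul ℝ ℝ) (s := (univ : Set P)) (v := fun _ => (1 : ℝ))
    (f := (Icc (0 : ℝ) 1).indicator fun _ => (1 : ℝ))
    (g := fun p t => b (1 - t) * G (p, 1 - t)) (k := (fun t => 1 - t) '' tsupport b)
    contDiffOn_const isOpen_univ (hbc.isCompact.image (by fun_prop))
    (fun p x _ hx => by
      have : b (1 - x) = 0 := by
        by_contra h
        exact hx ⟨1 - x, subset_tsupport _ h, by ring⟩
      simp [this])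
    ((integrable_indicator_iff measurableSet_Icc).2
      (integrableOn_const (by simp))).locallyIntegrable
    (ContDiff.contDiffOn (by
      have h1 : ContDiff ℝ ∞ fun q : P × ℝ => b (1 - q.2) := hbs.comp (by fun_prop)
      have h2 : ContDiff ℝ ∞ fun q : P × ℝ => G (q.1, 1 - q.2) := hG.comp (by fun_prop)
      exact h1.mul h2))
  rw [contDiffOn_univ] at key
  convert key using 2 with p
  rw [← convolution_flip, convolution]
  simp only [ContinuousLinearMap.flip_apply, ContinuousLinearMap.lsmul_apply, smul_eq_mul,
    sub_sub_cancel]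
  rw [intervalIntegral.integral_of_le zero_le_one, ← integral_Icc_eq_integral_Ioc,
    ← integral_indicator measurableSet_Icc]
  refine integral_congr_ae (.of_forall fun t => ?_)
  by_cases ht : t ∈ Icc (0 : ℝ) 1
  · simp [ht, hb1 t ht]
  · simp [ht]

/-- Hadamard's lemma along the graph of a function of one variable. -/
theorem exists_contDiff_hadamard {g : ℝ × ℝ → ℝ} (hg : ContDiff ℝ ∞ g) {σ : ℝ → ℝ}
    (hσ : ContDiff ℝ ∞ σ) : ∃ g₁ : ℝ × ℝ → ℝ, ContDiff ℝ ∞ g₁ ∧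
      ∀ t y, g (t, y) = g (t, σ t) + (y - σ t) * g₁ (t, y) := by
  have hd : ContDiff ℝ ∞ fun q : ℝ × ℝ => fderiv ℝ g q (0, 1) :=
    (hg.fderiv_right (m := ∞) (by simp)).clm_apply contDiff_const
  refine ⟨fun q => ∫ s in (0 : ℝ)..1, fderiv ℝ g (q.1, σ q.1 + s * (q.2 - σ q.1)) (0, 1), ?_, ?_⟩
  · refine contDiff_intervalIntegral_param
      (G := fun r : (ℝ × ℝ) × ℝ => fderiv ℝ g (r.1.1, σ r.1.1 + r.2 * (r.1.2 - σ r.1.1)) (0, 1)) ?_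
    have h1 : ContDiff ℝ ∞ fun r : (ℝ × ℝ) × ℝ => σ r.1.1 := hσ.comp (by fun_prop)
    exact hd.comp (by fun_prop)
  · intro t y
    have hdiff : ∀ s : ℝ, HasDerivAt (fun s : ℝ => g (t, σ t + s * (y - σ t)))
        ((y - σ t) * fderiv ℝ g (t, σ t + s * (y - σ t)) (0, 1)) s := by
      intro s
      have h1 : HasDerivAt (fun s : ℝ => (t, σ t + s * (y - σ t))) ((0 : ℝ), (y - σ t)) s := by
        refine (hasDerivAt_const s t).prodMk ?_
        simpa using ((hasDerivAt_id s).mul_const (y - σ t)).const_add (σ t)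
      have h2 := ((hg.differentiable (by simp) (t, σ t + s * (y - σ t))).hasFDerivAt).comp_hasDerivAt
        s h1
      rw [show ((0 : ℝ), y - σ t) = (y - σ t) • ((0 : ℝ), (1 : ℝ)) by simp, map_smul,
        smul_eq_mul] at h2
      exact h2
    have hc : Continuous fun s : ℝ => (y - σ t) * fderiv ℝ g (t, σ t + s * (y - σ t)) (0, 1) :=
      continuous_const.mul (hd.continuous.comp (by fun_prop))
    have := intervalIntegral.integral_eq_sub_of_hasDerivAt (a := 0) (b := 1)
      (fun s _ => hdiff s) (hc.intervalIntegrable _ _)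
    rw [intervalIntegral.integral_const_mul] at this
    simp only [one_mul, add_sub_cancel, zero_mul, add_zero] at this
    linarith

/-- A cutoff changes nothing near `a`. Only germs matter for division, so the division lemmas can be
stated for globally smooth functions. -/
theorem exists_contDiff_eventuallyEq {E F : Type*} [NormedAddCommGroup E] [NormedSpace ℝ E]
    [FiniteDimensional ℝ E] [NormedAddCommGroup F] [NormedSpace ℝ F] {f : E → F} {U : Set E}
    (hU : IsOpen U) {a : E} (ha : a ∈ U) (hf : ContDiffOn ℝ ∞ f U) :
    ∃ g : E → F, ContDiff ℝ ∞ g ∧ g =ᶠ[𝓝 a] f := by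
  obtain ⟨r, hr, hrU⟩ := Metric.isOpen_iff.1 hU a ha
  let φ : ContDiffBump a := ⟨r / 4, r / 2, by positivity, by linarith⟩
  refine ⟨fun x => φ x • f x, ?_, ?_⟩
  · rw [contDiff_iff_contDiffAt]
    intro x
    by_cases hx : x ∈ U
    · exact φ.contDiff.contDiffAt.smul (hf.contDiffAt (hU.mem_nhds hx))
    · have : x ∉ tsupport φ := by
        rw [φ.tsupport_eq]
        intro h
        exact hx (hrU (Metric.closedBall_subset_ball (show r / 2 < r by linarith) h))
      have h0 : (fun x => φ x • f x) =ᶠ[𝓝 x] fun _ => 0 := by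
        filter_upwards [(notMem_tsupport_iff_eventuallyEq.1 this)] with y hy
        simp [hy]
      exact contDiffAt_const.congr_of_eventuallyEq h0
  · filter_upwards [φ.eventuallyEq_one] with x hx
    simp [hx]

/-- The inverse function theorem on an open set, with a uniform smoothness domain. -/
theorem exists_openPartialHomeomorph_contDiffOn {E F : Type*} [NormedAddCommGroup E]
    [NormedSpace ℝ E] [FiniteDimensional ℝ E] [NormedAddCommGroup F] [NormedSpace ℝ F] {n : ℕ∞ω}
    (hn : 1 ≤ n) {f : E → F} {U : Set E} (hU : IsOpen U) {a : E} (ha : a ∈ U)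
    (hf : ContDiffOn ℝ n f U) (f' : E ≃L[ℝ] F) (hf' : HasFDerivAt f (f' : E →L[ℝ] F) a) :
    ∃ e : OpenPartialHomeomorph E F, a ∈ e.source ∧ e.source ⊆ U ∧ (∀ x, e x = f x) ∧
      ContDiffOn ℝ n e.symm e.target := by
  have : CompleteSpace E := FiniteDimensional.complete ℝ E
  have hn0 : n ≠ 0 := by rintro rfl; simp at hn
  have hfa := hf.contDiffAt (hU.mem_nhds ha)
  let e₀ := hfa.toOpenPartialHomeomorph f hf' hn0
  have he₀ : ∀ x, e₀ x = f x := fun x => by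
    simp only [e₀, ContDiffAt.toOpenPartialHomeomorph_coe]
  -- Invertibility of the derivative is an open condition. Restricting to where it holds makes the
  -- inverse of class `C^n` on the whole target, not just at the image of `a`.
  have hV : ∀ᶠ x in 𝓝 a, ∃ g : E ≃L[ℝ] F, (g : E →L[ℝ] F) = fderiv ℝ f x := by
    have hc : ContinuousAt (fderiv ℝ f) a :=
      (hfa.fderiv_right (m := 0) (by simpa using hn)).continuousAt
    exact hc.eventually_mem (by rw [hf'.fderiv]; exact f'.nhds)
  obtain ⟨V, hVs, hVo, haV⟩ := eventually_nhds_iff.1 hV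
  refine ⟨e₀.restrOpen (U ∩ V) (hU.inter hVo), ?_, ?_, ?_, ?_⟩
  · exact ⟨hfa.mem_toOpenPartialHomeomorph_source hf' hn0, ha, haV⟩
  · exact fun x hx => hx.2.1
  · exact fun x => he₀ x
  · intro y hy
    have hy2 := (e₀.restrOpen (U ∩ V) (hU.inter hVo)).map_target hy
    obtain ⟨g, hg⟩ := hVs _ hy2.2.2
    refine (OpenPartialHomeomorph.contDiffAt_symm _ (f₀' := g) hy ?_ ?_).contDiffWithinAt
    · have : HasFDerivAt f (fderiv ℝ f _) ((e₀.restrOpen (U ∩ V) (hU.inter hVo)).symm y) :=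
        ((hf.contDiffAt (hU.mem_nhds hy2.2.1)).differentiableAt hn0).hasFDerivAt
      rw [hg]
      exact this.congr_of_eventuallyEq (.of_forall fun x => he₀ x)
    · exact (hf.contDiffAt (hU.mem_nhds hy2.2.1)).congr_of_eventuallyEq (.of_forall fun x => he₀ x)

/-- The blow-up of a smooth function with a given leading term along rays. -/
theorem exists_blowup {R : ℂ → ℝ} (hR : ContDiff ℝ ∞ R) {k : ℕ} {Q : ℂ → ℝ}
    (hRQ : ∀ η : ℂ, Tendsto (fun t : ℝ => R (t * η) / t ^ k) (𝓝[≠] 0) (𝓝 (Q η))) (e : ℂ) :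
    ∃ G : ℝ × ℝ → ℝ, ContDiff ℝ ∞ G ∧ (∀ s : ℝ, G (s, 0) = Q (e * (1 + s * Complex.I))) ∧
      ∀ s t : ℝ, R (t * (e * (1 + s * Complex.I))) = t ^ k * G (s, t) := by
  have hlim : ∀ j ≤ k, ∀ G : ℝ × ℝ → ℝ, ContDiff ℝ ∞ G →
      (∀ s t : ℝ, R (t * (e * (1 + s * Complex.I))) = t ^ j * G (s, t)) →
      ∀ s : ℝ, Tendsto (fun t : ℝ => t ^ (k - j) * (R (t * (e * (1 + s * Complex.I))) / t ^ k))
        (𝓝[≠] 0) (𝓝 (G (s, 0))) := by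
    intro j hj G hG h s
    have hc : Tendsto (fun t : ℝ => G (s, t)) (𝓝[≠] 0) (𝓝 (G (s, 0))) :=
      ((hG.continuous.comp (Continuous.prodMk_right s)).tendsto 0).mono_left nhdsWithin_le_nhds
    refine hc.congr' ?_
    filter_upwards [self_mem_nhdsWithin] with t ht
    have ht : t ≠ 0 := ht
    rw [h s t]
    have : t ^ k = t ^ (k - j) * t ^ j := by rw [← pow_add, Nat.sub_add_cancel hj]
    rw [this]
    field_simp
  -- While `j < k`, the value `G (s, 0)` is the limit of a positive power of `t` times a convergent
  -- quotient, hence zero, and Hadamard's lemma extracts one more factor `t`.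
  have main : ∀ j ≤ k, ∃ G : ℝ × ℝ → ℝ, ContDiff ℝ ∞ G ∧
      ∀ s t : ℝ, R (t * (e * (1 + s * Complex.I))) = t ^ j * G (s, t) := by
    intro j
    induction j with
    | zero =>
      intro _
      refine ⟨fun q => R (q.2 * (e * (1 + q.1 * Complex.I))), hR.comp ?_, by simp⟩
      have h1 : ContDiff ℝ ∞ fun q : ℝ × ℝ => (q.2 : ℂ) := Complex.ofRealCLM.contDiff.comp contDiff_snd
      have h2 : ContDiff ℝ ∞ fun q : ℝ × ℝ => (q.1 : ℂ) := Complex.ofRealCLM.contDiff.comp contDiff_fst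
      fun_prop
    | succ j ih =>
      intro hj
      obtain ⟨G, hG, h⟩ := ih (by omega)
      have h0 : ∀ s, G (s, 0) = 0 := by
        intro s
        refine tendsto_nhds_unique (hlim j (by omega) G hG h s) ?_
        have h1 : Tendsto (fun t : ℝ => t ^ (k - j)) (𝓝[≠] 0) (𝓝 0) := by
          have : Tendsto (fun t : ℝ => t ^ (k - j)) (𝓝 0) (𝓝 (0 ^ (k - j))) :=
            (continuous_pow (k - j)).tendsto 0
          rw [zero_pow (by omega)] at this
          exact this.mono_left nhdsWithin_le_nhds
        simpa using h1.mul (hRQ (e * (1 + s * Complex.I)))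
      obtain ⟨G₁, hG₁, h₁⟩ := exists_contDiff_hadamard hG (σ := fun _ => 0) contDiff_const
      refine ⟨G₁, hG₁, fun s t => ?_⟩
      rw [h s t, h₁ s t, h0 s]
      ring
  obtain ⟨G, hG, h⟩ := main k le_rfl
  refine ⟨G, hG, fun s => ?_, h⟩
  refine tendsto_nhds_unique (hlim k le_rfl G hG h s) ?_
  simpa using hRQ (e * (1 + s * Complex.I))

/-- The branch of the zero set of `R` that is tangent to a simple zero line of its leading term. -/
theorem exists_zero_branch {R : ℂ → ℝ} (hR : ContDiff ℝ ∞ R) {k : ℕ} {Q : ℂ → ℝ}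
    (hRQ : ∀ η : ℂ, Tendsto (fun t : ℝ => R (t * η) / t ^ k) (𝓝[≠] 0) (𝓝 (Q η))) {e : ℂ}
    (he : Q e = 0) {q : ℝ} (hq : q ≠ 0)
    (hQ : HasDerivAt (fun s : ℝ => Q (e * (1 + s * Complex.I))) q 0) :
    ∃ σ : ℝ → ℝ, ContDiff ℝ ∞ σ ∧ σ 0 = 0 ∧ HasDerivAt σ 0 0 ∧
      ∀ᶠ t : ℝ in 𝓝 0, R (e * (t + σ t * Complex.I)) = 0 := by
  obtain ⟨G, hG, hG0, hRG⟩ := exists_blowup hR hRQ e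
  have hG00 : G (0, 0) = 0 := by simpa [he] using hG0 0
  set L := fderiv ℝ G (0, 0) with hL
  have hGd : HasFDerivAt G L (0, 0) := (hG.differentiable (by simp) _).hasFDerivAt
  have hLq : L (1, 0) = q := by
    have h1 : HasDerivAt (fun s : ℝ => (s, (0 : ℝ))) ((1 : ℝ), (0 : ℝ)) 0 :=
      (hasDerivAt_id (0 : ℝ)).prodMk (hasDerivAt_const _ _)
    have h2 := HasFDerivAt.comp_hasDerivAt (f := fun s : ℝ => (s, (0 : ℝ))) (0 : ℝ) hGd h1
    have h3 : (G ∘ fun s : ℝ => (s, (0 : ℝ))) = fun s : ℝ => Q (e * (1 + s * Complex.I)) := by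
      ext s
      exact hG0 s
    rw [h3] at h2
    exact h2.unique hQ
  have hLs : ∀ v : ℝ × ℝ, L v = v.1 * q + v.2 * L (0, 1) := by
    intro v
    have : v = v.1 • ((1 : ℝ), (0 : ℝ)) + v.2 • ((0 : ℝ), (1 : ℝ)) := by
      ext <;> simp
    conv_lhs => rw [this]
    rw [map_add, map_smul, map_smul, hLq, smul_eq_mul, smul_eq_mul]
  -- Implicit function theorem for `G (s, t) = 0`, by inverting `(s, t) ↦ (G (s, t), t)`: the
  -- simplicity of the zero of `Q` says `∂G/∂s = q ≠ 0` at the origin.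
  let Θ : ℝ × ℝ → ℝ × ℝ := fun v => (G v, v.2)
  let Λ : (ℝ × ℝ) ≃L[ℝ] (ℝ × ℝ) := ContinuousLinearEquiv.equivOfInverse
    (L.prod (ContinuousLinearMap.snd ℝ ℝ ℝ))
    ((q⁻¹ • (ContinuousLinearMap.fst ℝ ℝ ℝ - L (0, 1) • ContinuousLinearMap.snd ℝ ℝ ℝ)).prod
      (ContinuousLinearMap.snd ℝ ℝ ℝ))
    (fun v => by
      ext
      · simp only [ContinuousLinearMap.prod_apply, smul_apply,
          sub_apply, ContinuousLinearMap.coe_fst', ContinuousLinearMap.coe_snd',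
          smul_eq_mul, hLs v]
        field_simp
        ring
      · simp)
    (fun v => by
      ext
      · simp only [ContinuousLinearMap.prod_apply, smul_apply,
          sub_apply, ContinuousLinearMap.coe_fst', ContinuousLinearMap.coe_snd',
          smul_eq_mul]
        rw [hLs]
        field_simp
        ring
      · simp)
  have hΘ : ContDiff ℝ ∞ Θ := hG.prodMk contDiff_snd
  obtain ⟨E, hE0, -, hE, hEs⟩ := exists_openPartialHomeomorph_contDiffOn (n := ∞) (by simp)
    isOpen_univ (mem_univ (0, 0)) hΘ.contDiffOn Λ (hGd.prodMk hasFDerivAt_snd)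
  have hE00 : E (0, 0) = (0, 0) := by rw [hE]; simp [Θ, hG00]
  have hT : ((0 : ℝ), (0 : ℝ)) ∈ E.target := by
    have := E.map_source hE0
    rwa [hE00] at this
  have hES0 : E.symm (0, 0) = (0, 0) := by
    have := E.left_inv hE0
    rwa [hE00] at this
  obtain ⟨τ, hτ, hτE⟩ := exists_contDiff_eventuallyEq (a := (0 : ℝ))
    (f := fun t => (E.symm (0, t)).1) (U := (fun t : ℝ => ((0 : ℝ), t)) ⁻¹' E.target)
    (E.open_target.preimage (Continuous.prodMk_right 0)) hT
    (contDiff_fst.comp_contDiffOn (hEs.comp (contDiff_prodMk_right 0).contDiffOn fun t ht => ht))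
  have hτ0 : τ 0 = 0 := by rw [hτE.self_of_nhds]; simp [hES0]
  -- The solution `s = τ t` is the point `t e (1 + i τ t) = e (t + i t τ t)`. Since `τ 0 = 0`, the
  -- branch is tangent to its line.
  refine ⟨fun t => t * τ t, contDiff_id.mul hτ, by simp, ?_, ?_⟩
  · have := (hasDerivAt_id (0 : ℝ)).mul ((hτ.differentiable (by simp) 0).hasDerivAt)
    simp only [id, hτ0, mul_zero, zero_mul, add_zero] at this
    exact this
  · have hmem : ∀ᶠ t : ℝ in 𝓝 0, ((0 : ℝ), t) ∈ E.target :=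
      (E.open_target.preimage (Continuous.prodMk_right 0)).mem_nhds hT
    filter_upwards [hτE, hmem] with t ht hm
    have h1 := E.right_inv hm
    rw [hE] at h1
    have h2 : (E.symm (0, t)).2 = t := congrArg Prod.snd h1
    have h3 : G (τ t, t) = 0 := by
      have h5 : G (E.symm (0, t)) = 0 := congrArg Prod.fst h1
      rw [ht]
      convert h5 using 2
      exact Prod.ext rfl h2.symm
    have h4 := hRG (τ t) t
    rw [h3, mul_zero] at h4
    rw [← h4]
    congr 1
    push_cast
    ring

end SmoothDivision

end CMCFace

namespace CMCFace

open Filter Topology Set MeasureTheory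

/-! ### Smooth division II: factoring along transverse branches. -/

section SmoothDivision

/-- The defining function of the curve `t ↦ e (t + i σ(t))`. -/
noncomputable def branchFun (e : ℂ) (σ : ℝ → ℝ) (ξ : ℂ) : ℝ := (ξ / e).im - σ (ξ / e).re

theorem contDiff_branchFun (e : ℂ) {σ : ℝ → ℝ} (hσ : ContDiff ℝ ∞ σ) :
    ContDiff ℝ ∞ (branchFun e σ) := by
  have h0 : ContDiff ℝ ∞ fun ξ : ℂ => ξ / e := by
    simp only [div_eq_mul_inv]
    fun_prop
  exact (Complex.imCLM.contDiff.comp h0).sub (hσ.comp (Complex.reCLM.contDiff.comp h0))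

theorem branchFun_apply {e : ℂ} (he : e ≠ 0) (σ : ℝ → ℝ) (t y : ℝ) :
    branchFun e σ (e * (t + y * Complex.I)) = y - σ t := by
  simp [branchFun, mul_div_cancel_left₀ _ he]

theorem eq_mul_re_add_im {e : ℂ} (he : e ≠ 0) (ξ : ℂ) :
    ξ = e * (((ξ / e).re : ℂ) + ((ξ / e).im : ℂ) * Complex.I) := by
  rw [Complex.re_add_im, mul_div_cancel₀ _ he]

theorem dense_branchFun_ne_zero {e : ℂ} (he : e ≠ 0) (σ : ℝ → ℝ) :
    Dense {ξ | branchFun e σ ξ ≠ 0} := by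
  intro ξ
  have h : Tendsto (fun y : ℝ => e * (((ξ / e).re : ℂ) + (((ξ / e).im + y : ℝ) : ℂ) * Complex.I))
      (𝓝[≠] 0) (𝓝 ξ) := by
    have hc : Continuous fun y : ℝ =>
        e * (((ξ / e).re : ℂ) + (((ξ / e).im + y : ℝ) : ℂ) * Complex.I) := by fun_prop
    have := hc.tendsto 0
    rw [add_zero, ← eq_mul_re_add_im he] at this
    exact this.mono_left nhdsWithin_le_nhds
  refine mem_closure_of_tendsto h ?_
  by_cases h0 : branchFun e σ ξ = 0
  · filter_upwards [self_mem_nhdsWithin] with y hy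
    have hy : y ≠ 0 := hy
    change branchFun e σ _ ≠ 0
    rw [branchFun_apply he]
    unfold branchFun at h0
    intro h1
    apply hy
    linarith
  · have hne : branchFun e σ ξ ≠ 0 := h0
    have hc : Tendsto (fun y : ℝ => branchFun e σ (e * (((ξ / e).re : ℂ) +
        (((ξ / e).im + y : ℝ) : ℂ) * Complex.I))) (𝓝[≠] 0) (𝓝 (branchFun e σ ξ)) := by
      simp only [branchFun_apply he]
      have hc : Continuous fun y : ℝ => (ξ / e).im + y - σ (ξ / e).re := by fun_prop
      have := hc.tendsto 0
      rw [add_zero] at this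
      exact this.mono_left nhdsWithin_le_nhds
    exact hc.eventually_ne hne

theorem hasDerivAt_branchFun_ray {e : ℂ} {σ : ℝ → ℝ} (hσ' : HasDerivAt σ 0 0) (η : ℂ) :
    HasDerivAt (fun t : ℝ => branchFun e σ (t * η)) (η / e).im 0 := by
  have h1 : HasDerivAt (fun t : ℝ => t * (η / e).im - σ (t * (η / e).re)) ((η / e).im) 0 := by
    have h2 : HasDerivAt (fun t : ℝ => t * (η / e).re) (η / e).re 0 := by
      simpa using (hasDerivAt_id (0 : ℝ)).mul_const (η / e).re
    have h3 : HasDerivAt (fun t : ℝ => t * (η / e).im) (η / e).im 0 := by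
      simpa using (hasDerivAt_id (0 : ℝ)).mul_const (η / e).im
    have h4 : HasDerivAt (fun t : ℝ => σ (t * (η / e).re)) 0 0 := by
      have : HasDerivAt σ 0 (0 * (η / e).re) := by rwa [zero_mul]
      have h5 := this.comp (0 : ℝ) h2
      rw [zero_mul] at h5
      exact h5
    have h6 := h3.sub h4
    rw [sub_zero] at h6
    exact h6
  convert h1 using 2 with t
  rw [branchFun, mul_div_assoc, Complex.re_ofReal_mul, Complex.im_ofReal_mul]

/-- A function vanishing on finitely many pairwise transverse smooth branches through `0` is
divisible by the product of their defining functions. -/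
theorem exists_eq_prod_branchFun_mul {ι : Type*} (S : Finset ι) {e : ι → ℂ} {σ : ι → ℝ → ℝ}
    (he : ∀ j, e j ≠ 0) (hσ : ∀ j, ContDiff ℝ ∞ (σ j)) (hσ0 : ∀ j, σ j 0 = 0)
    (hσ' : ∀ j, HasDerivAt (σ j) 0 0) (hne : ∀ i ∈ S, ∀ j ∈ S, i ≠ j → (e i / e j).im ≠ 0)
    {P : ℂ → ℝ} (hP : ContDiff ℝ ∞ P)
    (hP0 : ∀ j ∈ S, ∀ᶠ t : ℝ in 𝓝 0, P (e j * (t + σ j t * Complex.I)) = 0) :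
    ∃ P' : ℂ → ℝ, ContDiff ℝ ∞ P' ∧
      ∀ᶠ ξ in 𝓝 (0 : ℂ), P ξ = (∏ j ∈ S, branchFun (e j) (σ j) ξ) * P' ξ := by
  classical
  induction S using Finset.induction_on with
  | empty => exact ⟨P, hP, by simp⟩
  | insert i S hi ih =>
    obtain ⟨P', hP', hPP'⟩ := ih
      (fun a ha b hb => hne a (Finset.mem_insert_of_mem ha) b (Finset.mem_insert_of_mem hb))
      (fun j hj => hP0 j (Finset.mem_insert_of_mem hj))
    let c : ℝ → ℂ := fun t => e i * (t + σ i t * Complex.I)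
    have hcs : ContDiff ℝ ∞ c := by
      have h1 : ContDiff ℝ ∞ fun t : ℝ => (t : ℂ) := Complex.ofRealCLM.contDiff
      have h2 : ContDiff ℝ ∞ fun t : ℝ => (σ i t : ℂ) := Complex.ofRealCLM.contDiff.comp (hσ i)
      fun_prop
    have hc0 : c 0 = 0 := by simp [c, hσ0 i]
    have hcc : Tendsto c (𝓝 0) (𝓝 0) := by
      have := hcs.continuous.tendsto 0
      rwa [hc0] at this
    have hcd : HasDerivAt c (e i) 0 := by
      have h1 : HasDerivAt (fun t : ℝ => (t : ℂ)) 1 0 := Complex.ofRealCLM.hasDerivAt (x := 0)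
      have h2 : HasDerivAt (fun t : ℝ => (σ i t : ℂ)) ((0 : ℝ) : ℂ) 0 := (hσ' i).ofReal_comp
      simpa using (h1.add (h2.mul_const Complex.I)).const_mul (e i)
    -- Along branch `i` the defining function of branch `j` has derivative `Im (e i / e j) ≠ 0` at
    -- `0`, so near `0` it vanishes there only at `0`. Hence the cofactor `P'` left by the other
    -- branches must itself vanish on branch `i`.
    have hbr : ∀ j ∈ S, ∀ᶠ t in 𝓝[≠] (0 : ℝ), branchFun (e j) (σ j) (c t) ≠ 0 := by
      intro j hj
      have hij : i ≠ j := fun h => hi (h ▸ hj)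
      have hd : HasFDerivAt (branchFun (e j) (σ j)) (fderiv ℝ (branchFun (e j) (σ j)) 0) (c 0) := by
        rw [hc0]
        exact ((contDiff_branchFun (e j) (hσ j)).differentiable (by simp) 0).hasFDerivAt
      have h1 := hd.comp_hasDerivAt (0 : ℝ) hcd
      have h2 : fderiv ℝ (branchFun (e j) (σ j)) 0 (e i) = (e i / e j).im := by
        have h3 : HasDerivAt (fun t : ℝ => (t : ℂ) * e i) (e i) 0 := by
          simpa using (Complex.ofRealCLM.hasDerivAt (x := 0)).mul_const (e i)
        have hd' : HasFDerivAt (branchFun (e j) (σ j)) (fderiv ℝ (branchFun (e j) (σ j)) 0)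
            ((fun t : ℝ => (t : ℂ) * e i) 0) := by
          rw [hc0] at hd
          simpa using hd
        exact (HasFDerivAt.comp_hasDerivAt (f := fun t : ℝ => (t : ℂ) * e i) (0 : ℝ) hd' h3).unique
          (hasDerivAt_branchFun_ray (hσ' j) (e i))
      rw [h2] at h1
      exact h1.eventually_ne
        (hne i (Finset.mem_insert_self _ _) j (Finset.mem_insert_of_mem hj) hij)
    have hP'c : ∀ᶠ t in 𝓝 (0 : ℝ), P' (c t) = 0 := by
      have h1 : ∀ᶠ t in 𝓝[≠] (0 : ℝ), P' (c t) = 0 := by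
        have h2 := (hP0 i (Finset.mem_insert_self _ _)).filter_mono (nhdsWithin_le_nhds (s := {0}ᶜ))
        have h3 := (hcc.eventually hPP').filter_mono (nhdsWithin_le_nhds (s := {0}ᶜ))
        have h4 : ∀ᶠ t in 𝓝[≠] (0 : ℝ), ∀ j ∈ S, branchFun (e j) (σ j) (c t) ≠ 0 :=
          (Finset.eventually_all S).2 hbr
        filter_upwards [h2, h3, h4] with t h2 h3 h4
        rw [h2] at h3
        exact (mul_eq_zero.1 h3.symm).resolve_left (Finset.prod_ne_zero_iff.2 h4)
      have h0 : P' (c 0) = 0 := by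
        have hcont : Tendsto (fun t => P' (c t)) (𝓝[≠] 0) (𝓝 (P' (c 0))) :=
          ((hP'.continuous.comp hcs.continuous).tendsto 0).mono_left nhdsWithin_le_nhds
        exact tendsto_nhds_unique hcont
          ((tendsto_congr' (h1.mono fun t ht => ht)).2 tendsto_const_nhds)
      rw [eventually_nhdsWithin_iff] at h1
      filter_upwards [h1] with t ht
      by_cases h : t = 0
      · rw [h, h0]
      · exact ht h
    obtain ⟨g₁, hg₁, hg⟩ := exists_contDiff_hadamard
      (g := fun q => P' (e i * (q.1 + q.2 * Complex.I)))
      (hP'.comp (by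
        have h1 : ContDiff ℝ ∞ fun q : ℝ × ℝ => (q.1 : ℂ) :=
          Complex.ofRealCLM.contDiff.comp contDiff_fst
        have h2 : ContDiff ℝ ∞ fun q : ℝ × ℝ => (q.2 : ℂ) :=
          Complex.ofRealCLM.contDiff.comp contDiff_snd
        fun_prop)) (hσ i)
    have hdiv : ContDiff ℝ ∞ fun ξ : ℂ => ξ / e i := by
      simp only [div_eq_mul_inv]
      fun_prop
    refine ⟨fun ξ => g₁ ((ξ / e i).re, (ξ / e i).im), hg₁.comp
      ((Complex.reCLM.contDiff.comp hdiv).prodMk (Complex.imCLM.contDiff.comp hdiv)), ?_⟩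
    have hre : Tendsto (fun ξ : ℂ => (ξ / e i).re) (𝓝 0) (𝓝 0) := by
      have : Continuous fun ξ : ℂ => (ξ / e i).re := Complex.continuous_re.comp hdiv.continuous
      simpa using this.tendsto 0
    filter_upwards [hPP', hre.eventually hP'c] with ξ h1 h2
    have h3 := hg (ξ / e i).re (ξ / e i).im
    simp only at h3
    rw [← eq_mul_re_add_im (he i), show e i * (((ξ / e i).re : ℂ) + (σ i (ξ / e i).re : ℂ) *
      Complex.I) = c (ξ / e i).re from rfl, h2, zero_add] at h3
    rw [h1, h3, Finset.prod_insert hi]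
    unfold branchFun
    ring

/-- The zero lines of `Re (C ξ ^ k)` are obtained from one solution of `e₀ ^ k = i / C` by rotations
through `π j / k`. Two of these angles differ by less than `π`, so the `k` lines are distinct. -/
theorem exists_zero_directions {C : ℂ} (hC : C ≠ 0) {k : ℕ} (hk : k ≠ 0) :
    ∃ e : Fin k → ℂ, (∀ j, e j ≠ 0) ∧ (∀ i j, i ≠ j → (e i / e j).im ≠ 0) ∧
      ∀ j, ∃ r : ℝ, r ≠ 0 ∧ C * e j ^ k = r * Complex.I := by
  obtain ⟨e₀, he₀⟩ := IsAlgClosed.exists_pow_nat_eq (Complex.I / C) (Nat.pos_of_ne_zero hk)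
  have he00 : e₀ ≠ 0 := by
    rintro rfl
    rw [zero_pow hk] at he₀
    exact (div_ne_zero Complex.I_ne_zero hC) he₀.symm
  have hkr : (k : ℝ) ≠ 0 := by exact_mod_cast hk
  refine ⟨fun j => e₀ * Complex.exp ((Real.pi * j / k : ℝ) * Complex.I),
    fun j => mul_ne_zero he00 (Complex.exp_ne_zero _), fun i j hij => ?_, fun j => ?_⟩
  · rw [mul_div_mul_left _ _ he00, ← Complex.exp_sub, ← sub_mul, ← Complex.ofReal_sub,
      Complex.exp_ofReal_mul_I_im]
    have hkpos : (0 : ℝ) < k := by positivity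
    have hi : (i : ℝ) < k := by exact_mod_cast i.2
    have hj : (j : ℝ) < k := by exact_mod_cast j.2
    have hi0 : (0 : ℝ) ≤ i := by positivity
    have hj0 : (0 : ℝ) ≤ j := by positivity
    have hne : (i : ℝ) ≠ j := by
      intro h
      exact hij (Fin.ext (by exact_mod_cast h))
    have hval : Real.pi * i / k - Real.pi * j / k = Real.pi * ((i - j) / k) := by ring
    rw [hval]
    have hpi := Real.pi_pos
    refine Real.sin_eq_zero_iff_of_lt_of_lt ?_ ?_ |>.not.2 ?_
    · have : -1 < ((i : ℝ) - j) / k := by rw [lt_div_iff₀ hkpos]; linarith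
      nlinarith
    · have : ((i : ℝ) - j) / k < 1 := by rw [div_lt_iff₀ hkpos]; linarith
      nlinarith
    · exact mul_ne_zero hpi.ne' (div_ne_zero (sub_ne_zero.2 hne) hkr)
  · refine ⟨(-1) ^ (j : ℕ), pow_ne_zero _ (by norm_num), ?_⟩
    rw [mul_pow, he₀, ← Complex.exp_nat_mul]
    have h1 : (k : ℂ) * (((Real.pi * j / k : ℝ) : ℂ) * Complex.I) = (j : ℕ) * (Real.pi * Complex.I) := by
      have hkc : (k : ℂ) ≠ 0 := by exact_mod_cast hk
      push_cast
      field_simp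
    rw [h1, Complex.exp_nat_mul, Complex.exp_pi_mul_I]
    push_cast
    field_simp

/-- Division by a smooth function whose leading term is `Re (C ξ ^ k)`: a continuous quotient of
smooth functions is smooth. -/
theorem exists_contDiff_quotient {R : ℂ → ℝ} (hR : ContDiff ℝ ∞ R) {k : ℕ} (hk : k ≠ 0) {C : ℂ}
    (hC : C ≠ 0)
    (hRC : ∀ η : ℂ, Tendsto (fun t : ℝ => R (t * η) / t ^ k) (𝓝[≠] 0) (𝓝 (C * η ^ k).re))
    {P h : ℂ → ℝ} (hP : ContDiff ℝ ∞ P) (hh : ∀ᶠ ξ in 𝓝 0, ContinuousAt h ξ)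
    (hPR : ∀ᶠ ξ in 𝓝 0, P ξ = R ξ * h ξ) :
    ∃ h' : ℂ → ℝ, ContDiff ℝ ∞ h' ∧ h' =ᶠ[𝓝 0] h := by
  obtain ⟨e, he, hne, hCe⟩ := exists_zero_directions hC hk
  have hbranch : ∀ j, ∃ σ : ℝ → ℝ, ContDiff ℝ ∞ σ ∧ σ 0 = 0 ∧ HasDerivAt σ 0 0 ∧
      ∀ᶠ t : ℝ in 𝓝 0, R (e j * (t + σ t * Complex.I)) = 0 := by
    intro j
    obtain ⟨r, hr, hr'⟩ := hCe j
    refine exists_zero_branch (Q := fun η => (C * η ^ k).re) hR hRC (e := e j) (q := -(r * k))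
      ?_ ?_ ?_
    · simp [hr']
    · exact neg_ne_zero.2 (mul_ne_zero hr (by exact_mod_cast hk))
    -- Along this line the derivative is `(r i)(k i) = -r k`, which is real and nonzero: the zero of
    -- the leading term is simple.
    · have h1 : HasDerivAt (fun s : ℂ => C * (e j * (1 + s * Complex.I)) ^ k)
          (C * e j ^ k * (k * Complex.I)) 0 := by
        have h2 : HasDerivAt (fun s : ℂ => 1 + s * Complex.I) Complex.I 0 := by
          simpa using ((hasDerivAt_id (0 : ℂ)).mul_const Complex.I).const_add 1
        have h3 := (h2.pow k).const_mul (C * e j ^ k)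
        simp only [zero_mul, add_zero, one_pow, mul_one] at h3
        refine h3.congr_of_eventuallyEq (.of_forall fun s => ?_)
        change C * (e j * (1 + s * Complex.I)) ^ k = C * e j ^ k * (1 + s * Complex.I) ^ k
        rw [mul_pow, mul_assoc]
      have h4 : HasDerivAt (fun s : ℂ => C * (e j * (1 + s * Complex.I)) ^ k)
          (C * e j ^ k * (k * Complex.I)) ((0 : ℝ) : ℂ) := by simpa using h1
      have h5 := h4.real_of_complex
      convert h5 using 1
      rw [hr']
      simp
  choose σ hσ hσ0 hσ' hσR using hbranch
  obtain ⟨R', hR', hRR'⟩ := exists_eq_prod_branchFun_mul Finset.univ he hσ hσ0 hσ'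
    (fun i _ j _ => hne i j) hR (fun j _ => hσR j)
  have hPc : ∀ j, ∀ᶠ t : ℝ in 𝓝 0, P (e j * (t + σ j t * Complex.I)) = 0 := by
    intro j
    have hc : Tendsto (fun t : ℝ => e j * (t + σ j t * Complex.I)) (𝓝 0) (𝓝 0) := by
      have : Continuous fun t : ℝ => e j * (t + σ j t * Complex.I) := by
        have := (hσ j).continuous
        fun_prop
      simpa [hσ0 j] using this.tendsto 0
    filter_upwards [hσR j, hc.eventually hPR] with t h1 h2
    rw [h2, h1, zero_mul]
  obtain ⟨P', hP', hPP'⟩ := exists_eq_prod_branchFun_mul Finset.univ he hσ hσ0 hσ'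
    (fun i _ j _ => hne i j) hP (fun j _ => hPc j)
  -- Choose a ray with `C η ^ k = 1`. There `R (t η) / t ^ k` tends to `1`, while the factorisation
  -- gives the limit `(∏ Im (η / e j)) * R' 0`: the `k` branches already account for the full order
  -- of vanishing.
  have hR'0 : R' 0 ≠ 0 := by
    obtain ⟨η, hη⟩ := IsAlgClosed.exists_pow_nat_eq (C⁻¹) (Nat.pos_of_ne_zero hk)
    intro h0
    have h1 := hRC η
    rw [hη, mul_inv_cancel₀ hC, Complex.one_re] at h1
    have hray : Tendsto (fun t : ℝ => (t : ℂ) * η) (𝓝[≠] 0) (𝓝 0) := by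
      have : Continuous fun t : ℝ => (t : ℂ) * η := by fun_prop
      have := this.tendsto 0
      simp only [Complex.ofReal_zero, zero_mul] at this
      exact this.mono_left nhdsWithin_le_nhds
    have h2 : Tendsto (fun t : ℝ => (∏ j, branchFun (e j) (σ j) (t * η) / t) * R' (t * η)) (𝓝[≠] 0)
        (𝓝 ((∏ j, (η / e j).im) * R' 0)) := by
      refine Tendsto.mul (tendsto_finsetProd _ fun j _ => ?_) ((hR'.continuous.tendsto 0).comp hray)
      have h3 := (hasDerivAt_branchFun_ray (e := e j) (hσ' j) η).tendsto_slope
      refine h3.congr fun t => ?_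
      simp [slope_def_field, branchFun, hσ0 j]
    rw [h0, mul_zero] at h2
    refine one_ne_zero (tendsto_nhds_unique (h1.congr' ?_) h2)
    filter_upwards [hray.eventually hRR', self_mem_nhdsWithin] with t ht ht0
    rw [ht, Finset.prod_div_distrib]
    simp
    ring
  have hU : IsOpen {ξ | R' ξ ≠ 0} := isOpen_ne_fun hR'.continuous continuous_const
  obtain ⟨h', hh', hh'e⟩ := exists_contDiff_eventuallyEq (a := (0 : ℂ)) (U := {ξ | R' ξ ≠ 0})
    (f := fun ξ => P' ξ / R' ξ) hU hR'0 (hP'.contDiffOn.div hR'.contDiffOn fun ξ hξ => hξ)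
  refine ⟨h', hh', ?_⟩
  -- Off the branches `h` is `P' / R'` by cancellation. The branches have dense complement and both
  -- functions are continuous, so they agree near `0`.
  have hD : Dense (⋂ j, {ξ | branchFun (e j) (σ j) ξ ≠ 0}) :=
    dense_iInter_of_isOpen
      (fun j => isOpen_ne_fun (contDiff_branchFun _ (hσ j)).continuous continuous_const)
      (fun j => dense_branchFun_ne_zero (he j) (σ j))
  obtain ⟨V, hV, hVo, h0V⟩ := eventually_nhds_iff.1
    (hh'e.and (hh.and (hPR.and (hPP'.and (hRR'.and (hU.mem_nhds hR'0))))))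
  filter_upwards [hVo.mem_nhds h0V] with ξ hξ
  have hcl : ξ ∈ closure (V ∩ ⋂ j, {ξ | branchFun (e j) (σ j) ξ ≠ 0}) :=
    hD.open_subset_closure_inter hVo hξ
  have : (𝓝[V ∩ ⋂ j, {ξ | branchFun (e j) (σ j) ξ ≠ 0}] ξ).NeBot :=
    mem_closure_iff_nhdsWithin_neBot.1 hcl
  have t1 : Tendsto h' (𝓝[V ∩ ⋂ j, {ξ | branchFun (e j) (σ j) ξ ≠ 0}] ξ) (𝓝 (h' ξ)) :=
    (hh'.continuous.tendsto ξ).mono_left nhdsWithin_le_nhds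
  have t2 : Tendsto h (𝓝[V ∩ ⋂ j, {ξ | branchFun (e j) (σ j) ξ ≠ 0}] ξ) (𝓝 (h ξ)) :=
    Tendsto.mono_left (hV ξ hξ).2.1 nhdsWithin_le_nhds
  refine tendsto_nhds_unique_of_eventuallyEq t1 t2 ?_
  filter_upwards [self_mem_nhdsWithin] with ζ hζ
  obtain ⟨a1, -, a2, a3, a4, a5⟩ := hV ζ hζ.1
  have hprod : ∏ j, branchFun (e j) (σ j) ζ ≠ 0 :=
    Finset.prod_ne_zero_iff.2 fun j _ => mem_iInter.1 hζ.2 j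
  have a5 : R' ζ ≠ 0 := a5
  rw [a1, div_eq_iff a5]
  rw [a3, a4, mul_assoc] at a2
  rw [mul_left_cancel₀ hprod a2]
  ring

end SmoothDivision

end CMCFace

namespace CMCFace

/-! ### Lorentz geometry in terms of Hermitian matrices. -/

section LorentzAlgebra

theorem lorentz_comm (x y : Fin 4 → ℝ) : lorentz x y = lorentz y x := by
  simp only [lorentz]; ring

theorem lorentz_add_left (x y z : Fin 4 → ℝ) : lorentz (x + y) z = lorentz x z + lorentz y z := by
  simp only [lorentz, Pi.add_apply]; ring

theorem lorentz_sub_left (x y z : Fin 4 → ℝ) : lorentz (x - y) z = lorentz x z - lorentz y z := by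
  simp only [lorentz, Pi.sub_apply]; ring

theorem lorentz_smul_left (c : ℝ) (x y : Fin 4 → ℝ) : lorentz (c • x) y = c * lorentz x y := by
  simp only [lorentz, Pi.smul_apply, smul_eq_mul]; ring

theorem lorentz_add_right (x y z : Fin 4 → ℝ) : lorentz x (y + z) = lorentz x y + lorentz x z := by
  simp only [lorentz, Pi.add_apply]; ring

theorem lorentz_smul_right (c : ℝ) (x y : Fin 4 → ℝ) : lorentz x (c • y) = c * lorentz x y := by
  simp only [lorentz, Pi.smul_apply, smul_eq_mul]; ring

/-- `-adj (toHerm x)`, the inverse of `toHerm x` for `x` in de Sitter space. -/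
noncomputable def toHermInv (x : Fin 4 → ℝ) : Matrix (Fin 2) (Fin 2) ℂ :=
  !![-(x 0 : ℂ) + x 3, x 1 + Complex.I * x 2; x 1 - Complex.I * x 2, -(x 0 : ℂ) - x 3]

theorem toHerm_add (x y : Fin 4 → ℝ) : toHerm (x + y) = toHerm x + toHerm y := by
  ext i j; fin_cases i <;> fin_cases j <;> simp [toHerm] <;> ring

theorem toHerm_smul (c : ℝ) (x : Fin 4 → ℝ) : toHerm (c • x) = c • toHerm x := by
  ext i j; fin_cases i <;> fin_cases j <;> simp [toHerm] <;> ring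

theorem toHermInv_add (x y : Fin 4 → ℝ) : toHermInv (x + y) = toHermInv x + toHermInv y := by
  ext i j; fin_cases i <;> fin_cases j <;> simp [toHermInv] <;> ring

theorem toHermInv_smul (c : ℝ) (x : Fin 4 → ℝ) : toHermInv (c • x) = c • toHermInv x := by
  ext i j; fin_cases i <;> fin_cases j <;> simp [toHermInv] <;> ring

theorem toHerm_conjTranspose (x : Fin 4 → ℝ) : (toHerm x)ᴴ = toHerm x := by
  ext i j
  fin_cases i <;> fin_cases j <;> simp [toHerm, Matrix.conjTranspose_apply, sub_eq_add_neg]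

theorem toHerm_injective : Function.Injective toHerm := by
  intro x y h
  have h00 := congrFun (congrFun h 0) 0
  have h01 := congrFun (congrFun h 0) 1
  have h11 := congrFun (congrFun h 1) 1
  simp only [toHerm, Matrix.of_apply, Matrix.cons_val', Matrix.cons_val_zero,
    Matrix.cons_val_one, Complex.ext_iff] at h00 h01 h11
  simp at h00 h01 h11
  ext i
  fin_cases i <;> simp <;> linarith [h01.1, h01.2]

theorem det_toHerm (x : Fin 4 → ℝ) : (toHerm x).det = -(lorentz x x : ℂ) := by
  rw [Matrix.det_fin_two]
  simp [toHerm, lorentz]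
  ring_nf
  simp
  ring

/-- Polarisation of `X adj X = det X`, i.e. the Clifford relation of the Lorentz product. -/
theorem toHerm_mul_toHermInv_add (x y : Fin 4 → ℝ) :
    toHerm x * toHermInv y + toHerm y * toHermInv x = ((2 * lorentz x y : ℝ) : ℂ) • 1 := by
  ext i j
  fin_cases i <;> fin_cases j <;> apply Complex.ext <;>
    simp [toHerm, toHermInv, lorentz] <;> ring

theorem toHerm_mul_toHermInv {x : Fin 4 → ℝ} (hx : lorentz x x = 1) :
    toHerm x * toHermInv x = 1 := by
  have h := toHerm_mul_toHermInv_add x x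
  rw [hx, ← two_smul ℂ] at h
  have h2 : (2 : ℂ)⁻¹ • ((2 : ℂ) • (toHerm x * toHermInv x)) = toHerm x * toHermInv x := by
    rw [smul_smul]; norm_num
  rw [← h2, h, smul_smul]
  norm_num

theorem toHermInv_mul_toHerm {x : Fin 4 → ℝ} (hx : lorentz x x = 1) :
    toHermInv x * toHerm x = 1 := mul_eq_one_comm.1 (toHerm_mul_toHermInv hx)

/-- The Lorentzian triple product. -/
def tripleProduct (a b c : Fin 4 → ℝ) : Fin 4 → ℝ :=
  ![Matrix.det ![![1, 0, 0, 0], a, b, c], -Matrix.det ![![0, 1, 0, 0], a, b, c],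
    -Matrix.det ![![0, 0, 1, 0], a, b, c], -Matrix.det ![![0, 0, 0, 1], a, b, c]]

theorem det_fin_four' (a b c d : Fin 4 → ℝ) : Matrix.det ![a, b, c, d] =
    a 0 * (b 1 * (c 2 * d 3 - c 3 * d 2) - b 2 * (c 1 * d 3 - c 3 * d 1)
      + b 3 * (c 1 * d 2 - c 2 * d 1))
    - a 1 * (b 0 * (c 2 * d 3 - c 3 * d 2) - b 2 * (c 0 * d 3 - c 3 * d 0)
      + b 3 * (c 0 * d 2 - c 2 * d 0))
    + a 2 * (b 0 * (c 1 * d 3 - c 3 * d 1) - b 1 * (c 0 * d 3 - c 3 * d 0)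
      + b 3 * (c 0 * d 1 - c 1 * d 0))
    - a 3 * (b 0 * (c 1 * d 2 - c 2 * d 1) - b 1 * (c 0 * d 2 - c 2 * d 0)
      + b 2 * (c 0 * d 1 - c 1 * d 0)) := by
  refine (Matrix.det_succ_row_zero (Matrix.of ![a, b, c, d])).trans ?_
  simp [Fin.sum_univ_succ, Matrix.det_fin_three, Matrix.submatrix, Fin.succAbove]
  ring

theorem lorentz_tripleProduct (x a b c : Fin 4 → ℝ) :
    lorentz x (tripleProduct a b c) = -Matrix.det ![x, a, b, c] := by
  simp [lorentz, tripleProduct, det_fin_four']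
  ring

/-- A Clifford product of three vectors is a combination of those vectors plus `i` times their cross
product. This is how the unit normal enters the matrix calculus. -/
theorem toHerm_triple (a b c : Fin 4 → ℝ) :
    (toHerm b * toHermInv a - toHerm a * toHermInv b) * toHerm c =
      (2 * Complex.I) • toHerm (tripleProduct a b c) + (2 * lorentz c a) • toHerm b
        - (2 * lorentz c b) • toHerm a := by
  ext i j
  fin_cases i <;> fin_cases j <;> apply Complex.ext <;>
    simp [toHerm, toHermInv, tripleProduct, det_fin_four', lorentz] <;> ring

/-- Nondegeneracy of the product: vector identities will be checked by pairing with the frame `N,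
∂₀g, ∂₁g, g`. -/
theorem eq_zero_of_lorentz_eq_zero {a b c d x : Fin 4 → ℝ} (hd : Matrix.det ![a, b, c, d] ≠ 0)
    (ha : lorentz x a = 0) (hb : lorentz x b = 0) (hc : lorentz x c = 0) (hx : lorentz x d = 0) :
    x = 0 := by
  have h : Matrix.mulVec (Matrix.of ![a, b, c, d]) ![-x 0, x 1, x 2, x 3] = 0 := by
    simp only [lorentz] at ha hb hc hx
    ext i
    fin_cases i <;> simp [Matrix.mulVec, dotProduct, Fin.sum_univ_four] <;> linarith
  have h0 := Matrix.eq_zero_of_mulVec_eq_zero hd h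
  ext i
  have h1 := congrFun h0 i
  fin_cases i <;> simpa using h1

/-- The Gram matrix of the frame is block diagonal with blocks `-1`, the metric, and `1`. The minus
sign of `⟨N, N⟩` cancels that of the signature. -/
theorem det_sq_eq_gram (N a b c : Fin 4 → ℝ) (hN : lorentz N N = -1) (hNa : lorentz N a = 0)
    (hNb : lorentz N b = 0) (hNc : lorentz N c = 0) (hca : lorentz c a = 0)
    (hcb : lorentz c b = 0) (hcc : lorentz c c = 1) :
    Matrix.det ![N, a, b, c] ^ 2 = lorentz a a * lorentz b b - lorentz a b ^ 2 := by
  have hmul : Matrix.of ![N, a, b, c] * Matrix.diagonal ![-1, 1, 1, 1] *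
      (Matrix.of ![N, a, b, c])ᵀ = Matrix.of ![![-1, 0, 0, 0], ![0, lorentz a a, lorentz a b, 0],
        ![0, lorentz a b, lorentz b b, 0], ![0, 0, 0, 1]] := by
    simp only [lorentz] at *
    ext i j
    fin_cases i <;> fin_cases j <;>
      simp [Matrix.mul_apply, Matrix.vecMul_diagonal, Fin.sum_univ_four] <;> linarith
  have h := congrArg Matrix.det hmul
  rw [Matrix.det_mul, Matrix.det_mul, Matrix.det_transpose, Matrix.det_diagonal] at h
  have h4 : Matrix.det (Matrix.of ![![-1, 0, 0, 0], ![0, lorentz a a, lorentz a b, 0],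
        ![0, lorentz a b, lorentz b b, 0], ![0, 0, 0, (1 : ℝ)]]) =
      -(lorentz a a * lorentz b b - lorentz a b ^ 2) := by
    refine (det_fin_four' _ _ _ _).trans ?_
    simp
    ring
  rw [h4] at h
  simp [Fin.prod_univ_four] at h
  change Matrix.det (Matrix.of ![N, a, b, c]) ^ 2 = _
  linarith

/-- The oriented unit normal is the normalized triple product. -/
theorem smul_normal_eq_tripleProduct {N a b c : Fin 4 → ℝ} (hN : lorentz N N = -1)
    (hNa : lorentz N a = 0) (hNb : lorentz N b = 0) (hNc : lorentz N c = 0)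
    (hca : lorentz c a = 0) (hcb : lorentz c b = 0) (hcc : lorentz c c = 1)
    (hdet : 0 < Matrix.det ![N, a, b, c]) {S : ℝ} (hS : 0 < S)
    (hS2 : S ^ 2 = lorentz a a * lorentz b b - lorentz a b ^ 2) :
    S • N = tripleProduct a b c := by
  have h1 : Matrix.det ![N, a, b, c] = S := by
    have := det_sq_eq_gram N a b c hN hNa hNb hNc hca hcb hcc
    rw [← hS2] at this
    exact (pow_left_inj₀ hdet.le hS.le two_ne_zero).1 this
  have hrep : ∀ x, lorentz (tripleProduct a b c) x = -Matrix.det ![x, a, b, c] := fun x => by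
    rw [lorentz_comm, lorentz_tripleProduct]
  rw [← sub_eq_zero]
  apply eq_zero_of_lorentz_eq_zero hdet.ne' <;>
    rw [lorentz_sub_left, lorentz_smul_left, hrep]
  · rw [hN, h1]; ring
  · rw [hNa, det_fin_four']; ring
  · rw [hNb, det_fin_four']; ring
  · rw [hNc, det_fin_four']; ring

/-- For tangent vectors `a`, `b` at `c` only the triple product survives in `toHerm_triple`. The
sign, hence the orientation of `N`, is fixed by the positive determinant. -/
theorem toHerm_commutator_eq_normal {N a b c : Fin 4 → ℝ} (hN : lorentz N N = -1)
    (hNa : lorentz N a = 0) (hNb : lorentz N b = 0) (hNc : lorentz N c = 0)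
    (hca : lorentz c a = 0) (hcb : lorentz c b = 0) (hcc : lorentz c c = 1)
    (hdet : 0 < Matrix.det ![N, a, b, c]) {S : ℝ} (hS : 0 < S)
    (hS2 : S ^ 2 = lorentz a a * lorentz b b - lorentz a b ^ 2) :
    toHerm b * toHermInv a - toHerm a * toHermInv b =
      (2 * Complex.I * S) • (toHerm N * toHermInv c) := by
  have h := toHerm_triple a b c
  rw [hca, hcb, mul_zero, zero_smul, zero_smul, add_zero, sub_zero,
    ← smul_normal_eq_tripleProduct hN hNa hNb hNc hca hcb hcc hdet hS hS2, toHerm_smul] at h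
  have h2 := congrArg (· * toHermInv c) h
  simp only [mul_assoc, toHerm_mul_toHermInv hcc, mul_one] at h2
  rw [h2, ← Complex.coe_smul, smul_smul, Matrix.smul_mul]

end LorentzAlgebra

end CMCFace

namespace CMCFace

open Filter Topology Set
open scoped Matrix.Norms.Operator

/-! ### Mean curvature 1 as the closedness of `∂g g⁻¹`. -/

section Closedness

/-- `toHerm` as a continuous linear map. -/
noncomputable def toHermCLM : (Fin 4 → ℝ) →L[ℝ] Matrix (Fin 2) (Fin 2) ℂ :=
  LinearMap.toContinuousLinearMap ⟨⟨toHerm, toHerm_add⟩, toHerm_smul⟩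

/-- `toHermInv` as a continuous linear map. -/
noncomputable def toHermInvCLM : (Fin 4 → ℝ) →L[ℝ] Matrix (Fin 2) (Fin 2) ℂ :=
  LinearMap.toContinuousLinearMap ⟨⟨toHermInv, toHermInv_add⟩, toHermInv_smul⟩

@[simp] theorem toHermCLM_apply (x : Fin 4 → ℝ) : toHermCLM x = toHerm x := rfl

/-- The partial derivative `∂ᵢ u`. -/
noncomputable def pderiv {E : Type*} [NormedAddCommGroup E] [NormedSpace ℝ E] (i : Fin 2)
    (u : Plane → E) (x : Plane) : E := fderiv ℝ u x (bvec i)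

theorem _root_.DifferentiableAt.hasDerivAt_line {E : Type*} [NormedAddCommGroup E]
    [NormedSpace ℝ E] {u : Plane → E} {y : Plane} (hu : DifferentiableAt ℝ u y) (i : Fin 2) :
    HasDerivAt (fun t : ℝ => u (y + t • bvec i)) (pderiv i u y) 0 := by
  have h1 : HasDerivAt (fun t : ℝ => y + t • bvec i) (bvec i) 0 := by
    simpa using ((hasDerivAt_id (0 : ℝ)).smul_const (bvec i)).const_add y
  have h2 : HasFDerivAt u (fderiv ℝ u y) (y + (0 : ℝ) • bvec i) := by
    simpa using hu.hasFDerivAt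
  exact HasFDerivAt.comp_hasDerivAt (f := fun t : ℝ => y + t • bvec i) (0 : ℝ) h2 h1

theorem tendsto_line (y w : Plane) : Tendsto (fun t : ℝ => y + t • w) (𝓝 0) (𝓝 y) := by
  have : Continuous fun t : ℝ => y + t • w := by fun_prop
  simpa using this.tendsto 0

theorem hasDerivAt_lorentz {u v : ℝ → Fin 4 → ℝ} {u' v' : Fin 4 → ℝ} {t : ℝ}
    (hu : HasDerivAt u u' t) (hv : HasDerivAt v v' t) :
    HasDerivAt (fun t => lorentz (u t) (v t)) (lorentz u' (v t) + lorentz (u t) v') t := by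
  have hu := hasDerivAt_pi.1 hu
  have hv := hasDerivAt_pi.1 hv
  have := (((((hu 0).mul (hv 0)).neg).add ((hu 1).mul (hv 1))).add ((hu 2).mul (hv 2))).add
    ((hu 3).mul (hv 3))
  refine (this.congr_deriv ?_)
  simp only [lorentz]
  ring

/-- The entries of the induced metric. -/
noncomputable def gram (g : Plane → Fin 4 → ℝ) (i j : Fin 2) (x : Plane) : ℝ :=
  lorentz (pderiv i g x) (pderiv j g x)

/-- A unimodular representative of a conformal class of metrics: the entries of its matrix. -/
structure ConfClass where
  a : Plane → ℝ
  b : Plane → ℝ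
  c : Plane → ℝ

/-- The first component of the Hodge star of `dg`. -/
noncomputable def ConfClass.star₁ (h : ConfClass) (g : Plane → Fin 4 → ℝ) (x : Plane) :
    Fin 4 → ℝ := h.b x • pderiv 0 g x - h.a x • pderiv 1 g x

/-- The second component of the Hodge star of `dg`. -/
noncomputable def ConfClass.star₂ (h : ConfClass) (g : Plane → Fin 4 → ℝ) (x : Plane) :
    Fin 4 → ℝ := h.c x • pderiv 0 g x - h.b x • pderiv 1 g x

/-- The pointwise content of the CMC 1 condition. -/
structure CMC1At (h : ConfClass) (g : Plane → Fin 4 → ℝ) (y : Plane) : Prop where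
  smooth : ContDiffAt ℝ 2 g y
  unit : ∀ᶠ x in 𝓝 y, lorentz (g x) (g x) = 1
  diff_a : DifferentiableAt ℝ h.a y
  diff_b : DifferentiableAt ℝ h.b y
  diff_c : DifferentiableAt ℝ h.c y
  pos : 0 < h.a y
  det : ∀ᶠ x in 𝓝 y, h.a x * h.c x - h.b x ^ 2 = 1
  conf : ∀ᶠ x in 𝓝 y, ∃ s : ℝ, 0 < s ∧ gram g 0 0 x = s * h.a x ∧ gram g 0 1 x = s * h.b x ∧
    gram g 1 1 x = s * h.c x
  normal : ∃ N : Fin 4 → ℝ, lorentz N N = -1 ∧ lorentz N (g y) = 0 ∧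
    (∀ i, lorentz N (pderiv i g y) = 0) ∧ 0 < Matrix.det ![N, pderiv 0 g y, pderiv 1 g y, g y] ∧
    gram g 1 1 y * lorentz (pderiv 0 (pderiv 0 g) y) N
      - 2 * gram g 0 1 y * lorentz (pderiv 0 (pderiv 1 g) y) N
      + gram g 0 0 y * lorentz (pderiv 1 (pderiv 1 g) y) N
      = 2 * (gram g 0 0 y * gram g 1 1 y - gram g 0 1 y ^ 2)

theorem differentiableAt_pderiv {E : Type*} [NormedAddCommGroup E] [NormedSpace ℝ E]
    {g : Plane → E} {y : Plane} (hg : ContDiffAt ℝ 2 g y) (i : Fin 2) :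
    DifferentiableAt ℝ (pderiv i g) y :=
  ((hg.fderiv_right (m := 1) (by norm_num)).differentiableAt one_ne_zero).clm_apply
    (differentiableAt_const _)

theorem pderiv_comm {E : Type*} [NormedAddCommGroup E] [NormedSpace ℝ E]
    {g : Plane → E} {y : Plane} (hg : ContDiffAt ℝ 2 g y) (i j : Fin 2) :
    pderiv i (pderiv j g) y = pderiv j (pderiv i g) y := by
  have hd : DifferentiableAt ℝ (fderiv ℝ g) y :=
    (hg.fderiv_right (m := 1) (by norm_num)).differentiableAt one_ne_zero
  have h1 : ∀ i j, pderiv i (pderiv j g) y = fderiv ℝ (fderiv ℝ g) y (bvec i) (bvec j) := by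
    intro i j
    have := (hd.hasFDerivAt.clm_apply (hasFDerivAt_const (bvec j) y)).fderiv
    simp only [pderiv]
    change fderiv ℝ (fun x => fderiv ℝ g x (bvec j)) y (bvec i) = _
    rw [this]
    simp
  rw [h1, h1]
  exact (hg.isSymmSndFDerivAt (by simp)).eq _ _

theorem lorentz_pderiv_self {g : Plane → Fin 4 → ℝ} {x : Plane} (hg : DifferentiableAt ℝ g x)
    (h1 : ∀ᶠ x in 𝓝 x, lorentz (g x) (g x) = 1) (i : Fin 2) : lorentz (pderiv i g x) (g x) = 0 := by
  have h := hasDerivAt_lorentz (hg.hasDerivAt_line i) (hg.hasDerivAt_line i)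
  have h0 := (hasDerivAt_const (0 : ℝ) (1 : ℝ)).congr_of_eventuallyEq
    (((tendsto_line x (bvec i)).eventually h1).mono fun t ht => ht)
  have := h.unique h0
  simp only [zero_smul, add_zero] at this
  rw [lorentz_comm (g x)] at this
  linarith

/-- The Hodge Laplacian of a CMC 1 immersion. -/
theorem CMC1At.laplacian {h : ConfClass} {g : Plane → Fin 4 → ℝ} {y : Plane} (H : CMC1At h g y) :
    ∃ (N : Fin 4 → ℝ) (S : ℝ), 0 < S ∧ gram g 0 0 y = S * h.a y ∧ gram g 0 1 y = S * h.b y ∧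
      gram g 1 1 y = S * h.c y ∧
      toHerm (pderiv 1 g y) * toHermInv (pderiv 0 g y)
        - toHerm (pderiv 0 g y) * toHermInv (pderiv 1 g y) =
        (2 * Complex.I * S) • (toHerm N * toHermInv (g y)) ∧ lorentz N N = -1 ∧
      pderiv 0 (h.star₂ g) y - pderiv 1 (h.star₁ g) y = -(2 * S) • (N + g y) := by
  obtain ⟨N, hN, hNg, hNp, hdet, hH⟩ := H.normal
  have hgd : DifferentiableAt ℝ g y := H.smooth.differentiableAt (by norm_num)
  have hpd := fun i => differentiableAt_pderiv H.smooth i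
  have hline : ∀ i, Tendsto (fun t : ℝ => y + t • bvec i) (𝓝 0) (𝓝 y) := fun i => tendsto_line y _
  have hpg : ∀ i, lorentz (pderiv i g y) (g y) = 0 := fun i => lorentz_pderiv_self hgd H.unit i
  have hppg : ∀ k i, lorentz (pderiv k (pderiv i g) y) (g y) = -gram g i k y := by
    intro k i
    have hev : ∀ᶠ x in 𝓝 y, lorentz (pderiv i g x) (g x) = 0 := by
      have hsm : ∀ᶠ x in 𝓝 y, ContDiffAt ℝ 2 g x := H.smooth.eventually (by simp)
      filter_upwards [hsm, eventually_eventually_nhds.2 H.unit] with x h1 h2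
      exact lorentz_pderiv_self (h1.differentiableAt (by norm_num)) h2 i
    have h1 := hasDerivAt_lorentz ((hpd i).hasDerivAt_line k) (hgd.hasDerivAt_line k)
    have h0 := (hasDerivAt_const (0 : ℝ) (0 : ℝ)).congr_of_eventuallyEq
      (((hline k).eventually hev).mono fun t ht => ht)
    have := h1.unique h0
    simp only [zero_smul, add_zero] at this
    unfold gram
    linarith
  have hgramd : ∀ i j k, HasDerivAt (fun t : ℝ => gram g i j (y + t • bvec k))
      (lorentz (pderiv k (pderiv i g) y) (pderiv j g y)
        + lorentz (pderiv i g y) (pderiv k (pderiv j g) y)) 0 := by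
    intro i j k
    have h1 := hasDerivAt_lorentz ((hpd i).hasDerivAt_line k) ((hpd j).hasDerivAt_line k)
    simp only [zero_smul, add_zero] at h1
    exact h1
  obtain ⟨S, hS, hSa, hSb, hSc⟩ := H.conf.self_of_nhds
  have hdety := H.det.self_of_nhds
  have hS2 : S ^ 2 = gram g 0 0 y * gram g 1 1 y - gram g 0 1 y ^ 2 := by
    rw [hSa, hSb, hSc]
    linear_combination (-S ^ 2) * hdety
  -- differentiate the conformality relations
  have hrel : ∀ k, ∃ s' : ℝ,
      lorentz (pderiv k (pderiv 0 g) y) (pderiv 0 g y) * 2 = s' * h.a y + S * pderiv k h.a y ∧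
      lorentz (pderiv k (pderiv 0 g) y) (pderiv 1 g y)
        + lorentz (pderiv k (pderiv 1 g) y) (pderiv 0 g y) = s' * h.b y + S * pderiv k h.b y ∧
      lorentz (pderiv k (pderiv 1 g) y) (pderiv 1 g y) * 2 = s' * h.c y + S * pderiv k h.c y ∧
      pderiv k h.a y * h.c y + h.a y * pderiv k h.c y - 2 * h.b y * pderiv k h.b y = 0 := by
    intro k
    have ha := H.diff_a.hasDerivAt_line k
    have hb := H.diff_b.hasDerivAt_line k
    have hc := H.diff_c.hasDerivAt_line k
    have hay : h.a (y + (0 : ℝ) • bvec k) ≠ 0 := by simpa using H.pos.ne'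
    -- The conformal factor is differentiable because it is the quotient of `gram g 0 0` by `h.a`.
    -- Its derivative `s'` cancels from the tangential part of the Laplacian.
    have hs := (hgramd 0 0 k).div ha hay
    set s' := ((lorentz (pderiv k (pderiv 0 g) y) (pderiv 0 g y)
        + lorentz (pderiv 0 g y) (pderiv k (pderiv 0 g) y)) * h.a (y + (0 : ℝ) • bvec k)
        - gram g 0 0 (y + (0 : ℝ) • bvec k) * pderiv k h.a y) / h.a (y + (0 : ℝ) • bvec k) ^ 2
    have hSy : gram g 0 0 (y + (0 : ℝ) • bvec k) / h.a (y + (0 : ℝ) • bvec k) = S := by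
      rw [div_eq_iff hay]
      simpa using hSa
    have hev : ∀ᶠ x in 𝓝 y, gram g 0 0 x = (gram g 0 0 x / h.a x) * h.a x ∧
        gram g 0 1 x = (gram g 0 0 x / h.a x) * h.b x ∧
        gram g 1 1 x = (gram g 0 0 x / h.a x) * h.c x := by
      filter_upwards [H.conf, H.diff_a.continuousAt.eventually_ne H.pos.ne'] with x ⟨s, _, h1, h2, h3⟩
        h4
      have : gram g 0 0 x / h.a x = s := by rw [h1]; field_simp
      rw [this]
      exact ⟨h1, h2, h3⟩
    have hev := (hline k).eventually hev
    refine ⟨s', ?_, ?_, ?_, ?_⟩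
    · have := (hgramd 0 0 k).unique ((hs.mul ha).congr_of_eventuallyEq (hev.mono fun t ht => ht.1))
      rw [Pi.div_apply, hSy] at this
      simp only [zero_smul, add_zero] at this
      rw [lorentz_comm (pderiv 0 g y)] at this
      linarith
    · have := (hgramd 0 1 k).unique ((hs.mul hb).congr_of_eventuallyEq (hev.mono fun t ht => ht.2.1))
      rw [Pi.div_apply, hSy] at this
      simp only [zero_smul, add_zero] at this
      rw [lorentz_comm (pderiv 0 g y)] at this
      linarith
    · have := (hgramd 1 1 k).unique ((hs.mul hc).congr_of_eventuallyEq (hev.mono fun t ht => ht.2.2))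
      rw [Pi.div_apply, hSy] at this
      simp only [zero_smul, add_zero] at this
      rw [lorentz_comm (pderiv 1 g y)] at this
      linarith
    · have h1 := (ha.mul hc).sub (hb.pow 2)
      have h0 := (hasDerivAt_const (0 : ℝ) (1 : ℝ)).congr_of_eventuallyEq
        (((hline k).eventually H.det).mono fun t ht => ht)
      have := h1.unique h0
      simp only [zero_smul, add_zero] at this
      simp at this
      linarith
  have hV : pderiv 0 (h.star₂ g) y - pderiv 1 (h.star₁ g) y =
      (pderiv 0 h.c y - pderiv 1 h.b y) • pderiv 0 g y
        + (pderiv 1 h.a y - pderiv 0 h.b y) • pderiv 1 g y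
        + h.c y • pderiv 0 (pderiv 0 g) y - (2 * h.b y) • pderiv 0 (pderiv 1 g) y
        + h.a y • pderiv 1 (pderiv 1 g) y := by
    have e2 : DifferentiableAt ℝ (h.star₂ g) y :=
      (H.diff_c.smul (hpd 0)).sub (H.diff_b.smul (hpd 1))
    have e1 : DifferentiableAt ℝ (h.star₁ g) y :=
      (H.diff_b.smul (hpd 0)).sub (H.diff_a.smul (hpd 1))
    have d2 := (e2.hasDerivAt_line 0).unique
      (((H.diff_c.hasDerivAt_line 0).smul ((hpd 0).hasDerivAt_line 0)).sub
        ((H.diff_b.hasDerivAt_line 0).smul ((hpd 1).hasDerivAt_line 0)))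
    have d1 := (e1.hasDerivAt_line 1).unique
      (((H.diff_b.hasDerivAt_line 1).smul ((hpd 0).hasDerivAt_line 1)).sub
        ((H.diff_a.hasDerivAt_line 1).smul ((hpd 1).hasDerivAt_line 1)))
    rw [d1, d2, pderiv_comm H.smooth 1 0]
    simp only [zero_smul, add_zero]
    module
  refine ⟨N, S, hS, hSa, hSb, hSc, ?_, hN, ?_⟩
  · refine toHerm_commutator_eq_normal hN (hNp 0) (hNp 1) hNg ?_ ?_ H.unit.self_of_nhds hdet hS hS2
    · rw [lorentz_comm]; exact hpg 0
    · rw [lorentz_comm]; exact hpg 1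
  · rw [hV, ← sub_eq_zero]
    obtain ⟨s0, a1, a2, a3, a4⟩ := hrel 0
    obtain ⟨s1, b1, b2, b3, b4⟩ := hrel 1
    rw [pderiv_comm H.smooth 1 0] at b1 b2
    rw [hS2.symm, hSa, hSb, hSc] at hH
    have hg00 : lorentz (pderiv 0 g y) (pderiv 0 g y) = S * h.a y := hSa
    have hg01 : lorentz (pderiv 0 g y) (pderiv 1 g y) = S * h.b y := hSb
    have hg10 : lorentz (pderiv 1 g y) (pderiv 0 g y) = S * h.b y := by rw [lorentz_comm]; exact hSb
    have hg11 : lorentz (pderiv 1 g y) (pderiv 1 g y) = S * h.c y := hSc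
    -- Pairing with `N` is the mean curvature equation. The two tangential pairings vanish by the
    -- differentiated conformality relations together with the derivative of `ac - b² = 1`. Pairing
    -- with `g` gives the curvature term of de Sitter space.
    apply eq_zero_of_lorentz_eq_zero hdet.ne' <;>
      simp only [lorentz_sub_left, lorentz_add_left, lorentz_smul_left, hpg, hppg, hN, hNg, hNp,
        hg00, hg01, hg10, hg11]
    · rw [lorentz_comm (pderiv 0 g y), lorentz_comm (pderiv 1 g y), hNp, hNp, lorentz_comm (g y),
        hNg]
      have : S * (h.c y * lorentz (pderiv 0 (pderiv 0 g) y) N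
        - 2 * h.b y * lorentz (pderiv 0 (pderiv 1 g) y) N
        + h.a y * lorentz (pderiv 1 (pderiv 1 g) y) N) = S * (2 * S) := by linear_combination hH
      have := mul_left_cancel₀ hS.ne' this
      linear_combination this
    · rw [lorentz_comm (g y), hpg]
      linear_combination (h.c y / 2) * a1 - h.b y * b1 + h.a y * b2 - (h.a y / 2) * a3
        + (S / 2) * a4
    · rw [lorentz_comm (g y), hpg]
      linear_combination h.c y * a2 - (h.c y / 2) * b1 - h.b y * a3 + (h.a y / 2) * b3
        + (S / 2) * b4
    · have hg10' : gram g 1 0 y = S * h.b y := hg10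
      rw [hSa, hg10', hSc, H.unit.self_of_nhds]
      linear_combination (-2 * S) * hdety

theorem toHerm_sub (x y : Fin 4 → ℝ) : toHerm (x - y) = toHerm x - toHerm y :=
  map_sub toHermCLM x y

theorem toHerm_ne_zero {x : Fin 4 → ℝ} (hx : x ≠ 0) : toHerm x ≠ 0 := by
  intro h
  apply hx
  apply toHerm_injective
  rw [h]
  exact (map_zero toHermCLM).symm

/-- The first component of the form `½ (dg + i ε ⋆dg) g⁻¹`. -/
noncomputable def ConfClass.form₁ (h : ConfClass) (g : Plane → Fin 4 → ℝ) (ε : ℂ) (x : Plane) :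
    Matrix (Fin 2) (Fin 2) ℂ :=
  (1 / 2 : ℂ) • ((toHerm (pderiv 0 g x) + (ε * Complex.I) • toHerm (h.star₁ g x)) *
    toHermInv (g x))

/-- The second component of the form `½ (dg + i ε ⋆dg) g⁻¹`. -/
noncomputable def ConfClass.form₂ (h : ConfClass) (g : Plane → Fin 4 → ℝ) (ε : ℂ) (x : Plane) :
    Matrix (Fin 2) (Fin 2) ℂ :=
  (1 / 2 : ℂ) • ((toHerm (pderiv 1 g x) + (ε * Complex.I) • toHerm (h.star₂ g x)) *
    toHermInv (g x))

theorem hasDerivAt_toHerm_line {u : Plane → Fin 4 → ℝ} {y : Plane} (hu : DifferentiableAt ℝ u y)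
    (k : Fin 2) :
    HasDerivAt (fun t : ℝ => toHerm (u (y + t • bvec k))) (toHerm (pderiv k u y)) 0 :=
  (toHermCLM.hasFDerivAt).comp_hasDerivAt (0 : ℝ) (hu.hasDerivAt_line k)

theorem hasDerivAt_toHermInv_line {u : Plane → Fin 4 → ℝ} {y : Plane}
    (hu : DifferentiableAt ℝ u y) (k : Fin 2) :
    HasDerivAt (fun t : ℝ => toHermInv (u (y + t • bvec k))) (toHermInv (pderiv k u y)) 0 :=
  (toHermInvCLM.hasFDerivAt).comp_hasDerivAt (0 : ℝ) (hu.hasDerivAt_line k)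

theorem pderiv_form {v w g : Plane → Fin 4 → ℝ} {y : Plane} (hv : DifferentiableAt ℝ v y)
    (hw : DifferentiableAt ℝ w y) (hg : DifferentiableAt ℝ g y) (ε : ℂ) (k : Fin 2) :
    DifferentiableAt ℝ (fun x => (1 / 2 : ℂ) • ((toHerm (v x) + (ε * Complex.I) • toHerm (w x)) *
      toHermInv (g x))) y ∧
    pderiv k (fun x => (1 / 2 : ℂ) • ((toHerm (v x) + (ε * Complex.I) • toHerm (w x)) *
      toHermInv (g x))) y =
    (1 / 2 : ℂ) • ((toHerm (pderiv k v y) + (ε * Complex.I) • toHerm (pderiv k w y)) *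
      toHermInv (g y) +
      (toHerm (v y) + (ε * Complex.I) • toHerm (w y)) * toHermInv (pderiv k g y)) := by
  have e1 : DifferentiableAt ℝ (fun x => toHerm (v x)) y := toHermCLM.differentiableAt.comp y hv
  have e2 : DifferentiableAt ℝ (fun x => toHerm (w x)) y := toHermCLM.differentiableAt.comp y hw
  have e3 : DifferentiableAt ℝ (fun x => toHermInv (g x)) y :=
    toHermInvCLM.differentiableAt.comp y hg
  have e : DifferentiableAt ℝ (fun x => (1 / 2 : ℂ) • ((toHerm (v x) + (ε * Complex.I) •
      toHerm (w x)) * toHermInv (g x))) y :=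
    ((e1.add (e2.const_smul (ε * Complex.I))).mul e3).const_smul (1 / 2 : ℂ)
  refine ⟨e, ?_⟩
  have h1 := (((hasDerivAt_toHerm_line hv k).add
    ((hasDerivAt_toHerm_line hw k).const_smul (ε * Complex.I))).mul
      (hasDerivAt_toHermInv_line hg k)).const_smul (1 / 2 : ℂ)
  have h2 := (e.hasDerivAt_line k).unique h1
  rw [h2]
  simp

theorem CMC1At.differentiableAt_star {h : ConfClass} {g : Plane → Fin 4 → ℝ} {y : Plane}
    (H : CMC1At h g y) :
    DifferentiableAt ℝ (h.star₁ g) y ∧ DifferentiableAt ℝ (h.star₂ g) y :=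
  ⟨(H.diff_b.smul (differentiableAt_pderiv H.smooth 0)).sub
      (H.diff_a.smul (differentiableAt_pderiv H.smooth 1)),
    (H.diff_c.smul (differentiableAt_pderiv H.smooth 0)).sub
      (H.diff_b.smul (differentiableAt_pderiv H.smooth 1))⟩

/-- The exterior derivative of `½ (dg + i ε ⋆dg) g⁻¹` for a CMC 1 immersion. -/
theorem CMC1At.curl_form {h : ConfClass} {g : Plane → Fin 4 → ℝ} {y : Plane} (H : CMC1At h g y) :
    ∃ (N : Fin 4 → ℝ) (S : ℝ), 0 < S ∧ lorentz N N = -1 ∧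
      ∀ ε, pderiv 0 (h.form₂ g ε) y - pderiv 1 (h.form₁ g ε) y =
        (Complex.I * S * (1 - ε)) • (toHerm N * toHermInv (g y)) := by
  obtain ⟨N, S, hS, ha, hb, hc, hK, hN, hV⟩ := H.laplacian
  refine ⟨N, S, hS, hN, fun ε => ?_⟩
  have hg : DifferentiableAt ℝ g y := H.smooth.differentiableAt (by norm_num)
  have hpd := fun i => differentiableAt_pderiv H.smooth i
  have h2 := (pderiv_form (hpd 1) H.differentiableAt_star.2 hg ε 0).2
  have h1 := (pderiv_form (hpd 0) H.differentiableAt_star.1 hg ε 1).2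
  change pderiv 0 (h.form₂ g ε) y = _ at h2
  change pderiv 1 (h.form₁ g ε) y = _ at h1
  rw [h1, h2, pderiv_comm H.smooth 1 0]
  have hV' : toHerm (pderiv 0 (h.star₂ g) y) - toHerm (pderiv 1 (h.star₁ g) y) =
      (-(2 * S) : ℝ) • (toHerm N + toHerm (g y)) := by
    have := congrArg toHermCLM hV
    simpa only [map_sub, map_smul, map_add, toHermCLM_apply] using this
  have hVQ := congrArg (· * toHermInv (g y)) hV'
  simp only [sub_mul, smul_mul_assoc, add_mul, toHerm_mul_toHermInv H.unit.self_of_nhds] at hVQ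
  -- Three terms make up the exterior derivative. The Laplacian contributes `-2S (N g⁻¹ + 1)`, the
  -- product of `⋆dg` with `d(g⁻¹)` contributes `2S`, which cancels the identity, and the commutator
  -- contributes `2i S N g⁻¹`. Weighted by `iε`, `iε` and `1` they combine to the factor `1 - ε`.
  have hst : toHerm (h.star₂ g y) * toHermInv (pderiv 0 g y)
      - toHerm (h.star₁ g y) * toHermInv (pderiv 1 g y) = ((2 * S : ℝ) : ℂ) • 1 := by
    have e2 : toHerm (h.star₂ g y) = h.c y • toHerm (pderiv 0 g y) - h.b y • toHerm (pderiv 1 g y) := by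
      rw [ConfClass.star₂, toHerm_sub, toHerm_smul, toHerm_smul]
    have e1 : toHerm (h.star₁ g y) = h.b y • toHerm (pderiv 0 g y) - h.a y • toHerm (pderiv 1 g y) := by
      rw [ConfClass.star₁, toHerm_sub, toHerm_smul, toHerm_smul]
    have q00 := toHerm_mul_toHermInv_add (pderiv 0 g y) (pderiv 0 g y)
    have q01 := toHerm_mul_toHermInv_add (pderiv 0 g y) (pderiv 1 g y)
    have q11 := toHerm_mul_toHermInv_add (pderiv 1 g y) (pderiv 1 g y)
    change _ = ((2 * gram g 0 0 y : ℝ) : ℂ) • _ at q00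
    change _ = ((2 * gram g 0 1 y : ℝ) : ℂ) • _ at q01
    change _ = ((2 * gram g 1 1 y : ℝ) : ℂ) • _ at q11
    rw [Complex.coe_smul] at q00 q01 q11 ⊢
    rw [ha] at q00
    rw [hb] at q01
    rw [hc] at q11
    have hdet := H.det.self_of_nhds
    rw [e1, e2, sub_mul, sub_mul, smul_mul_assoc, smul_mul_assoc, smul_mul_assoc, smul_mul_assoc]
    have : (h.c y • (toHerm (pderiv 0 g y) * toHermInv (pderiv 0 g y)) -
        h.b y • (toHerm (pderiv 1 g y) * toHermInv (pderiv 0 g y))) -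
        (h.b y • (toHerm (pderiv 0 g y) * toHermInv (pderiv 1 g y)) -
        h.a y • (toHerm (pderiv 1 g y) * toHermInv (pderiv 1 g y))) =
        (h.c y / 2) • (toHerm (pderiv 0 g y) * toHermInv (pderiv 0 g y) +
          toHerm (pderiv 0 g y) * toHermInv (pderiv 0 g y)) -
        h.b y • (toHerm (pderiv 0 g y) * toHermInv (pderiv 1 g y) +
          toHerm (pderiv 1 g y) * toHermInv (pderiv 0 g y)) +
        (h.a y / 2) • (toHerm (pderiv 1 g y) * toHermInv (pderiv 1 g y) +
          toHerm (pderiv 1 g y) * toHermInv (pderiv 1 g y)) := by module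
    rw [this, q00, q01, q11, smul_smul, smul_smul, smul_smul, ← sub_smul, ← add_smul]
    congr 1
    linear_combination (2 * S) * hdet
  rw [← Complex.coe_smul] at hVQ
  have key : ∀ (A B C D E F P Q R T U : Matrix (Fin 2) (Fin 2) ℂ) (c : ℂ),
      A - B = (c : ℂ) • (P + 1) → C - D = (-c) • 1 → E - F = Q →
      (1 / 2 : ℂ) • ((R + (ε * Complex.I) • A) + (E + (ε * Complex.I) • C)) -
      (1 / 2 : ℂ) • ((R + (ε * Complex.I) • B) + (F + (ε * Complex.I) • D)) =
      (1 / 2 : ℂ) • ((ε * Complex.I * c) • P + Q) := by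
    intro A B C D E F P Q R T U c h1 h2 h3
    rw [sub_eq_iff_eq_add.1 h1, sub_eq_iff_eq_add.1 h2, sub_eq_iff_eq_add.1 h3]
    module
  simp only [add_mul, smul_mul_assoc]
  rw [key _ _ _ _ _ _ (toHerm N * toHermInv (g y)) _ _ 0 0 (-(2 * S) : ℝ) hVQ (by
    rw [hst]; push_cast; ring_nf) hK]
  push_cast
  module

theorem CMC1At.closed {h : ConfClass} {g : Plane → Fin 4 → ℝ} {y : Plane} (H : CMC1At h g y) :
    pderiv 0 (h.form₂ g 1) y = pderiv 1 (h.form₁ g 1) y := by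
  obtain ⟨N, S, -, -, h1⟩ := H.curl_form
  have := h1 1
  rwa [sub_self, mul_zero, zero_smul, sub_eq_zero] at this

/-- At `ε = -1` the exterior derivative is `2i S N g⁻¹`, nonzero because `N ≠ 0` and `g` is
invertible. This asymmetry between the two signs is what lets a null lift detect the orientation. -/
theorem CMC1At.not_closed {h : ConfClass} {g : Plane → Fin 4 → ℝ} {y : Plane} (H : CMC1At h g y) :
    pderiv 0 (h.form₂ g (-1)) y ≠ pderiv 1 (h.form₁ g (-1)) y := by
  obtain ⟨N, S, hS, hN, h1⟩ := H.curl_form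
  intro h0
  have h2 := h1 (-1)
  rw [sub_eq_zero.2 h0] at h2
  have hS' : (S : ℂ) ≠ 0 := by exact_mod_cast hS.ne'
  have h3 := (smul_eq_zero.1 h2.symm).resolve_left
    (mul_ne_zero (mul_ne_zero Complex.I_ne_zero hS') (by norm_num))
  have h4 := congrArg (· * toHerm (g y)) h3
  simp only [mul_assoc, toHermInv_mul_toHerm H.unit.self_of_nhds, mul_one, zero_mul] at h4
  refine toHerm_ne_zero (x := N) ?_ h4
  rintro rfl
  simp [lorentz] at hN

end Closedness

end CMCFace

namespace CMCFace

open Filter Topology Set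
open scoped Matrix.Norms.Operator

/-! ### Holomorphic linear differential equations. -/

section LinearODE

/-- Local solutions of the holomorphic linear differential equation `F' = A F`. -/
theorem exists_hasDerivAt_linear {𝔸 : Type*} [NormedRing 𝔸] [NormedAlgebra ℂ 𝔸] [CompleteSpace 𝔸]
    {A : ℂ → 𝔸} {U : Set ℂ} (hU : IsOpen U) {z₀ : ℂ} (hz₀ : z₀ ∈ U) (hA : DifferentiableOn ℂ A U)
    (F₀ : 𝔸) : ∃ r > 0, Metric.ball z₀ r ⊆ U ∧ ∃ F : ℂ → 𝔸, F z₀ = F₀ ∧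
      ∀ z ∈ Metric.ball z₀ r, HasDerivAt F (A z * F z) z := by
  have hAc : ContinuousAt A z₀ := (hA.differentiableAt (hU.mem_nhds hz₀)).continuousAt
  set K : ℝ := ‖A z₀‖ + 1 with hK
  have hKpos : 0 < K := by positivity
  have hbd : ∀ᶠ z in 𝓝 z₀, ‖A z‖ < K := hAc.norm.eventually_lt_const (by rw [hK]; linarith)
  obtain ⟨r₀, hr₀, hr₀U⟩ := Metric.eventually_nhds_iff_ball.1 (hbd.and (hU.mem_nhds hz₀))
  -- With `K r ≤ 1 / 2` each integration on the disc at least halves the norm, so the Picard series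
  -- is dominated by a geometric one.
  set r := min r₀ (1 / (2 * K)) with hr
  have hrpos : 0 < r := lt_min hr₀ (by positivity)
  have hrK : K * r ≤ 1 / 2 := by
    have : r ≤ 1 / (2 * K) := min_le_right _ _
    calc K * r ≤ K * (1 / (2 * K)) := by gcongr
      _ = 1 / 2 := by field_simp
  have hball : ∀ z ∈ Metric.ball z₀ r, ‖A z‖ < K ∧ z ∈ U := fun z hz =>
    hr₀U z (Metric.ball_subset_ball (min_le_left _ _) hz)
  have hz₀b : z₀ ∈ Metric.ball z₀ r := Metric.mem_ball_self hrpos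
  -- Holomorphy is placed under the existential so that `choose` yields an integration operator
  -- defined on all functions, which can be iterated.
  have hprim : ∀ G : ℂ → 𝔸, ∃ P : ℂ → 𝔸, DifferentiableOn ℂ G (Metric.ball z₀ r) →
      P z₀ = 0 ∧ ∀ z ∈ Metric.ball z₀ r, HasDerivAt P (A z * G z) z := by
    intro G
    by_cases hG : DifferentiableOn ℂ G (Metric.ball z₀ r)
    · have hAG : DifferentiableOn ℂ (fun z => A z * G z) (Metric.ball z₀ r) :=
        (hA.mono fun z hz => (hball z hz).2).mul hG
      obtain ⟨P, h1⟩ := hAG.isExactOn_ball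
      exact ⟨fun z => P z - P z₀, fun _ => ⟨sub_self _, fun z hz => (h1 z hz).sub_const _⟩⟩
    · exact ⟨0, fun h => absurd h hG⟩
  choose T hT using hprim
  -- These are the Picard increments: each is the primitive of `A` times the preceding one that
  -- vanishes at `z₀`, and their sum is the solution.
  let Fn : ℕ → ℂ → 𝔸 := fun n => n.rec (fun _ => F₀) (fun _ G => T G)
  have hFn : ∀ n, DifferentiableOn ℂ (Fn n) (Metric.ball z₀ r) := by
    intro n
    induction n with
    | zero => exact differentiableOn_const _
    | succ n ih => exact fun z hz => ((hT _ ih).2 z hz).differentiableAt.differentiableWithinAt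
  have hFd : ∀ n, ∀ z ∈ Metric.ball z₀ r, HasDerivAt (Fn (n + 1)) (A z * Fn n z) z :=
    fun n => (hT _ (hFn n)).2
  have hF0 : ∀ n, Fn (n + 1) z₀ = 0 := fun n => (hT _ (hFn n)).1
  have hFb : ∀ n, ∀ z ∈ Metric.ball z₀ r, ‖Fn n z‖ ≤ ‖F₀‖ * (1 / 2) ^ n := by
    intro n
    induction n with
    | zero => intro z _; simp [Fn]
    | succ n ih =>
      intro z hz
      have hc : ∀ w ∈ Metric.ball z₀ r, ‖A w * Fn n w‖ ≤ K * (‖F₀‖ * (1 / 2) ^ n) := fun w hw =>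
        (norm_mul_le _ _).trans (mul_le_mul (hball w hw).1.le (ih w hw) (norm_nonneg _) hKpos.le)
      have h1 := (convex_ball z₀ r).norm_image_sub_le_of_norm_hasDerivWithin_le
        (fun w hw => (hFd n w hw).hasDerivWithinAt) hc hz₀b hz
      rw [hF0, sub_zero] at h1
      have hzr : ‖z - z₀‖ ≤ r := by
        rw [← dist_eq_norm]; exact (Metric.mem_ball.1 hz).le
      calc ‖Fn (n + 1) z‖ ≤ K * (‖F₀‖ * (1 / 2) ^ n) * r := h1.trans (by gcongr)
        _ = (K * r) * (‖F₀‖ * (1 / 2) ^ n) := by ring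
        _ ≤ (1 / 2) * (‖F₀‖ * (1 / 2) ^ n) := by gcongr
        _ = _ := by ring
  have hsum : Summable fun n : ℕ => ‖F₀‖ * (1 / 2 : ℝ) ^ n :=
    (summable_geometric_of_lt_one (by norm_num) (by norm_num)).mul_left _
  have hsz : ∀ z ∈ Metric.ball z₀ r, Summable fun n => Fn n z := fun z hz =>
    Summable.of_norm_bounded hsum fun n => hFb n z hz
  refine ⟨r, hrpos, fun z hz => (hball z hz).2, fun z => ∑' n, Fn n z, ?_, ?_⟩
  · dsimp only
    refine (tsum_eq_single 0 fun n hn => ?_).trans rfl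
    obtain ⟨m, rfl⟩ := Nat.exists_eq_succ_of_ne_zero hn
    exact hF0 m
  · intro z hz
    have h1 : HasDerivAt (fun w => ∑' n, Fn (n + 1) w) (∑' n, A z * Fn n z) z := by
      refine hasDerivAt_tsum_of_isPreconnected (u := fun n => K * (‖F₀‖ * (1 / 2 : ℝ) ^ n))
        (hsum.mul_left K) Metric.isOpen_ball (convex_ball z₀ r).isPreconnected
        (fun n w hw => hFd n w hw) (fun n w hw => (norm_mul_le _ _).trans
          (mul_le_mul (hball w hw).1.le (hFb n w hw) (norm_nonneg _) hKpos.le)) hz₀b ?_ hz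
      simp only [hF0]
      exact summable_zero
    rw [(hsz z hz).tsum_mul_left] at h1
    refine (h1.const_add F₀).congr_of_eventuallyEq ?_
    filter_upwards [Metric.isOpen_ball.mem_nhds hz] with w hw
    exact (hsz w hw).tsum_eq_zero_add

end LinearODE

/-! ### Transitivity of `SL(2, ℂ)` on de Sitter space. -/

section Factorization

theorem mul_e₃_mul_conjTranspose (α β γ δ : ℂ) :
    !![α, β; γ, δ] * e₃ * (!![α, β; γ, δ])ᴴ =
      !![α * star α - β * star β, α * star γ - β * star δ;
        γ * star α - δ * star β, γ * star γ - δ * star δ] := by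
  ext i j
  fin_cases i <;> fin_cases j <;> simp [e₃, Matrix.mul_apply] <;> ring

/-- A point of de Sitter space is of the form `F e₃ F^*`. -/
theorem exists_eq_mul_e₃_mul {x : Fin 4 → ℝ} (hx : lorentz x x = 1) :
    ∃ F : Matrix (Fin 2) (Fin 2) ℂ, F.det = 1 ∧ toHerm x = F * e₃ * Fᴴ := by
  obtain ⟨p, hp⟩ : ∃ p : ℝ, p = x 0 + x 3 := ⟨_, rfl⟩
  obtain ⟨q, hq⟩ : ∃ q : ℝ, q = x 0 - x 3 := ⟨_, rfl⟩
  obtain ⟨w, hw⟩ : ∃ w : ℂ, w = x 1 + Complex.I * x 2 := ⟨_, rfl⟩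
  have hw' : star w = x 1 - Complex.I * x 2 := by
    rw [hw]; simp [sub_eq_add_neg]
  have hX : toHerm x = !![(p : ℂ), w; star w, (q : ℂ)] := by
    rw [hw', hw, hp, hq]; push_cast; rfl
  have hpq : (p : ℂ) * q = w * star w - 1 := by
    have h1 : p * q = x 1 ^ 2 + x 2 ^ 2 - 1 := by
      simp only [lorentz] at hx
      rw [hp, hq]
      linarith
    have h2 : w * star w = ((x 1 ^ 2 + x 2 ^ 2 : ℝ) : ℂ) := by
      rw [hw', hw]; push_cast; linear_combination (-(x 2 : ℂ) ^ 2) * Complex.I_sq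
    rw [h2]
    exact_mod_cast h1
  rw [hX]
  -- If the corner entry `p` is nonzero, elimination gives a factor with a zero in the first row;
  -- the entry `√|p|` goes in the column to which `e₃` gives the sign of `p`. If `p = 0` then `|w| =
  -- 1`, and a first row `(u, u)` with `u² = -w` makes the corner vanish.
  rcases lt_trichotomy p 0 with h | h | h
  · obtain ⟨s, hs, hs2⟩ : ∃ s : ℝ, 0 < s ∧ s * s = -p :=
      ⟨√(-p), Real.sqrt_pos.2 (by linarith), Real.mul_self_sqrt (by linarith)⟩
    have hs0 : (s : ℂ) ≠ 0 := by exact_mod_cast hs.ne'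
    have hp0 : (p : ℂ) = -(s * s) := by
      have : p = -(s * s) := by linarith
      rw [this]; push_cast; ring
    have hss : star (s : ℂ) = s := Complex.conj_ofReal s
    refine ⟨!![0, (s : ℂ); -(s : ℂ)⁻¹, -star w / s], ?_, ?_⟩
    · rw [Matrix.det_fin_two_of]
      field_simp
      ring
    · rw [mul_e₃_mul_conjTranspose]
      simp only [star_zero, star_neg, star_div₀, star_inv₀, hss, star_star]
      rw [hp0] at hpq ⊢
      have hq' : (q : ℂ) = (1 - w * star w) / (s * s) := by
        field_simp
        linear_combination -hpq
      rw [hq']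
      congr 1
      ext i j
      fin_cases i <;> fin_cases j <;> simp <;> field_simp
  · rw [h, Complex.ofReal_zero, zero_mul] at hpq
    have hww : w * star w = 1 := by linear_combination -hpq
    obtain ⟨u, hu⟩ := IsAlgClosed.exists_pow_nat_eq (-w) two_pos
    have huu : u * star u = 1 := by
      have h1 : (u * star u) ^ 2 = 1 := by
        rw [mul_pow, ← star_pow, hu, star_neg]
        linear_combination hww
      have h2 : u * star u = ((Complex.normSq u : ℝ) : ℂ) := Complex.mul_conj u
      rw [h2] at h1 ⊢
      have h3 : Complex.normSq u ^ 2 = 1 := by exact_mod_cast h1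
      have h4 := (pow_eq_one_iff_of_nonneg (Complex.normSq_nonneg u) two_ne_zero).1 h3
      exact_mod_cast h4
    have hqq : star (q : ℂ) = q := Complex.conj_ofReal q
    have hw2 : w = -u ^ 2 := by rw [hu, neg_neg]
    refine ⟨!![u, u; -(q + 1) / 2 * star u, -(q + 1) / 2 * star u + star u], ?_, ?_⟩
    · rw [Matrix.det_fin_two_of]
      linear_combination huu
    · rw [mul_e₃_mul_conjTranspose]
      simp only [star_mul', star_add, star_div₀, star_neg, star_one, star_star, hqq, star_ofNat]
      rw [h, hw2]
      simp only [star_neg, star_pow]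
      congr 1
      ext i j
      fin_cases i <;> fin_cases j <;> simp
      · ring
      · ring
      · have huu' : u * (starRingEnd ℂ) u = 1 := huu
        linear_combination (-q : ℂ) * huu'
  · obtain ⟨s, hs, hs2⟩ : ∃ s : ℝ, 0 < s ∧ s * s = p :=
      ⟨√p, Real.sqrt_pos.2 h, Real.mul_self_sqrt h.le⟩
    have hs0 : (s : ℂ) ≠ 0 := by exact_mod_cast hs.ne'
    have hp0 : (p : ℂ) = s * s := by rw [← hs2]; push_cast; ring
    have hss : star (s : ℂ) = s := Complex.conj_ofReal s
    refine ⟨!![(s : ℂ), 0; star w / s, (s : ℂ)⁻¹], ?_, ?_⟩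
    · rw [Matrix.det_fin_two_of]
      field_simp
      ring
    · rw [mul_e₃_mul_conjTranspose]
      simp only [star_zero, star_div₀, star_inv₀, hss, star_star]
      rw [hp0] at hpq ⊢
      have hq' : (q : ℂ) = (w * star w - 1) / (s * s) := by
        field_simp
        linear_combination hpq
      rw [hq']
      congr 1
      ext i j
      fin_cases i <;> fin_cases j <;> simp <;> field_simp

end Factorization

end CMCFace

namespace CMCFace

open Filter Topology Set
open scoped Matrix.Norms.Operator

/-! ### The closed (1,0)-form of a planar face. -/

section PlanarFace

/-- A CMC 1 face in the coordinate domain `U`, with conformal class `h`, which is of class `C¹`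
across the singular set; `V` is the set of regular points. -/
structure PlanarFace (h : ConfClass) (g : Plane → Fin 4 → ℝ) (U V : Set Plane) : Prop where
  isOpen : IsOpen U
  dense : U ⊆ closure V
  smooth_g : ContDiffOn ℝ ∞ g U
  smooth_a : ContDiffOn ℝ 1 h.a U
  smooth_b : ContDiffOn ℝ 1 h.b U
  smooth_c : ContDiffOn ℝ 1 h.c U
  pos : ∀ x ∈ U, 0 < h.a x
  det : ∀ x ∈ U, h.a x * h.c x - h.b x ^ 2 = 1
  unit : ∀ x ∈ U, lorentz (g x) (g x) = 1
  cmc : ∀ x ∈ U ∩ V, CMC1At h g x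

/-- The slope of the conformal class: the forms of type `(1,0)` are the multiples of
`dx₀ + μ dx₁`. -/
noncomputable def ConfClass.slope (h : ConfClass) (x : Plane) : ℂ := (h.b x + Complex.I) / h.a x

theorem ContDiffOn.pderiv {E : Type*} [NormedAddCommGroup E] [NormedSpace ℝ E] {u : Plane → E}
    {U : Set Plane} (hU : IsOpen U) {m n : ℕ∞ω} (hu : ContDiffOn ℝ n u U) (hmn : m + 1 ≤ n)
    (i : Fin 2) : ContDiffOn ℝ m (pderiv i u) U :=
  (hu.fderiv_of_isOpen hU hmn).clm_apply contDiffOn_const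

theorem eqOn_of_dense {X E : Type*} [TopologicalSpace X] [TopologicalSpace E] [T2Space E]
    {u v : X → E} {U V : Set X} (hU : IsOpen U) (hd : U ⊆ closure V) (hu : ContinuousOn u U)
    (hv : ContinuousOn v U) (h : ∀ x ∈ U ∩ V, u x = v x) : ∀ x ∈ U, u x = v x := by
  intro x hx
  have hcl : x ∈ closure (U ∩ V) := by
    rw [mem_closure_iff_nhds]
    intro t ht
    obtain ⟨z, hz⟩ := mem_closure_iff_nhds.1 (hd hx) (t ∩ U) (inter_mem ht (hU.mem_nhds hx))
    exact ⟨z, hz.1.1, hz.1.2, hz.2⟩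
  have : (𝓝[U ∩ V] x).NeBot := mem_closure_iff_nhdsWithin_neBot.1 hcl
  refine tendsto_nhds_unique_of_eventuallyEq ((hu.continuousAt (hU.mem_nhds hx)).mono_left
    (nhdsWithin_le_nhds (s := U ∩ V))) ((hv.continuousAt (hU.mem_nhds hx)).mono_left
    nhdsWithin_le_nhds) ?_
  filter_upwards [self_mem_nhdsWithin] with z hz using h z hz

variable {h : ConfClass} {g : Plane → Fin 4 → ℝ} {U V : Set Plane}

/-- The forms inherit the regularity of the conformal class: `n = 1` at first, and `n = ∞` once the
class is known to be smooth. -/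
theorem PlanarFace.contDiffOn_form (H : PlanarFace h g U V) {n : ℕ∞ω} (hn : n ≤ ∞)
    (ha : ContDiffOn ℝ n h.a U) (hb : ContDiffOn ℝ n h.b U) (hc : ContDiffOn ℝ n h.c U) (ε : ℂ) :
    ContDiffOn ℝ n (h.form₁ g ε) U ∧ ContDiffOn ℝ n (h.form₂ g ε) U := by
  have hn1 : n + 1 ≤ ∞ := by
    calc n + 1 ≤ ∞ + 1 := by gcongr
      _ = ∞ := rfl
  have hp : ∀ i, ContDiffOn ℝ n (pderiv i g) U := fun i =>
    ContDiffOn.pderiv H.isOpen H.smooth_g hn1 i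
  have hQ : ContDiffOn ℝ n (fun x => toHermInv (g x)) U :=
    toHermInvCLM.contDiff.comp_contDiffOn (H.smooth_g.of_le hn)
  have hT : ∀ {u : Plane → Fin 4 → ℝ}, ContDiffOn ℝ n u U →
      ContDiffOn ℝ n (fun x => toHerm (u x)) U := fun hu => toHermCLM.contDiff.comp_contDiffOn hu
  exact ⟨(((hT (hp 0)).add ((hT ((hb.smul (hp 0)).sub (ha.smul (hp 1)))).const_smul
      (ε * Complex.I))).mul hQ).const_smul (1 / 2 : ℂ),
    (((hT (hp 1)).add ((hT ((hc.smul (hp 0)).sub (hb.smul (hp 1)))).const_smul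
      (ε * Complex.I))).mul hQ).const_smul (1 / 2 : ℂ)⟩

/-- The coefficients are `C¹` across the singular set, so both sides are continuous, and they agree
at the dense set of regular points. -/
theorem PlanarFace.closed (H : PlanarFace h g U V) : ∀ x ∈ U,
    pderiv 0 (h.form₂ g 1) x = pderiv 1 (h.form₁ g 1) x := by
  obtain ⟨h1, h2⟩ := H.contDiffOn_form (n := 1) (by norm_cast)
    H.smooth_a H.smooth_b H.smooth_c 1
  exact eqOn_of_dense H.isOpen H.dense
    (ContDiffOn.pderiv (m := 0) H.isOpen h2 (by simp) 0).continuousOn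
    (ContDiffOn.pderiv (m := 0) H.isOpen h1 (by simp) 1).continuousOn
    fun x hx => (H.cmc x hx).closed

theorem PlanarFace.conf (H : PlanarFace h g U V) : ∀ x ∈ U, ∃ s : ℝ, 0 ≤ s ∧
    gram g 0 0 x = s * h.a x ∧ gram g 0 1 x = s * h.b x ∧ gram g 1 1 x = s * h.c x := by
  have hp : ∀ i, ContinuousOn (pderiv i g) U := fun i =>
    (ContDiffOn.pderiv (m := 0) H.isOpen H.smooth_g (by simp) i).continuousOn
  have hgr : ∀ i j, ContinuousOn (gram g i j) U := by
    intro i j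
    have h0 := fun k : Fin 4 => (continuous_apply k).comp_continuousOn (hp i)
    have h1 := fun k : Fin 4 => (continuous_apply k).comp_continuousOn (hp j)
    exact (((((h0 0).mul (h1 0)).neg).add ((h0 1).mul (h1 1))).add ((h0 2).mul (h1 2))).add
      ((h0 3).mul (h1 3))
  have hs : ContinuousOn (fun x => gram g 0 0 x / h.a x) U :=
    (hgr 0 0).div H.smooth_a.continuousOn fun x hx => (H.pos x hx).ne'
  have key : ∀ x ∈ U ∩ V, 0 ≤ gram g 0 0 x / h.a x ∧
      gram g 0 1 x = gram g 0 0 x / h.a x * h.b x ∧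
      gram g 1 1 x = gram g 0 0 x / h.a x * h.c x := by
    intro x hx
    obtain ⟨s, hs0, h1, h2, h3⟩ := (H.cmc x hx).conf.self_of_nhds
    have ha := H.pos x hx.1
    have : gram g 0 0 x / h.a x = s := by rw [h1]; field_simp
    rw [this]
    exact ⟨hs0.le, h2, h3⟩
  have hnonneg := eqOn_of_dense H.isOpen H.dense (hs.sup continuousOn_const) hs
    fun x hx => sup_eq_left.2 (key x hx).1
  intro x hx
  refine ⟨gram g 0 0 x / h.a x, ?_, ?_, ?_, ?_⟩
  · have := hnonneg x hx
    exact sup_eq_left.1 this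
  · rw [div_mul_cancel₀ _ (H.pos x hx).ne']
  · exact eqOn_of_dense H.isOpen H.dense (hgr 0 1) (hs.mul H.smooth_b.continuousOn)
      (fun x hx => (key x hx).2.1) x hx
  · exact eqOn_of_dense H.isOpen H.dense (hgr 1 1) (hs.mul H.smooth_c.continuousOn)
      (fun x hx => (key x hx).2.2) x hx

/-- This says that the form is of type (1,0); it rests on `ac = b² + 1`. -/
theorem ConfClass.form₂_eq {x : Plane} (ha : h.a x ≠ 0) (hdet : h.a x * h.c x - h.b x ^ 2 = 1) :
    h.form₂ g 1 x = h.slope x • h.form₁ g 1 x := by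
  have haC : (h.a x : ℂ) ≠ 0 := by exact_mod_cast ha
  have hdC : (h.a x : ℂ) * h.c x = h.b x ^ 2 + 1 := by
    have : h.a x * h.c x = h.b x ^ 2 + 1 := by linarith
    exact_mod_cast this
  rw [ConfClass.form₂, ConfClass.form₁, smul_comm, ← smul_mul_assoc (h.slope x)]
  congr 2
  rw [star₁, star₂, toHerm_sub, toHerm_sub, toHerm_smul, toHerm_smul, toHerm_smul, toHerm_smul]
  simp only [← Complex.coe_smul]
  have hc : (h.c x : ℂ) = (h.b x ^ 2 + 1) / h.a x := by
    rw [eq_div_iff haC, mul_comm]; exact hdC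
  rw [hc, slope]
  match_scalars
  · field_simp
    linear_combination Complex.I_sq
  · field_simp
    ring_nf
    simp

theorem trace_toHerm_mul_toHermInv (x y : Fin 4 → ℝ) :
    (toHerm x * toHermInv y).trace = ((2 * lorentz x y : ℝ) : ℂ) := by
  apply Complex.ext <;>
    simp [Matrix.trace_fin_two, toHerm, toHermInv, lorentz] <;> ring

theorem det_toHerm_add_I_smul (x y : Fin 4 → ℝ) :
    (toHerm x + Complex.I • toHerm y).det =
      -(lorentz x x - lorentz y y : ℝ) - 2 * Complex.I * lorentz x y := by
  rw [Matrix.det_fin_two]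
  apply Complex.ext <;> simp [toHerm, lorentz] <;> ring

theorem PlanarFace.lorentz_pderiv (H : PlanarFace h g U V) {x : Plane} (hx : x ∈ U) (i : Fin 2) :
    lorentz (pderiv i g x) (g x) = 0 :=
  lorentz_pderiv_self ((H.smooth_g.contDiffAt (H.isOpen.mem_nhds hx)).differentiableAt (by simp))
    (by filter_upwards [H.isOpen.mem_nhds hx] with z hz using H.unit z hz) i

theorem PlanarFace.trace_form₁ (H : PlanarFace h g U V) {x : Plane} (hx : x ∈ U) :
    (h.form₁ g 1 x).trace = 0 := by
  rw [ConfClass.form₁, Matrix.trace_smul, add_mul, smul_mul_assoc, Matrix.trace_add,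
    Matrix.trace_smul, trace_toHerm_mul_toHermInv, trace_toHerm_mul_toHermInv, ConfClass.star₁,
    lorentz_sub_left, lorentz_smul_left, lorentz_smul_left, H.lorentz_pderiv hx,
    H.lorentz_pderiv hx]
  simp

/-- Conformality: `∂₀g` and the first component of `⋆dg` are orthogonal with equal Lorentz squares,
so `∂g` is a null vector. Singular points are included, the conformal factor being allowed to
vanish. -/
theorem PlanarFace.det_form₁ (H : PlanarFace h g U V) {x : Plane} (hx : x ∈ U) :
    (h.form₁ g 1 x).det = 0 := by
  rw [ConfClass.form₁, Matrix.det_smul, Matrix.det_mul, one_mul, det_toHerm_add_I_smul]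
  obtain ⟨s, -, h00, h01, h11⟩ := H.conf x hx
  have h10 : lorentz (pderiv 1 g x) (pderiv 0 g x) = s * h.b x := by rw [lorentz_comm]; exact h01
  have hdet := H.det x hx
  have e1 : lorentz (pderiv 0 g x) (pderiv 0 g x) -
      lorentz (h.star₁ g x) (h.star₁ g x) = 0 := by
    have g00 : lorentz (pderiv 0 g x) (pderiv 0 g x) = s * h.a x := h00
    have g01 : lorentz (pderiv 0 g x) (pderiv 1 g x) = s * h.b x := h01
    have g11 : lorentz (pderiv 1 g x) (pderiv 1 g x) = s * h.c x := h11
    simp only [ConfClass.star₁, sub_eq_add_neg, ← neg_smul, lorentz_add_left, lorentz_smul_left,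
      lorentz_add_right, lorentz_smul_right, g00, g01, g11, h10]
    linear_combination (-s * h.a x) * hdet
  have e2 : lorentz (pderiv 0 g x) (h.star₁ g x) = 0 := by
    rw [lorentz_comm, ConfClass.star₁, lorentz_sub_left, lorentz_smul_left, lorentz_smul_left, h10]
    change h.b x * gram g 0 0 x - _ = 0
    rw [h00]
    ring
  rw [e1, e2]
  simp

/-- Adding the adjoint doubles the Hermitian part and cancels the part with the factor `i`. So the
(1,0)-form determines `dg`. -/
theorem form_decomp {u v f : Fin 4 → ℝ} (hf : lorentz f f = 1) :
    let Ω := (1 / 2 : ℂ) • ((toHerm u + ((1 : ℂ) * Complex.I) • toHerm v) * toHermInv f)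
    Ω * toHerm f + toHerm f * Ωᴴ = toHerm u := by
  intro Ω
  have h1 : Ω * toHerm f = (1 / 2 : ℂ) • (toHerm u + Complex.I • toHerm v) := by
    simp only [Ω, smul_mul_assoc, mul_assoc, toHermInv_mul_toHerm hf, mul_one, one_mul]
  have h2 : toHerm f * Ωᴴ = (1 / 2 : ℂ) • (toHerm u - Complex.I • toHerm v) := by
    have : (Ω * toHerm f)ᴴ = toHerm f * Ωᴴ := by
      rw [Matrix.conjTranspose_mul, toHerm_conjTranspose]
    rw [← this, h1]
    simp only [Matrix.conjTranspose_smul, Matrix.conjTranspose_add, toHerm_conjTranspose]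
    simp [sub_eq_add_neg]
  rw [h1, h2]
  module

/-- If one component vanished, so would its multiple, the other one, and then `dg = 0` by
`form_decomp`. At singular points this relies on the requirement `df ≠ 0`. -/
theorem PlanarFace.form₁_ne_zero (H : PlanarFace h g U V) {x : Plane} (hx : x ∈ U)
    (hd : ∃ i, pderiv i g x ≠ 0) : h.form₁ g 1 x ≠ 0 := by
  intro h0
  have e0 := form_decomp (u := pderiv 0 g x) (v := h.star₁ g x) (H.unit x hx)
  have e1 := form_decomp (u := pderiv 1 g x) (v := h.star₂ g x) (H.unit x hx)
  have h2 := ConfClass.form₂_eq (g := g) (H.pos x hx).ne' (H.det x hx)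
  rw [h0, smul_zero] at h2
  change h.form₁ g 1 x * _ + _ * (h.form₁ g 1 x)ᴴ = _ at e0
  change h.form₂ g 1 x * _ + _ * (h.form₂ g 1 x)ᴴ = _ at e1
  rw [h0] at e0
  rw [h2] at e1
  simp only [zero_mul, Matrix.conjTranspose_zero, mul_zero, add_zero] at e0 e1
  obtain ⟨i, hi⟩ := hd
  fin_cases i
  · exact toHerm_ne_zero hi e0.symm
  · exact toHerm_ne_zero hi e1.symm

/-- The one-form `u₀ dx₀ + u₁ dx₁`. -/
noncomputable def oneForm (u₀ u₁ : ℂ) : Plane →L[ℝ] ℂ :=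
  (EuclideanSpace.proj (0 : Fin 2) : Plane →L[ℝ] ℝ).smulRight u₀
    + (EuclideanSpace.proj (1 : Fin 2) : Plane →L[ℝ] ℝ).smulRight u₁

@[simp] theorem oneForm_apply (u₀ u₁ : ℂ) (v : Plane) : oneForm u₀ u₁ v = v 0 * u₀ + v 1 * u₁ := by
  simp [oneForm]

theorem plane_eq (v : Plane) : v = v 0 • bvec 0 + v 1 • bvec 1 := by
  ext i
  fin_cases i <;> simp [bvec]

theorem clm_plane_apply {E : Type*} [NormedAddCommGroup E] [NormedSpace ℝ E] (L : Plane →L[ℝ] E)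
    (v : Plane) : L v = v 0 • L (bvec 0) + v 1 • L (bvec 1) := by
  conv_lhs => rw [plane_eq v, map_add, map_smul, map_smul]

/-- The Poincaré lemma on a disc. -/
theorem exists_primitive {u₀ u₁ : Plane → ℂ} {y : Plane} {r : ℝ}
    (h0 : ∀ x ∈ Metric.ball y r, DifferentiableAt ℝ u₀ x)
    (h1 : ∀ x ∈ Metric.ball y r, DifferentiableAt ℝ u₁ x)
    (hcl : ∀ x ∈ Metric.ball y r, pderiv 0 u₁ x = pderiv 1 u₀ x) :
    ∃ φ : Plane → ℂ, ∀ x ∈ Metric.ball y r, HasFDerivAt φ (oneForm (u₀ x) (u₁ x)) x := by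
  let S := ContinuousLinearMap.smulRightL ℝ Plane ℂ
  let S₀ := S (EuclideanSpace.proj (0 : Fin 2))
  let S₁ := S (EuclideanSpace.proj (1 : Fin 2))
  have hder : ∀ x ∈ Metric.ball y r, HasFDerivAt (fun x => oneForm (u₀ x) (u₁ x))
      (S₀.comp (fderiv ℝ u₀ x) + S₁.comp (fderiv ℝ u₁ x)) x := by
    intro x hx
    have A₀ : HasFDerivAt (fun x => S₀ (u₀ x)) (S₀.comp (fderiv ℝ u₀ x)) x :=
      S₀.hasFDerivAt.comp x (h0 x hx).hasFDerivAt
    have A₁ : HasFDerivAt (fun x => S₁ (u₁ x)) (S₁.comp (fderiv ℝ u₁ x)) x :=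
      S₁.hasFDerivAt.comp x (h1 x hx).hasFDerivAt
    exact A₀.add A₁
  refine (convex_ball y r).exists_forall_hasFDerivAt_of_fderiv_symmetric Metric.isOpen_ball
    (fun x hx => (hder x hx).differentiableAt.differentiableWithinAt) fun x hx v w => ?_
  rw [(hder x hx).fderiv]
  have hcl := hcl x hx
  unfold pderiv at hcl
  change w 0 • fderiv ℝ u₀ x v + w 1 • fderiv ℝ u₁ x v =
    v 0 • fderiv ℝ u₀ x w + v 1 • fderiv ℝ u₁ x w
  rw [clm_plane_apply (fderiv ℝ u₀ x) v, clm_plane_apply (fderiv ℝ u₀ x) w,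
    clm_plane_apply (fderiv ℝ u₁ x) v, clm_plane_apply (fderiv ℝ u₁ x) w, hcl]
  module

/-- The entry of a matrix as a continuous linear map. -/
noncomputable def entryCLM (i j : Fin 2) : Matrix (Fin 2) (Fin 2) ℂ →L[ℝ] ℂ :=
  LinearMap.toContinuousLinearMap (Matrix.entryLinearMap ℝ ℂ i j)

theorem pderiv_entry {u : Plane → Matrix (Fin 2) (Fin 2) ℂ} {x : Plane}
    (hu : DifferentiableAt ℝ u x) (k i j : Fin 2) :
    pderiv k (fun x => u x i j) x = pderiv k u x i j := by
  have := ((entryCLM i j).hasFDerivAt.comp x hu.hasFDerivAt).fderiv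
  change fderiv ℝ (fun x => u x i j) x = _ at this
  rw [pderiv, this]
  rfl

theorem PlanarFace.exists_primitive (H : PlanarFace h g U V) {y : Plane} {r : ℝ}
    (hr : Metric.ball y r ⊆ U) (i j : Fin 2) :
    ∃ φ : Plane → ℂ, ∀ x ∈ Metric.ball y r,
      HasFDerivAt φ (oneForm (h.form₁ g 1 x i j) (h.form₂ g 1 x i j)) x := by
  obtain ⟨h1, h2⟩ := H.contDiffOn_form (n := 1) (by norm_cast)
    H.smooth_a H.smooth_b H.smooth_c 1
  have hd1 : ∀ x ∈ U, DifferentiableAt ℝ (h.form₁ g 1) x := fun x hx =>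
    (h1.contDiffAt (H.isOpen.mem_nhds hx)).differentiableAt one_ne_zero
  have hd2 : ∀ x ∈ U, DifferentiableAt ℝ (h.form₂ g 1) x := fun x hx =>
    (h2.contDiffAt (H.isOpen.mem_nhds hx)).differentiableAt one_ne_zero
  refine CMCFace.exists_primitive (u₀ := fun x => h.form₁ g 1 x i j)
    (u₁ := fun x => h.form₂ g 1 x i j)
    (fun x hx => (entryCLM i j).differentiableAt.comp x (hd1 x (hr hx)))
    (fun x hx => (entryCLM i j).differentiableAt.comp x (hd2 x (hr hx))) fun x hx => ?_
  rw [pderiv_entry (hd1 x (hr hx)), pderiv_entry (hd2 x (hr hx)), H.closed x (hr hx)]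

end PlanarFace

end CMCFace

namespace CMCFace

open Filter Topology Set
open scoped Matrix.Norms.Operator

/-! ### Isothermal coordinates and the local null lift. -/

section Coordinates

variable {h : ConfClass} {g : Plane → Fin 4 → ℝ} {U V : Set Plane}

theorem exists_oneForm_equiv {α μ : ℂ} (hα : α ≠ 0) (hμ : μ.im ≠ 0) :
    ∃ E : Plane ≃L[ℝ] ℂ, (E : Plane →L[ℝ] ℂ) = oneForm α (μ * α) := by
  have hinj : Function.Injective (oneForm α (μ * α) : Plane →ₗ[ℝ] ℂ) := by
    rw [injective_iff_map_eq_zero]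
    intro v hv
    have h1 : ((v 0 : ℂ) + v 1 * μ) * α = 0 := by
      have : oneForm α (μ * α) v = 0 := hv
      rw [oneForm_apply] at this
      linear_combination this
    have h2 := (mul_eq_zero.1 h1).resolve_right hα
    have him := congrArg Complex.im h2
    have hre := congrArg Complex.re h2
    simp at him hre
    have hv1 : v 1 = 0 := him.resolve_right hμ
    rw [hv1] at hre
    simp at hre
    rw [plane_eq v, hv1, hre]
    simp
  exact ⟨(LinearMap.linearEquivOfInjective _ hinj (by simp)).toContinuousLinearEquiv, by
    ext v; rfl⟩

theorem ConfClass.slope_im {x : Plane} : (h.slope x).im = 1 / h.a x := by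
  rw [slope, Complex.div_ofReal_im]
  simp

theorem contDiffOn_oneForm {u₀ u₁ : Plane → ℂ} {n : ℕ∞ω} {S : Set Plane}
    (h0 : ContDiffOn ℝ n u₀ S) (h1 : ContDiffOn ℝ n u₁ S) :
    ContDiffOn ℝ n (fun x => oneForm (u₀ x) (u₁ x)) S := by
  let T := ContinuousLinearMap.smulRightL ℝ Plane ℂ
  exact ((T (EuclideanSpace.proj (0 : Fin 2))).contDiff.comp_contDiffOn h0).add
    ((T (EuclideanSpace.proj (1 : Fin 2))).contDiff.comp_contDiffOn h1)

/-- `e` is a complex coordinate that is holomorphic with respect to the conformal class `h`; its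
differential is `α (dx₀ + μ dx₁)`. -/
structure IsHoloCoord (h : ConfClass) (e : OpenPartialHomeomorph Plane ℂ) (α : Plane → ℂ) :
    Prop where
  deriv : ∀ x ∈ e.source, HasFDerivAt e (oneForm (α x) (h.slope x * α x)) x
  ne_zero : ∀ x ∈ e.source, α x ≠ 0

/-- Existence of isothermal coordinates, from a primitive of the closed form `∂g g⁻¹`. -/
theorem PlanarFace.exists_coord (H : PlanarFace h g U V) {y : Plane} (hy : y ∈ U)
    (hd : ∃ i, pderiv i g y ≠ 0) {n : ℕ∞ω} (hn1 : 1 ≤ n) (hn : n ≤ ∞)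
    (ha : ContDiffOn ℝ n h.a U) (hb : ContDiffOn ℝ n h.b U) (hc : ContDiffOn ℝ n h.c U) :
    ∃ (e : OpenPartialHomeomorph Plane ℂ) (α : Plane → ℂ), y ∈ e.source ∧ e.source ⊆ U ∧
      IsHoloCoord h e α ∧ ContDiffOn ℝ n α e.source ∧ ContDiffOn ℝ n e e.source ∧
      ContDiffOn ℝ n e.symm e.target := by
  -- A nonzero entry of the closed (1,0)-form is locally `dφ`, and `φ` is the coordinate. No
  -- Beltrami equation has to be solved.
  obtain ⟨i, j, hij⟩ : ∃ i j, h.form₁ g 1 y i j ≠ 0 := by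
    by_contra hcon
    push Not at hcon
    exact H.form₁_ne_zero hy hd (by ext i j; exact hcon i j)
  obtain ⟨h1, h2⟩ := H.contDiffOn_form hn ha hb hc 1
  have h1' : ContDiffOn ℝ n (fun x => h.form₁ g 1 x i j) U :=
    (entryCLM i j).contDiff.comp_contDiffOn h1
  have h2' : ContDiffOn ℝ n (fun x => h.form₂ g 1 x i j) U :=
    (entryCLM i j).contDiff.comp_contDiffOn h2
  obtain ⟨r, hr, hrU⟩ := Metric.isOpen_iff.1 H.isOpen y hy
  obtain ⟨φ, hφ⟩ := H.exists_primitive hrU i j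
  set W : Set Plane := Metric.ball y r ∩ {x | h.form₁ g 1 x i j ≠ 0} with hW
  have hWo : IsOpen W :=
    (h1'.continuousOn.mono hrU).isOpen_inter_preimage Metric.isOpen_ball isOpen_ne
  have hyW : y ∈ W := ⟨Metric.mem_ball_self hr, hij⟩
  have hWU : W ⊆ U := fun x hx => hrU hx.1
  have hform : ∀ x ∈ W, h.form₂ g 1 x i j = h.slope x * h.form₁ g 1 x i j := fun x hx => by
    rw [ConfClass.form₂_eq (H.pos x (hWU hx)).ne' (H.det x (hWU hx))]
    rfl
  have hφW : ContDiffOn ℝ n φ W := by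
    have : ContDiffOn ℝ (n + 1) φ W := by
      rw [contDiffOn_succ_iff_fderiv_of_isOpen hWo]
      refine ⟨fun x hx => (hφ x hx.1).differentiableAt.differentiableWithinAt, ?_, ?_⟩
      · rintro rfl
        exact absurd hn (by simp)
      · exact (contDiffOn_oneForm (h1'.mono hWU) (h2'.mono hWU)).congr
          fun x hx => (hφ x hx.1).fderiv
    exact this.of_le le_self_add
  have hμ : (h.slope y).im ≠ 0 := by
    rw [ConfClass.slope_im]
    exact one_div_ne_zero (H.pos y hy).ne'
  obtain ⟨E, hE⟩ := exists_oneForm_equiv hij hμ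
  obtain ⟨e, hye, heW, heφ, hes⟩ := exists_openPartialHomeomorph_contDiffOn hn1 hWo hyW hφW E (by
    rw [hE, ← hform y hyW]
    exact hφ y hyW.1)
  have hcoe : (e : Plane → ℂ) = φ := funext heφ
  refine ⟨e, fun x => h.form₁ g 1 x i j, hye, heW.trans hWU, ⟨?_, ?_⟩, ?_, ?_, hes⟩
  · intro x hx
    rw [hcoe, ← hform x (heW hx)]
    exact hφ x (heW hx).1
  · exact fun x hx => (heW hx).2
  · exact h1'.mono (heW.trans hWU)
  · rw [hcoe]
    exact hφW.mono heW

theorem IsHoloCoord.exists_hasFDerivAt_symm {e : OpenPartialHomeomorph Plane ℂ} {α : Plane → ℂ}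
    (he : IsHoloCoord h e α) {z : ℂ} (hz : z ∈ e.target) (ha : 0 < h.a (e.symm z)) :
    ∃ T : ℂ →L[ℝ] Plane, HasFDerivAt e.symm T z ∧ ∀ ζ : ℂ,
      ((T ζ 0 : ℂ) + T ζ 1 * h.slope (e.symm z)) * α (e.symm z) = ζ := by
  have hx := e.map_target hz
  have hμ : (h.slope (e.symm z)).im ≠ 0 := by
    rw [ConfClass.slope_im]
    exact one_div_ne_zero ha.ne'
  obtain ⟨E, hE⟩ := exists_oneForm_equiv (he.ne_zero _ hx) hμ
  refine ⟨E.symm, e.hasFDerivAt_symm hz (by rw [hE]; exact he.deriv _ hx), fun ζ => ?_⟩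
  have h1 : (E : Plane →L[ℝ] ℂ) (E.symm ζ) = ζ := E.apply_symm_apply ζ
  rw [hE, oneForm_apply] at h1
  change ((E.symm ζ 0 : ℂ) + E.symm ζ 1 * h.slope (e.symm z)) * α (e.symm z) = ζ
  linear_combination h1

/-- A function whose differential is of type `(1,0)` is holomorphic in a holomorphic coordinate. -/
theorem IsHoloCoord.hasDerivAt_comp_symm {e : OpenPartialHomeomorph Plane ℂ} {α : Plane → ℂ}
    (he : IsHoloCoord h e α) {z : ℂ} (hz : z ∈ e.target) (ha : 0 < h.a (e.symm z)) {φ : Plane → ℂ}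
    {c : ℂ} (hφ : HasFDerivAt φ (oneForm c (h.slope (e.symm z) * c)) (e.symm z)) :
    HasDerivAt (φ ∘ e.symm) ((α (e.symm z))⁻¹ * c) z := by
  obtain ⟨T, hT, hTα⟩ := he.exists_hasFDerivAt_symm hz ha
  have h1 := hφ.comp z hT
  have hα := he.ne_zero _ (e.map_target hz)
  refine (hasFDerivAt_of_restrictScalars ℝ h1 ?_ : HasFDerivAt (φ ∘ e.symm)
    (ContinuousLinearMap.toSpanSingleton ℂ ((α (e.symm z))⁻¹ * c)) z)
  refine ContinuousLinearMap.ext fun ζ => ?_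
  change ζ * ((α (e.symm z))⁻¹ * c) = oneForm c (h.slope (e.symm z) * c) (T ζ)
  have h2 := hTα ζ
  rw [oneForm_apply]
  field_simp
  linear_combination (-c) * h2

theorem matrix_eq_sum (X : Matrix (Fin 2) (Fin 2) ℂ) :
    X = X 0 0 • Matrix.single 0 0 1 + X 0 1 • Matrix.single 0 1 1
      + X 1 0 • Matrix.single 1 0 1 + X 1 1 • Matrix.single 1 1 1 := by
  ext i j
  fin_cases i <;> fin_cases j <;> simp [Matrix.single]

theorem hasDerivAt_matrix {X : ℂ → Matrix (Fin 2) (Fin 2) ℂ} {X' : Matrix (Fin 2) (Fin 2) ℂ}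
    {z : ℂ} (hX : ∀ i j, HasDerivAt (fun z => X z i j) (X' i j) z) : HasDerivAt X X' z := by
  have h1 := ((((hX 0 0).smul_const (Matrix.single (0 : Fin 2) (0 : Fin 2) (1 : ℂ))).add
    ((hX 0 1).smul_const (Matrix.single (0 : Fin 2) (1 : Fin 2) (1 : ℂ)))).add
    ((hX 1 0).smul_const (Matrix.single (1 : Fin 2) (0 : Fin 2) (1 : ℂ)))).add
    ((hX 1 1).smul_const (Matrix.single (1 : Fin 2) (1 : Fin 2) (1 : ℂ)))
  rw [← matrix_eq_sum] at h1
  refine h1.congr_of_eventuallyEq (.of_forall fun z => ?_)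
  exact matrix_eq_sum (X z)

theorem HasDerivAt.entry {X : ℂ → Matrix (Fin 2) (Fin 2) ℂ} {X' : Matrix (Fin 2) (Fin 2) ℂ}
    {z : ℂ} (hX : HasDerivAt X X' z) (i j : Fin 2) : HasDerivAt (fun z => X z i j) (X' i j) z :=
  ((LinearMap.toContinuousLinearMap (Matrix.entryLinearMap ℂ ℂ i j)).hasFDerivAt).comp_hasDerivAt
    z hX

/-- The adjugate of a `2 × 2` matrix as a linear map. -/
noncomputable def adjCLM : Matrix (Fin 2) (Fin 2) ℂ →L[ℝ] Matrix (Fin 2) (Fin 2) ℂ :=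
  LinearMap.toContinuousLinearMap
    { toFun := Matrix.adjugate
      map_add' := fun X Y => by
        ext i j
        fin_cases i <;> fin_cases j <;> simp [Matrix.adjugate_fin_two] <;> ring
      map_smul' := fun c X => by
        ext i j
        fin_cases i <;> fin_cases j <;> simp [Matrix.adjugate_fin_two] }

/-- The conjugate transpose as a linear map. -/
noncomputable def starCLM : Matrix (Fin 2) (Fin 2) ℂ →L[ℝ] Matrix (Fin 2) (Fin 2) ℂ :=
  LinearMap.toContinuousLinearMap
    { toFun := Matrix.conjTranspose
      map_add' := Matrix.conjTranspose_add
      map_smul' := fun c X => by simp }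

theorem adjugate_eq_neg {A : Matrix (Fin 2) (Fin 2) ℂ} (hA : A.trace = 0) : A.adjugate = -A := by
  rw [Matrix.trace_fin_two] at hA
  ext i j
  fin_cases i <;> fin_cases j <;> simp [Matrix.adjugate_fin_two]
  · linear_combination hA
  · linear_combination hA

theorem eq_of_hasDerivAt_zero {E : Type*} [NormedAddCommGroup E] [NormedSpace ℝ E] {k : ℝ → E}
    (hk : ∀ t ∈ Icc (0 : ℝ) 1, HasDerivAt k 0 t) : k 1 = k 0 :=
  constant_of_has_deriv_right_zero (fun t ht => (hk t ht).continuousAt.continuousWithinAt)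
    (fun t ht => (hk t (Ico_subset_Icc_self ht)).hasDerivWithinAt) 1 (right_mem_Icc.2 zero_le_one)

/-- The local null lift of a CMC 1 face. -/
theorem PlanarFace.exists_lift (H : PlanarFace h g U V) {e : OpenPartialHomeomorph Plane ℂ}
    {α : Plane → ℂ} (he : IsHoloCoord h e α) (heU : e.source ⊆ U) {y : Plane}
    (hy : y ∈ e.source) : ∃ ρ > 0, Metric.ball (e y) ρ ⊆ e.target ∧
      ∃ F : ℂ → Matrix (Fin 2) (Fin 2) ℂ, ∀ z ∈ Metric.ball (e y) ρ,
        HasDerivAt F ((α (e.symm z))⁻¹ • h.form₁ g 1 (e.symm z) * F z) z ∧ (F z).det = 1 ∧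
        toHerm (g (e.symm z)) = F z * e₃ * (F z)ᴴ := by
  set A : ℂ → Matrix (Fin 2) (Fin 2) ℂ := fun z => (α (e.symm z))⁻¹ • h.form₁ g 1 (e.symm z) with hA
  obtain ⟨r, hr, hrs⟩ := Metric.isOpen_iff.1 e.open_source y hy
  set W := e.target ∩ e.symm ⁻¹' Metric.ball y r with hW
  have hWo : IsOpen W := e.isOpen_inter_preimage_symm Metric.isOpen_ball
  have hyW : e y ∈ W := ⟨e.map_source hy, by
    rw [mem_preimage, e.left_inv hy]; exact Metric.mem_ball_self hr⟩
  have hzU : ∀ z ∈ W, e.symm z ∈ U := fun z hz => heU (e.map_target hz.1)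
  -- Each entry of the form has a primitive that is holomorphic in the coordinate, and the
  -- corresponding entry of `A` is its derivative, hence holomorphic although the conformal class is
  -- merely `C¹`.
  have hAd : DifferentiableOn ℂ A W := by
    have hent : ∀ i j, DifferentiableOn ℂ (fun z => A z i j) W := by
      intro i j
      obtain ⟨φ, hφ⟩ := H.exists_primitive (hrs.trans heU) i j
      have hd : ∀ z ∈ W, HasDerivAt (φ ∘ e.symm) (A z i j) z := by
        intro z hz
        have h1 := hφ (e.symm z) hz.2
        rw [ConfClass.form₂_eq (H.pos _ (hzU z hz)).ne' (H.det _ (hzU z hz))] at h1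
        exact he.hasDerivAt_comp_symm hz.1 (H.pos _ (hzU z hz)) h1
      have hdd : DifferentiableOn ℂ (φ ∘ e.symm) W := fun z hz =>
        (hd z hz).differentiableAt.differentiableWithinAt
      exact (hdd.deriv hWo).congr fun z hz => (hd z hz).deriv.symm
    intro z hz
    exact (hasDerivAt_matrix (X' := Matrix.of fun i j => deriv (fun z => A z i j) z) fun i j =>
      ((hent i j).differentiableAt (hWo.mem_nhds hz)).hasDerivAt).differentiableAt.differentiableWithinAt
  obtain ⟨F₀, hF₀, hgF₀⟩ := exists_eq_mul_e₃_mul (H.unit y (heU hy))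
  obtain ⟨ρ, hρ, hρW, F, hFy, hF⟩ := exists_hasDerivAt_linear hWo hyW hAd F₀
  refine ⟨ρ, hρ, fun z hz => (hρW hz).1, F, ?_⟩
  have hAtr : ∀ z ∈ W, (A z).trace = 0 := fun z hz => by
    rw [hA, Matrix.trace_smul, H.trace_form₁ (hzU z hz), smul_zero]
  intro z hz
  set ζ := z - e y with hζ
  let γ : ℝ → ℂ := fun t => e y + t * ζ
  have hγ : ∀ t, HasDerivAt γ ζ t := fun t =>
    (((Complex.ofRealCLM.hasDerivAt (x := t)).mul_const ζ).const_add (e y)).congr_deriv (by simp)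
  have hγb : ∀ t ∈ Icc (0 : ℝ) 1, γ t ∈ Metric.ball (e y) ρ := by
    intro t ht
    rw [Metric.mem_ball, dist_eq_norm] at hz ⊢
    change ‖e y + t * ζ - e y‖ < ρ
    rw [add_sub_cancel_left, norm_mul, Complex.norm_real, Real.norm_of_nonneg ht.1]
    calc t * ‖ζ‖ ≤ 1 * ‖ζ‖ := by gcongr; exact ht.2
      _ < ρ := by rwa [one_mul]
  have hγ0 : γ 0 = e y := by simp [γ]
  have hγ1 : γ 1 = z := by simp [γ, hζ]
  have hFγ : ∀ t ∈ Icc (0 : ℝ) 1, HasDerivAt (fun t => F (γ t)) (ζ • (A (γ t) * F (γ t))) t :=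
    fun t ht => (hF _ (hγb t ht)).scomp t (hγ t)
  -- Since `A` is trace-free, `adj A = -A`, so the adjugate of `F` solves the adjoint equation. It
  -- stands in for `F⁻¹` before `det F = 1` is known, and it shows that `det F` is constant along
  -- the segment.
  have hadj : ∀ t ∈ Icc (0 : ℝ) 1, HasDerivAt (fun t => (F (γ t)).adjugate)
      (-(ζ • ((F (γ t)).adjugate * A (γ t)))) t := by
    intro t ht
    have h1 := adjCLM.hasFDerivAt.comp_hasDerivAt t (hFγ t ht)
    have h2 : adjCLM (ζ • (A (γ t) * F (γ t))) = -(ζ • ((F (γ t)).adjugate * A (γ t))) := by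
      change (ζ • (A (γ t) * F (γ t))).adjugate = _
      rw [Matrix.adjugate_smul, Matrix.adjugate_mul_distrib,
        adjugate_eq_neg (hAtr _ (hρW (hγb t ht)))]
      simp
    exact h1.congr_deriv h2
  have hdet : (F z) * (F z).adjugate = 1 := by
    have hk := eq_of_hasDerivAt_zero (k := fun t => F (γ t) * (F (γ t)).adjugate) (fun t ht => by
      have h1 := (hFγ t ht).mul (hadj t ht)
      have h2 : ζ • (A (γ t) * F (γ t)) * (F (γ t)).adjugate
          + F (γ t) * -(ζ • ((F (γ t)).adjugate * A (γ t))) = 0 := by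
        rw [mul_neg, smul_mul_assoc, mul_smul_comm, mul_assoc, Matrix.mul_adjugate, ← mul_assoc,
          Matrix.mul_adjugate]
        simp
      exact h1.congr_deriv h2)
    simp only [hγ0, hγ1, hFy] at hk
    rw [hk, Matrix.mul_adjugate, hF₀, one_smul]
  have hdetz : (F z).det = 1 := by
    have := congrFun (congrFun hdet 0) 0
    rw [Matrix.mul_adjugate] at this
    simpa using this
  refine ⟨hF z hz, hdetz, ?_⟩
  have hG : ∀ t ∈ Icc (0 : ℝ) 1, HasDerivAt (fun t => toHerm (g (e.symm (γ t))))
      (ζ • (A (γ t) * toHerm (g (e.symm (γ t))))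
        + (ζ • (A (γ t) * toHerm (g (e.symm (γ t)))))ᴴ) t := by
    intro t ht
    have hw := hρW (hγb t ht)
    have hu := hzU _ hw
    obtain ⟨T, hT, hTα⟩ := he.exists_hasFDerivAt_symm hw.1 (H.pos _ hu)
    have hgd : DifferentiableAt ℝ g (e.symm (γ t)) :=
      (H.smooth_g.contDiffAt (H.isOpen.mem_nhds hu)).differentiableAt (by simp)
    have h1 := toHermCLM.hasFDerivAt.comp_hasDerivAt t
      (hgd.hasFDerivAt.comp_hasDerivAt t (hT.comp_hasDerivAt t (hγ t)))
    have h2 : toHermCLM (fderiv ℝ g (e.symm (γ t)) (T ζ)) =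
        ζ • (A (γ t) * toHerm (g (e.symm (γ t))))
        + (ζ • (A (γ t) * toHerm (g (e.symm (γ t)))))ᴴ := by
      set x := e.symm (γ t) with hx
      have e0 := form_decomp (u := pderiv 0 g x) (v := h.star₁ g x) (H.unit x hu)
      have e1 := form_decomp (u := pderiv 1 g x) (v := h.star₂ g x) (H.unit x hu)
      change h.form₁ g 1 x * _ + _ * (h.form₁ g 1 x)ᴴ = _ at e0
      change h.form₂ g 1 x * _ + _ * (h.form₂ g 1 x)ᴴ = _ at e1
      rw [clm_plane_apply, map_add, map_smul, map_smul]
      change (T ζ) 0 • toHerm (pderiv 0 g x) + (T ζ) 1 • toHerm (pderiv 1 g x) = _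
      have hz1 : ζ • (A (γ t) * toHerm (g x)) =
          ((T ζ) 0 • h.form₁ g 1 x + (T ζ) 1 • h.form₂ g 1 x) * toHerm (g x) := by
        rw [← smul_mul_assoc]
        congr 1
        have hα := he.ne_zero _ (e.map_target hw.1)
        rw [hA, ConfClass.form₂_eq (H.pos _ hu).ne' (H.det _ hu), smul_smul]
        simp only [← Complex.coe_smul]
        rw [smul_smul, ← add_smul]
        congr 1
        exact (mul_inv_eq_iff_eq_mul₀ hα).2 (hTα ζ).symm
      rw [hz1, ← e0, ← e1, Matrix.conjTranspose_mul, toHerm_conjTranspose,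
        Matrix.conjTranspose_add, Matrix.conjTranspose_smul, Matrix.conjTranspose_smul]
      simp only [star_trivial, smul_add, add_mul, mul_add, smul_mul_assoc, mul_smul_comm]
      abel
    exact h1.congr_deriv h2
  -- In `F⁻¹ g F⁻*` the derivative `A g + (A g)*` of the middle factor cancels against the outer
  -- ones. The expression is constant, with value `e₃` at the centre by the choice of `F₀`.
  have hK := eq_of_hasDerivAt_zero
    (k := fun t => (F (γ t)).adjugate * toHerm (g (e.symm (γ t))) * ((F (γ t)).adjugate)ᴴ)
    (fun t ht => by
      have h0 := starCLM.hasFDerivAt.comp_hasDerivAt t (hadj t ht)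
      have h1 := ((hadj t ht).mul (hG t ht)).mul h0
      have h2 : ∀ (P B X : Matrix (Fin 2) (Fin 2) ℂ), Xᴴ = X → (-(ζ • (P * B)) * X
          + P * (ζ • (B * X) + (ζ • (B * X))ᴴ)) * Pᴴ + P * X * (-(ζ • (P * B)))ᴴ = 0 := by
        intro P B X hX
        simp only [Matrix.conjTranspose_smul, Matrix.conjTranspose_mul, Matrix.conjTranspose_neg,
          hX, smul_mul_assoc, mul_smul_comm, neg_mul, mul_neg, mul_add, add_mul, mul_assoc]
        abel
      have h3 := h2 (F (γ t)).adjugate (A (γ t)) _ (toHerm_conjTranspose (g (e.symm (γ t))))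
      change HasDerivAt _ ((-(ζ • ((F (γ t)).adjugate * A (γ t))) * toHerm (g (e.symm (γ t)))
        + (F (γ t)).adjugate * (ζ • (A (γ t) * toHerm (g (e.symm (γ t))))
        + (ζ • (A (γ t) * toHerm (g (e.symm (γ t)))))ᴴ)) * ((F (γ t)).adjugate)ᴴ
        + (F (γ t)).adjugate * toHerm (g (e.symm (γ t))) *
          (-(ζ • ((F (γ t)).adjugate * A (γ t))))ᴴ) t at h1
      exact h1.congr_deriv h3)
  simp only [hγ0, hγ1, hFy, e.left_inv hy] at hK
  have hF₀' : F₀.adjugate * F₀ = 1 := by rw [Matrix.adjugate_mul, hF₀, one_smul]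
  have hF₀s : F₀ᴴ * (F₀.adjugate)ᴴ = 1 := by
    rw [← Matrix.conjTranspose_mul, hF₀', Matrix.conjTranspose_one]
  have hrhs : F₀.adjugate * toHerm (g y) * (F₀.adjugate)ᴴ = e₃ := by
    rw [hgF₀]
    calc F₀.adjugate * (F₀ * e₃ * F₀ᴴ) * (F₀.adjugate)ᴴ
        = (F₀.adjugate * F₀) * e₃ * (F₀ᴴ * (F₀.adjugate)ᴴ) := by simp only [mul_assoc]
      _ = e₃ := by rw [hF₀', hF₀s, one_mul, mul_one]
  rw [hrhs] at hK
  have hsz : ((F z).adjugate)ᴴ * (F z)ᴴ = 1 := by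
    rw [← Matrix.conjTranspose_mul, hdet, Matrix.conjTranspose_one]
  rw [← hK]
  calc toHerm (g (e.symm z)) = (F z * (F z).adjugate) * toHerm (g (e.symm z)) *
        (((F z).adjugate)ᴴ * (F z)ᴴ) := by rw [hdet, hsz, one_mul, mul_one]
    _ = _ := by simp only [mul_assoc]

end Coordinates

end CMCFace

namespace CMCFace

open Filter Topology Set
open scoped Matrix.Norms.Operator

/-! ### The differential of `F e₃ F*` in terms of Weierstrass data. -/

section NullForms

/-- The Hermitian matrix `ζ F B e₃ Fᴴ + (ζ F B e₃ Fᴴ)ᴴ`: the differential of `F e₃ Fᴴ` in the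
direction `ζ`, where `B = F⁻¹ F'`. -/
noncomputable def nullForm (F B : Matrix (Fin 2) (Fin 2) ℂ) (ζ : ℂ) : Matrix (Fin 2) (Fin 2) ℂ :=
  ζ • (F * B * e₃ * Fᴴ) + (ζ • (F * B * e₃ * Fᴴ))ᴴ

theorem nullForm_mul (M F B : Matrix (Fin 2) (Fin 2) ℂ) (ζ : ℂ) :
    nullForm (M * F) B ζ = M * nullForm F B ζ * Mᴴ := by
  simp only [nullForm, Matrix.conjTranspose_smul, Matrix.conjTranspose_mul, mul_add, add_mul,
    mul_smul_comm, smul_mul_assoc, mul_assoc, Matrix.conjTranspose_conjTranspose]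

/-- The nilpotent matrix with column space spanned by `(γ, 1)`. -/
noncomputable def nilMatrix (w γ : ℂ) : Matrix (Fin 2) (Fin 2) ℂ :=
  !![w * γ, -(w * γ ^ 2); w, -(w * γ)]

/-- Trace and determinant zero leave two parameters. For `B = F⁻¹F'` they are the Weierstrass data:
`γ` is the secondary Gauss map. -/
theorem eq_nilMatrix {B : Matrix (Fin 2) (Fin 2) ℂ} (ht : B.trace = 0) (hd : B.det = 0)
    (hB : B 1 0 ≠ 0) : B = nilMatrix (B 1 0) (B 0 0 / B 1 0) := by
  rw [Matrix.trace_fin_two] at ht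
  rw [Matrix.det_fin_two] at hd
  have h1 : B 1 1 = -B 0 0 := by linear_combination ht
  have h2 : B 0 1 = -(B 0 0 ^ 2 / B 1 0) := by
    field_simp
    rw [h1] at hd
    linear_combination -hd
  ext i j
  fin_cases i <;> fin_cases j <;> simp [nilMatrix, h1, h2] <;> field_simp

open ComplexConjugate in
-- Splits off a rank one matrix, which is all that survives on `|γ| = 1`, from a multiple of `|γ|² -
-- 1`.
theorem nullForm_apply (F : Matrix (Fin 2) (Fin 2) ℂ) (w γ ζ : ℂ) (i j : Fin 2) :
    nullForm F (nilMatrix w γ) ζ i j =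
      (ζ * w * γ + conj (ζ * w * γ)) * ((F i 0 * γ + F i 1) * conj (F j 0 * γ + F j 1))
      - (γ * conj γ - 1) * (ζ * w * (F i 0 * γ + F i 1) * conj (F j 0)
        + conj (ζ * w) * F i 0 * conj (F j 0 * γ + F j 1)) := by
  simp [nullForm, nilMatrix, e₃, Matrix.mul_apply, Fin.sum_univ_two]
  ring

/-- Congruence by `F` preserves the determinant, so `F = 1` may be assumed. By `det_toHerm` this is
the metric `|w|² (|γ|² - 1)² |dz|²`. -/
theorem det_nullForm {F : Matrix (Fin 2) (Fin 2) ℂ} (hF : F.det = 1) (w γ ζ : ℂ) :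
    (nullForm F (nilMatrix w γ) ζ).det =
      -((Complex.normSq (ζ * w) * (Complex.normSq γ - 1) ^ 2 : ℝ) : ℂ) := by
  have h1 : (nullForm (F * 1) (nilMatrix w γ) ζ).det =
      (nullForm 1 (nilMatrix w γ) ζ).det := by
    rw [nullForm_mul, Matrix.det_mul, Matrix.det_mul, Matrix.det_conjTranspose, hF]
    simp
  rw [mul_one] at h1
  rw [h1, Matrix.det_fin_two]
  push_cast
  simp only [nullForm_apply, Complex.normSq_eq_conj_mul_self]
  simp
  ring

/-- The case `γ = ∞`: there the metric degenerates only if `B = 0`. -/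
theorem det_nullForm_of_eq_zero {F B : Matrix (Fin 2) (Fin 2) ℂ} (hF : F.det = 1)
    (ht : B.trace = 0) (hd : B.det = 0) (hB : B 1 0 = 0) (ζ : ℂ) :
    (nullForm F B ζ).det = -((Complex.normSq (ζ * B 0 1) : ℝ) : ℂ) := by
  have h1 : (nullForm (F * 1) B ζ).det = (nullForm 1 B ζ).det := by
    rw [nullForm_mul, Matrix.det_mul, Matrix.det_mul, Matrix.det_conjTranspose, hF]
    simp
  rw [mul_one] at h1
  rw [Matrix.trace_fin_two] at ht
  rw [Matrix.det_fin_two, hB] at hd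
  have h2 : B 1 1 = -B 0 0 := by linear_combination ht
  have h3 : B 0 0 = 0 := by
    rw [h2] at hd
    simpa using hd
  rw [h1, Matrix.det_fin_two, Complex.normSq_eq_conj_mul_self]
  simp [nullForm, e₃, Matrix.mul_apply, Fin.sum_univ_two, hB, h2, h3]
  ring

open ComplexConjugate in
/-- The factor of `|γ|² - 1` in the Wronskian of two entries of `nullForm`. -/
noncomputable def nullWronskian (F : Matrix (Fin 2) (Fin 2) ℂ) (w γ ζ ξ : ℂ) : ℂ :=
  let a : Fin 2 → ℂ := fun i => F i 0 * γ + F i 1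
  let P : ℂ → ℂ := fun ζ => ζ * w * γ + conj (ζ * w * γ)
  let E : ℂ → Fin 2 → Fin 2 → ℂ := fun ζ i j =>
    ζ * w * a i * conj (F j 0) + conj (ζ * w) * F i 0 * conj (a j)
  (γ * conj γ - 1) * (E ζ 1 1 * E ξ 0 1 - E ξ 1 1 * E ζ 0 1)
    - (P ζ * (a 1 * conj (a 1)) * E ξ 0 1 + P ξ * (a 0 * conj (a 1)) * E ζ 1 1
      - P ξ * (a 1 * conj (a 1)) * E ζ 0 1 - P ζ * (a 0 * conj (a 1)) * E ξ 1 1)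

/-- The rank one parts for `ζ` and `ξ` are multiples of the same matrix, so they cancel in the
Wronskian. It therefore has `|γ|² - 1` as a factor to the first power, whereas the metric has only
its square. -/
theorem wronskian_nullForm (F : Matrix (Fin 2) (Fin 2) ℂ) (w γ ζ ξ : ℂ) :
    nullForm F (nilMatrix w γ) ζ 1 1 * nullForm F (nilMatrix w γ) ξ 0 1
      - nullForm F (nilMatrix w γ) ξ 1 1 * nullForm F (nilMatrix w γ) ζ 0 1 =
      ((Complex.normSq γ - 1 : ℝ) : ℂ) * nullWronskian F w γ ζ ξ := by
  push_cast
  rw [Complex.normSq_eq_conj_mul_self]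
  simp only [nullForm_apply, nullWronskian, map_mul, map_add]
  ring

/-- For `F = 1` the cofactor is `2i γ (Im μ) |w|² |ζ|²`, so the Wronskian vanishes to no higher
order than `|γ|² - 1`. -/
theorem nullWronskian_one_ne_zero {w γ ζ μ : ℂ} (hw : w ≠ 0) (hγ : γ ≠ 0)
    (hζ : ζ ≠ 0) (hμ : μ.im ≠ 0) : nullWronskian 1 w γ ζ (μ * ζ) ≠ 0 := by
  have h2 : nullWronskian 1 w γ ζ (μ * ζ) =
      2 * Complex.I * γ * μ.im * (w * starRingEnd ℂ w * ζ * starRingEnd ℂ ζ) := by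
    have h3 : μ - starRingEnd ℂ μ = 2 * Complex.I * μ.im := by
      rw [Complex.sub_conj]; push_cast; ring
    have h4 : nullWronskian 1 w γ ζ (μ * ζ) =
        (μ - starRingEnd ℂ μ) * γ * (w * starRingEnd ℂ w * ζ * starRingEnd ℂ ζ) := by
      simp [nullWronskian]
      ring
    rw [h4, h3]
    ring
  rw [h2]
  have hI := Complex.I_ne_zero
  simp [hw, hζ, hμ, hγ]

theorem continuousAt_nullWronskian {X : Type*} [TopologicalSpace X] {x : X}
    {F : X → Matrix (Fin 2) (Fin 2) ℂ} {w γ ζ ξ : X → ℂ}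
    (hF : ∀ i j, ContinuousAt (fun x => F x i j) x) (hw : ContinuousAt w x)
    (hγ : ContinuousAt γ x) (hζ : ContinuousAt ζ x) (hξ : ContinuousAt ξ x) :
    ContinuousAt (fun x => nullWronskian (F x) (w x) (γ x) (ζ x) (ξ x)) x := by
  have hc : ∀ {u : X → ℂ}, ContinuousAt u x → ContinuousAt (fun x => starRingEnd ℂ (u x)) x :=
    fun hu => Complex.continuous_conj.continuousAt.comp hu
  have ha : ∀ i, ContinuousAt (fun x => F x i 0 * γ x + F x i 1) x := fun i =>
    ((hF i 0).mul hγ).add (hF i 1)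
  have hP : ∀ {u : X → ℂ}, ContinuousAt u x →
      ContinuousAt (fun x => u x * w x * γ x + starRingEnd ℂ (u x * w x * γ x)) x :=
    fun hu => ((hu.mul hw).mul hγ).add (hc ((hu.mul hw).mul hγ))
  have hE : ∀ {u : X → ℂ}, ContinuousAt u x → ∀ i j,
      ContinuousAt (fun x => u x * w x * (F x i 0 * γ x + F x i 1) * starRingEnd ℂ (F x j 0)
        + starRingEnd ℂ (u x * w x) * F x i 0 * starRingEnd ℂ (F x j 0 * γ x + F x j 1)) x :=
    fun hu i j => (((hu.mul hw).mul (ha i)).mul (hc (hF j 0))).add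
      (((hc (hu.mul hw)).mul (hF i 0)).mul (hc (ha j)))
  exact (((hγ.mul (hc hγ)).sub continuousAt_const).mul
      (((hE hζ 1 1).mul (hE hξ 0 1)).sub ((hE hξ 1 1).mul (hE hζ 0 1)))).sub
    (((((hP hζ).mul ((ha 1).mul (hc (ha 1)))).mul (hE hξ 0 1)).add
    (((hP hξ).mul ((ha 0).mul (hc (ha 1)))).mul (hE hζ 1 1))).sub
    (((hP hξ).mul ((ha 1).mul (hc (ha 1)))).mul (hE hζ 0 1)) |>.sub
    (((hP hζ).mul ((ha 0).mul (hc (ha 1)))).mul (hE hξ 1 1)))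

end NullForms

/-! ### Order of vanishing on the singular set. -/

section Vanishing

/-- Near a point of the unit circle a nonconstant analytic function leaves the circle like the
real part of a homogeneous polynomial. -/
theorem exists_tendsto_normSq_sub_one {γ : ℂ → ℂ} {z₀ : ℂ} (hγ : AnalyticAt ℂ γ z₀)
    (h1 : Complex.normSq (γ z₀) = 1) (hne : ¬∀ᶠ z in 𝓝 z₀, γ z = γ z₀) :
    ∃ k : ℕ, k ≠ 0 ∧ ∃ C : ℂ, C ≠ 0 ∧ ∀ (c : ℝ → ℂ) (η : ℂ), HasDerivAt c η 0 → c 0 = z₀ →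
      Tendsto (fun t : ℝ => (Complex.normSq (γ (c t)) - 1) / t ^ k) (𝓝[≠] 0)
        (𝓝 (C * η ^ k).re) := by
  have hγ' : AnalyticAt ℂ (fun z => γ z - γ z₀) z₀ := hγ.sub analyticAt_const
  obtain ⟨k, u, hu, hu0, hku⟩ := hγ'.exists_eventuallyEq_pow_smul_nonzero_iff.2
    (fun hc => hne (hc.mono fun z hz => sub_eq_zero.1 hz))
  have hk : k ≠ 0 := by
    rintro rfl
    have := hku.self_of_nhds
    simp at this
    exact hu0 this.symm
  have hγ0 : γ z₀ ≠ 0 := fun h0 => by rw [h0] at h1; simp at h1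
  -- Writing `γ = γ z₀ + (z - z₀) ^ k u`, the linear term of `|γ|² - 1` is `2 Re (conj (γ z₀) (z -
  -- z₀) ^ k u)`. The limit is taken along curves differentiable at `0` because the coordinate `z`
  -- is so far only `C¹` in the smooth chart.
  refine ⟨k, hk, 2 * starRingEnd ℂ (γ z₀) * u z₀, by simp [hγ0, hu0], fun c η hc hc0 => ?_⟩
  have hcc : Tendsto c (𝓝[≠] 0) (𝓝 z₀) := by
    rw [← hc0]
    exact hc.continuousAt.mono_left nhdsWithin_le_nhds
  have hslope : Tendsto (fun t : ℝ => (c t - z₀) / t) (𝓝[≠] 0) (𝓝 η) := by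
    have := hasDerivAt_iff_tendsto_slope.1 hc
    refine this.congr fun t => ?_
    rw [slope_def_module, hc0, sub_zero, ← Complex.coe_smul]
    simp [div_eq_inv_mul]
  have hd : Tendsto (fun t : ℝ => (γ (c t) - γ z₀) / (t : ℂ) ^ k) (𝓝[≠] 0)
      (𝓝 (η ^ k * u z₀)) := by
    refine ((hslope.pow k).mul (hu.continuousAt.tendsto.comp hcc)).congr' ?_
    filter_upwards [hcc.eventually hku] with t ht
    rw [ht, smul_eq_mul, div_pow]
    simp only [Function.comp]
    ring
  have ht0 : Tendsto (fun t : ℝ => t ^ k) (𝓝[≠] 0) (𝓝 0) := by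
    have : Tendsto (fun t : ℝ => t ^ k) (𝓝 0) (𝓝 ((0 : ℝ) ^ k)) := (continuous_pow k).tendsto 0
    rw [zero_pow hk] at this
    exact this.mono_left nhdsWithin_le_nhds
  have hlim : Tendsto (fun t : ℝ => (2 * starRingEnd ℂ (γ z₀) *
      ((γ (c t) - γ z₀) / (t : ℂ) ^ k)).re
        + Complex.normSq ((γ (c t) - γ z₀) / (t : ℂ) ^ k) * t ^ k) (𝓝[≠] 0)
      (𝓝 ((2 * starRingEnd ℂ (γ z₀) * (η ^ k * u z₀)).re
        + Complex.normSq (η ^ k * u z₀) * 0)) :=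
    ((Complex.continuous_re.tendsto _).comp (hd.const_mul _)).add
      (((Complex.continuous_normSq.tendsto _).comp hd).mul ht0)
  rw [mul_zero, add_zero] at hlim
  rw [show 2 * starRingEnd ℂ (γ z₀) * u z₀ * η ^ k
    = 2 * starRingEnd ℂ (γ z₀) * (η ^ k * u z₀) by ring]
  refine hlim.congr' ?_
  filter_upwards [self_mem_nhdsWithin] with t ht
  have ht' : t ≠ 0 := ht
  set d := γ (c t) - γ z₀ with hd'
  have h2 : γ (c t) = γ z₀ + d := by rw [hd']; ring
  rw [h2, Complex.normSq_add, h1, ← Complex.ofReal_pow, Complex.normSq_div,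
    Complex.normSq_ofReal, mul_div_assoc', Complex.div_ofReal_re]
  have h3 : (2 * starRingEnd ℂ (γ z₀) * d).re = 2 * (γ z₀ * starRingEnd ℂ d).re := by
    simp [Complex.mul_re, Complex.mul_im]
    ring
  rw [h3]
  field_simp
  ring

/-- Smoothness of a continuous quotient by a function that vanishes like the real part of a
homogeneous polynomial. -/
theorem exists_contDiffOn_of_mul_eq {R P q : Plane → ℝ} {U : Set Plane} {y : Plane} (hU : IsOpen U)
    (hy : y ∈ U) (hR : ContDiffOn ℝ ∞ R U) (hP : ContDiffOn ℝ ∞ P U) (hq : ContinuousOn q U)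
    (hPR : ∀ x ∈ U, P x = R x * q x) (L : Plane ≃L[ℝ] ℂ) {k : ℕ} (hk : k ≠ 0) {C : ℂ}
    (hC : C ≠ 0) (hRC : ∀ v, Tendsto (fun t : ℝ => R (y + t • v) / t ^ k) (𝓝[≠] 0)
      (𝓝 (C * (L v) ^ k).re)) : ∃ U' ⊆ U, IsOpen U' ∧ y ∈ U' ∧ ContDiffOn ℝ ∞ q U' := by
  obtain ⟨R', hR', hRR⟩ := exists_contDiff_eventuallyEq hU hy hR
  obtain ⟨P', hP', hPP⟩ := exists_contDiff_eventuallyEq hU hy hP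
  let T : ℂ → Plane := fun ξ => y + L.symm ξ
  have hT : ContDiff ℝ ∞ T := contDiff_const.add L.symm.contDiff
  have hT0 : T 0 = y := by simp [T]
  have hTt : Tendsto T (𝓝 0) (𝓝 y) := by
    have := hT.continuous.tendsto 0
    rwa [hT0] at this
  obtain ⟨q', hq', hqq⟩ := exists_contDiff_quotient (R := R' ∘ T) (P := P' ∘ T) (h := q ∘ T)
    (hR'.comp hT) hk hC (fun η => by
      have h1 := hRC (L.symm η)
      rw [L.apply_symm_apply] at h1
      refine h1.congr' ?_
      filter_upwards [((tendsto_line y (L.symm η)).mono_left nhdsWithin_le_nhds).eventually hRR]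
        with t ht
      rw [← ht]
      simp only [Function.comp, T]
      rw [← Complex.real_smul, map_smul]) (hP'.comp hT) (by
      filter_upwards [hTt.eventually (hU.mem_nhds hy)] with ξ hξ
      exact (hq.continuousAt (hU.mem_nhds hξ)).comp hT.continuous.continuousAt) (by
      filter_upwards [hTt.eventually (hU.mem_nhds hy), hTt.eventually hRR, hTt.eventually hPP]
        with ξ h1 h2 h3
      simp only [Function.comp]
      rw [h2, h3, hPR _ h1])
  let S : Plane → ℂ := fun x => L (x - y)
  have hS : ContDiff ℝ ∞ S := L.contDiff.comp (contDiff_id.sub contDiff_const)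
  have hTS : ∀ x, T (S x) = x := fun x => by simp [T, S]
  have hSt : Tendsto S (𝓝 y) (𝓝 0) := by
    have := hS.continuous.tendsto y
    simpa [S] using this
  have hev : ∀ᶠ x in 𝓝 y, q' (S x) = q x := by
    filter_upwards [hSt.eventually hqq] with x hx
    rw [hx, Function.comp, hTS]
  obtain ⟨U', hU', hU'o, hyU'⟩ := mem_nhds_iff.1 (inter_mem (hU.mem_nhds hy) hev)
  exact ⟨U', hU'.trans inter_subset_left, hU'o, hyU', (hq'.comp hS).contDiffOn.congr
    fun x hx => ((hU' hx).2).symm⟩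

end Vanishing

end CMCFace

namespace CMCFace

open Filter Topology Set
open scoped Matrix.Norms.Operator

/-! ### Smoothness of the conformal class at singular points. -/

section Singular

variable {h : ConfClass} {g : Plane → Fin 4 → ℝ} {U V : Set Plane}

theorem contDiffOn_lorentz {u v : Plane → Fin 4 → ℝ} {n : ℕ∞ω} (hu : ContDiffOn ℝ n u U)
    (hv : ContDiffOn ℝ n v U) : ContDiffOn ℝ n (fun x => lorentz (u x) (v x)) U := by
  have h1 : ∀ k, ContDiffOn ℝ n (fun x => u x k) U := fun k => contDiffOn_pi.1 hu k
  have h2 : ∀ k, ContDiffOn ℝ n (fun x => v x k) U := fun k => contDiffOn_pi.1 hv k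
  exact (((((h1 0).mul (h2 0)).neg).add ((h1 1).mul (h2 1))).add ((h1 2).mul (h2 2))).add
    ((h1 3).mul (h2 3))

theorem contDiffOn_gram (hU : IsOpen U) (hg : ContDiffOn ℝ ∞ g U) (i j : Fin 2) :
    ContDiffOn ℝ ∞ (gram g i j) U :=
  contDiffOn_lorentz (ContDiffOn.pderiv hU hg le_rfl i) (ContDiffOn.pderiv hU hg le_rfl j)

/-- The congruence `X ↦ M X Mᴴ`, followed by an entry. -/
noncomputable def congrEntryCLM (M : Matrix (Fin 2) (Fin 2) ℂ) (i j : Fin 2) :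
    (Fin 4 → ℝ) →L[ℝ] ℂ :=
  LinearMap.toContinuousLinearMap
    { toFun := fun x => (M * toHerm x * Mᴴ) i j
      map_add' := fun x y => by rw [toHerm_add, mul_add, add_mul]; rfl
      map_smul' := fun c x => by
        rw [toHerm_smul, mul_smul_comm, smul_mul_assoc]
        rfl }

theorem PlanarFace.pos_gram (H : PlanarFace h g U V) {x : Plane} (hx : x ∈ U ∩ V) :
    0 < gram g 0 0 x := by
  obtain ⟨s, hs, h0, -⟩ := (H.cmc x hx).conf.self_of_nhds
  rw [h0]
  exact mul_pos hs (H.pos x hx.1)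

/-- Substitutes `g = F e₃ F*` into `dg = Ω g + g Ω*`; the matrix argument is `F⁻¹F'`, with the
adjugate as inverse. -/
theorem PlanarFace.toHerm_pderiv_eq_nullForm (H : PlanarFace h g U V)
    {e : OpenPartialHomeomorph Plane ℂ} {α : Plane → ℂ} (he : IsHoloCoord h e α) {x : Plane}
    (hx : x ∈ e.source) (hxU : x ∈ U) {F : Matrix (Fin 2) (Fin 2) ℂ} (hF : F.det = 1)
    (hg : toHerm (g x) = F * e₃ * Fᴴ) :
    toHerm (pderiv 0 g x) =
      nullForm F (F.adjugate * ((α x)⁻¹ • h.form₁ g 1 x * F)) (α x) ∧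
    toHerm (pderiv 1 g x) =
      nullForm F (F.adjugate * ((α x)⁻¹ • h.form₁ g 1 x * F)) (h.slope x * α x) := by
  have hFF : F * F.adjugate = 1 := by rw [Matrix.mul_adjugate, hF, one_smul]
  have e0 := form_decomp (u := pderiv 0 g x) (v := h.star₁ g x) (H.unit x hxU)
  have e1 := form_decomp (u := pderiv 1 g x) (v := h.star₂ g x) (H.unit x hxU)
  change h.form₁ g 1 x * _ + _ * (h.form₁ g 1 x)ᴴ = _ at e0
  change h.form₂ g 1 x * _ + _ * (h.form₂ g 1 x)ᴴ = _ at e1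
  rw [ConfClass.form₂_eq (H.pos _ hxU).ne' (H.det _ hxU)] at e1
  have hα := he.ne_zero x hx
  have key : ∀ ζ : ℂ, nullForm F (F.adjugate * ((α x)⁻¹ • h.form₁ g 1 x * F)) (ζ * α x) =
      (ζ • h.form₁ g 1 x) * toHerm (g x) + toHerm (g x) * (ζ • h.form₁ g 1 x)ᴴ := by
    intro ζ
    have h1 : (ζ * α x) • (F * (F.adjugate * ((α x)⁻¹ • h.form₁ g 1 x * F)) * e₃ * Fᴴ) =
        (ζ • h.form₁ g 1 x) * toHerm (g x) := by
      rw [hg, ← mul_assoc F, hFF, one_mul]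
      simp only [smul_mul_assoc, smul_smul, mul_assoc]
      rw [mul_inv_cancel₀ hα, mul_one]
    rw [nullForm, h1, Matrix.conjTranspose_mul, toHerm_conjTranspose]
  constructor
  · have := key 1
    rw [one_mul, one_smul] at this
    rw [this, ← e0]
  · rw [key, ← e1]

/-- As `h` has determinant 1, `ν²` is the determinant of `ν h`. So `ν` is smooth and can be divided
out. -/
theorem contDiffOn_of_smul_conf {h : ConfClass} {ν : Plane → ℝ} (hν : ∀ x ∈ U, 0 < ν x)
    (hdet : ∀ x ∈ U, h.a x * h.c x - h.b x ^ 2 = 1)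
    (h0 : ContDiffOn ℝ ∞ (fun x => ν x * h.a x) U) (h1 : ContDiffOn ℝ ∞ (fun x => ν x * h.b x) U)
    (h2 : ContDiffOn ℝ ∞ (fun x => ν x * h.c x) U) :
    ContDiffOn ℝ ∞ h.a U ∧ ContDiffOn ℝ ∞ h.b U ∧ ContDiffOn ℝ ∞ h.c U := by
  have hsq : ∀ x ∈ U, ν x * h.a x * (ν x * h.c x) - (ν x * h.b x) ^ 2 = ν x ^ 2 := fun x hx => by
    linear_combination (ν x ^ 2) * hdet x hx
  have hν' : ContDiffOn ℝ ∞ ν U := by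
    refine (((h0.mul h2).sub (h1.pow 2)).sqrt fun x hx => ?_).congr fun x hx => ?_
    · change ν x * h.a x * (ν x * h.c x) - (ν x * h.b x) ^ 2 ≠ 0
      rw [hsq x hx]
      exact (pow_pos (hν x hx) 2).ne'
    · change _ = √(ν x * h.a x * (ν x * h.c x) - (ν x * h.b x) ^ 2)
      rw [hsq x hx, Real.sqrt_sq (hν x hx).le]
  have hinv := hν'.inv fun x hx => (hν x hx).ne'
  have key : ∀ u : Plane → ℝ, ContDiffOn ℝ ∞ (fun x => ν x * u x) U → ContDiffOn ℝ ∞ u U :=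
    fun u hu => (hinv.mul hu).congr fun x hx => by
      have := (hν x hx).ne'
      simp only [Pi.inv_apply]
      field_simp
  exact ⟨key _ h0, key _ h1, key _ h2⟩

/-- The conformal class of a CMC 1 face is smooth across an admissible singular point. -/
theorem PlanarFace.contDiffOn_conf_of_singular (H : PlanarFace h g U V) {y : Plane} (hy : y ∈ U)
    (hsing : gram g 0 0 y = 0) (hd : ∃ i, pderiv i g y ≠ 0) :
    ∃ U' ⊆ U, IsOpen U' ∧ y ∈ U' ∧ ContDiffOn ℝ ∞ h.a U' ∧ ContDiffOn ℝ ∞ h.b U' ∧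
      ContDiffOn ℝ ∞ h.c U' := by
  obtain ⟨e, α, hye, heU, he, hα, hec, -⟩ := H.exists_coord hy hd (n := 1) le_rfl
    (by norm_cast) H.smooth_a H.smooth_b H.smooth_c
  obtain ⟨ρ, hρ, hρt, F, hF⟩ := H.exists_lift he heU hye
  set z₀ := e y with hz₀
  have hz₀b : z₀ ∈ Metric.ball z₀ ρ := Metric.mem_ball_self hρ
  set B : ℂ → Matrix (Fin 2) (Fin 2) ℂ := fun z =>
    (F z).adjugate * ((α (e.symm z))⁻¹ • h.form₁ g 1 (e.symm z) * F z) with hB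
  have hbU : ∀ z ∈ Metric.ball z₀ ρ, e.symm z ∈ U := fun z hz => heU (e.map_target (hρt hz))
  have hFd : ∀ i j, DifferentiableOn ℂ (fun z => F z i j) (Metric.ball z₀ ρ) := fun i j z hz =>
    (HasDerivAt.entry (hF z hz).1 i j).differentiableAt.differentiableWithinAt
  have hF'd : ∀ i j, DifferentiableOn ℂ
      (fun z => ((α (e.symm z))⁻¹ • h.form₁ g 1 (e.symm z) * F z) i j) (Metric.ball z₀ ρ) :=
    fun i j => ((hFd i j).deriv Metric.isOpen_ball).congr fun z hz =>
      (HasDerivAt.entry (hF z hz).1 i j).deriv.symm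
  have hadjd : ∀ i j, DifferentiableOn ℂ (fun z => (F z).adjugate i j) (Metric.ball z₀ ρ) := by
    intro i j
    fin_cases i <;> fin_cases j <;> simp only [Matrix.adjugate_fin_two] <;>
      first | exact hFd _ _ | exact (hFd _ _).neg
  have hBd : ∀ i j, DifferentiableOn ℂ (fun z => B z i j) (Metric.ball z₀ ρ) := by
    intro i j
    simp only [hB, Matrix.mul_apply (M := (F _).adjugate), Fin.sum_univ_two]
    exact ((hadjd i 0).mul (hF'd 0 j)).add ((hadjd i 1).mul (hF'd 1 j))
  have hFF : ∀ z ∈ Metric.ball z₀ ρ, F z * (F z).adjugate = 1 := fun z hz => by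
    rw [Matrix.mul_adjugate, (hF z hz).2.1, one_smul]
  have hFF' : ∀ z ∈ Metric.ball z₀ ρ, (F z).adjugate * F z = 1 := fun z hz => by
    rw [Matrix.adjugate_mul, (hF z hz).2.1, one_smul]
  have hBt : ∀ z ∈ Metric.ball z₀ ρ, (B z).trace = 0 := fun z hz => by
    rw [hB, Matrix.trace_mul_comm, mul_assoc, hFF z hz, mul_one, Matrix.trace_smul,
      H.trace_form₁ (hbU z hz), smul_zero]
  have hBdet : ∀ z ∈ Metric.ball z₀ ρ, (B z).det = 0 := fun z hz => by
    rw [hB, Matrix.det_mul, Matrix.det_mul, Matrix.det_smul, H.det_form₁ (hbU z hz)]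
    simp
  have hpd : ∀ z ∈ Metric.ball z₀ ρ, toHerm (pderiv 0 g (e.symm z)) =
      nullForm (F z) (B z) (α (e.symm z)) ∧ toHerm (pderiv 1 g (e.symm z)) =
      nullForm (F z) (B z) (h.slope (e.symm z) * α (e.symm z)) := fun z hz =>
    H.toHerm_pderiv_eq_nullForm he (e.map_target (hρt hz)) (hbU z hz) (hF z hz).2.1 (hF z hz).2.2
  have hsy : e.symm z₀ = y := e.left_inv hye
  have hsing' : (toHerm (pderiv 0 g y)).det = 0 := by
    rw [det_toHerm]
    change -((gram g 0 0 y : ℝ) : ℂ) = 0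
    rw [hsing]
    simp
  have hpd0 := (hpd z₀ hz₀b).1
  rw [hsy] at hpd0
  have hαy := he.ne_zero y hye
  -- The singular point is not a pole of `γ`: there degeneracy of the metric would force `B = 0` and
  -- hence `dg = 0`.
  have hB0 : B z₀ 1 0 ≠ 0 := by
    intro h0
    have h1 := det_nullForm_of_eq_zero (hF z₀ hz₀b).2.1 (hBt z₀ hz₀b) (hBdet z₀ hz₀b) h0 (α y)
    rw [← hpd0, hsing'] at h1
    have h2 : B z₀ 0 1 = 0 := by
      have h3 := neg_eq_zero.1 h1.symm
      rw [Complex.ofReal_eq_zero, Complex.normSq_eq_zero] at h3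
      exact (mul_eq_zero.1 h3).resolve_left hαy
    have h3 := hBt z₀ hz₀b
    have h4 := hBdet z₀ hz₀b
    rw [Matrix.trace_fin_two] at h3
    rw [Matrix.det_fin_two, h0, mul_zero, sub_zero] at h4
    have h5 : B z₀ 0 0 = 0 ∧ B z₀ 1 1 = 0 := by
      rcases mul_eq_zero.1 h4 with h6 | h6 <;> rw [h6] at h3 <;> simp at h3 <;>
        exact ⟨by assumption, by assumption⟩
    have hBz : B z₀ = 0 := by
      ext i j
      fin_cases i <;> fin_cases j
      exacts [h5.1, h2, h0, h5.2]
    have h7 : toHerm (pderiv 0 g y) = 0 ∧ toHerm (pderiv 1 g y) = 0 := by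
      have := hpd z₀ hz₀b
      rw [hBz, hsy] at this
      simpa [nullForm] using this
    obtain ⟨i, hi⟩ := hd
    fin_cases i
    · exact toHerm_ne_zero hi h7.1
    · exact toHerm_ne_zero hi h7.2
  set D := Metric.ball z₀ ρ ∩ {z | B z 1 0 ≠ 0} with hD
  have hDo : IsOpen D := (hBd 1 0).continuousOn.isOpen_inter_preimage Metric.isOpen_ball isOpen_ne
  have hz₀D : z₀ ∈ D := ⟨hz₀b, hB0⟩
  let w : ℂ → ℂ := fun z => B z 1 0
  let γ : ℂ → ℂ := fun z => B z 0 0 / B z 1 0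
  have hBn : ∀ z ∈ D, B z = nilMatrix (w z) (γ z) := fun z hz =>
    eq_nilMatrix (hBt z hz.1) (hBdet z hz.1) hz.2
  have hwd : DifferentiableOn ℂ w D := (hBd 1 0).mono inter_subset_left
  have hγd : DifferentiableOn ℂ γ D :=
    ((hBd 0 0).mono inter_subset_left).div hwd fun z hz => hz.2
  set U₁ := e.source ∩ e ⁻¹' D with hU₁
  have hU₁o : IsOpen U₁ := e.isOpen_inter_preimage hDo
  have hyU₁ : y ∈ U₁ := ⟨hye, hz₀D⟩
  have hU₁U : ∀ x ∈ U₁, x ∈ U := fun x hx => heU hx.1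
  have hnull : ∀ x ∈ U₁, toHerm (pderiv 0 g x) = nullForm (F (e x)) (nilMatrix (w (e x)) (γ (e x)))
      (α x) ∧ toHerm (pderiv 1 g x) = nullForm (F (e x)) (nilMatrix (w (e x)) (γ (e x)))
      (h.slope x * α x) := fun x hx => by
    have := hpd (e x) hx.2.1
    rwa [hBn _ hx.2, e.left_inv hx.1] at this
  have hgram : ∀ x ∈ U₁, gram g 0 0 x =
      Complex.normSq (α x * w (e x)) * (Complex.normSq (γ (e x)) - 1) ^ 2 := fun x hx => by
    have h1 := det_nullForm (hF _ hx.2.1).2.1 (w (e x)) (γ (e x)) (α x)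
    rw [← (hnull x hx).1, det_toHerm, neg_inj] at h1
    exact Complex.ofReal_injective h1
  have hγ1 : Complex.normSq (γ z₀) = 1 := by
    have h1 := hgram y hyU₁
    rw [hsing] at h1
    have h2 : Complex.normSq (α y * w (e y)) ≠ 0 := by
      simpa using And.intro hαy hB0
    have h3 := (mul_eq_zero.1 h1.symm).resolve_left h2
    exact sub_eq_zero.1 (pow_eq_zero_iff two_ne_zero |>.1 h3)
  have hγ0 : γ z₀ ≠ 0 := fun h0 => by rw [h0] at hγ1; simp at hγ1
  -- Were `γ` locally constant, the metric would degenerate on a neighbourhood of `y`, which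
  -- contains regular points.
  have hne : ¬∀ᶠ z in 𝓝 z₀, γ z = γ z₀ := by
    intro hc
    have h1 : ∀ᶠ x in 𝓝 y, γ (e x) = γ z₀ := (e.continuousAt hye).eventually hc
    obtain ⟨x, ⟨hx1, hx2⟩, hxV⟩ := mem_closure_iff_nhds.1 (H.dense hy) _
      (inter_mem h1 (hU₁o.mem_nhds hyU₁))
    change γ (e x) = γ z₀ at hx1
    have h2 := H.pos_gram ⟨hU₁U x hx2, hxV⟩
    rw [hgram x hx2, hx1, hγ1] at h2
    simp at h2
  obtain ⟨k, hk, C, hC, hlim⟩ := exists_tendsto_normSq_sub_one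
    (hγd.analyticAt (hDo.mem_nhds hz₀D)) hγ1 hne
  -- Replacing `F` by `F(z₀)⁻¹ F` makes it the identity at `z₀`, where the cofactor is explicit. On
  -- `dg` this is a fixed linear map, so smoothness is not affected.
  set M := (F z₀).adjugate with hM
  let Q : Plane → ℂ := fun x =>
    nullWronskian (M * F (e x)) (w (e x)) (γ (e x)) (α x) (h.slope x * α x)
  have hslope : ContinuousOn h.slope U := by
    refine ContinuousOn.div ?_ ?_ fun x hx => ?_
    · exact (Complex.continuous_ofReal.comp_continuousOn H.smooth_b.continuousOn).add
        continuousOn_const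
    · exact Complex.continuous_ofReal.comp_continuousOn H.smooth_a.continuousOn
    · exact_mod_cast (H.pos x hx).ne'
  have hecont : ∀ {u : ℂ → ℂ}, DifferentiableOn ℂ u D → ContinuousOn (fun x => u (e x)) U₁ :=
    fun hu => hu.continuousOn.comp (e.continuousOn.mono inter_subset_left) fun x hx => hx.2
  have hMF : ∀ i j, DifferentiableOn ℂ (fun z => (M * F z) i j) D := by
    intro i j
    simp only [Matrix.mul_apply, Fin.sum_univ_two]
    exact ((((hFd 0 j).const_mul _).add ((hFd 1 j).const_mul _))).mono inter_subset_left
  have hα₁ : ContinuousOn α U₁ := hα.continuousOn.mono inter_subset_left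
  have hQc : ContinuousOn Q U₁ := fun x hx => by
    have hn := hU₁o.mem_nhds hx
    exact (continuousAt_nullWronskian (fun i j => (hecont (hMF i j)).continuousAt hn)
      ((hecont hwd).continuousAt hn) ((hecont hγd).continuousAt hn) (hα₁.continuousAt hn)
      (((hslope.mono hU₁U).continuousAt hn).mul (hα₁.continuousAt hn))).continuousWithinAt
  have hQy : Q y ≠ 0 := by
    have h1 : M * F (e y) = 1 := hFF' z₀ hz₀b
    simp only [Q]
    rw [h1]
    refine nullWronskian_one_ne_zero hB0 hγ0 hαy ?_
    rw [ConfClass.slope_im]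
    exact one_div_ne_zero (H.pos y hy).ne'
  let q : Plane → ℝ := fun x => ((Q y)⁻¹ * Q x).re
  have hqc : ContinuousOn q U₁ :=
    Complex.continuous_re.comp_continuousOn (continuousOn_const.mul hQc)
  have hqy : q y = 1 := by
    change ((Q y)⁻¹ * Q y).re = 1
    rw [inv_mul_cancel₀ hQy, Complex.one_re]
  set U₂ := U₁ ∩ {x | 0 < q x} with hU₂
  have hU₂o : IsOpen U₂ := hqc.isOpen_inter_preimage hU₁o isOpen_Ioi
  have hyU₂ : y ∈ U₂ := ⟨hyU₁, by change 0 < q y; rw [hqy]; exact one_pos⟩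
  have hU₂U : U₂ ⊆ U := fun x hx => hU₁U x hx.1
  let T := congrEntryCLM M
  -- `R` is smooth, being built from first derivatives of `g`. It equals `(|γ|² - 1) q`, where `q`
  -- is a priori only continuous and is `1` at `y` thanks to the normalising factor `(Q y)⁻¹`.
  let R : Plane → ℝ := fun x => ((Q y)⁻¹ * (T 1 1 (pderiv 0 g x) * T 0 1 (pderiv 1 g x)
    - T 1 1 (pderiv 1 g x) * T 0 1 (pderiv 0 g x))).re
  have hpg : ∀ i, ContDiffOn ℝ ∞ (pderiv i g) U := fun i =>
    ContDiffOn.pderiv H.isOpen H.smooth_g le_rfl i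
  have hRs : ContDiffOn ℝ ∞ R U₂ := by
    have h1 : ∀ i j k, ContDiffOn ℝ ∞ (fun x => T i j (pderiv k g x)) U₂ := fun i j k =>
      (T i j).contDiff.comp_contDiffOn ((hpg k).mono hU₂U)
    exact Complex.reCLM.contDiff.comp_contDiffOn (contDiffOn_const.mul
      (((h1 1 1 0).mul (h1 0 1 1)).sub ((h1 1 1 1).mul (h1 0 1 0))))
  have hRκ : ∀ x ∈ U₁, R x = (Complex.normSq (γ (e x)) - 1) * q x := fun x hx => by
    have hT : ∀ (i j : Fin 2) (v : Fin 4 → ℝ), T i j v = (M * toHerm v * Mᴴ) i j :=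
      fun _ _ _ => rfl
    simp only [R, hT]
    rw [(hnull x hx).1, (hnull x hx).2, ← nullForm_mul, ← nullForm_mul, wronskian_nullForm]
    simp only [q, Q]
    rw [mul_left_comm, Complex.re_ofReal_mul]
  obtain ⟨L, hL⟩ := exists_oneForm_equiv hαy (μ := h.slope y) (by
    rw [ConfClass.slope_im]; exact one_div_ne_zero (H.pos y hy).ne')
  have hRlim : ∀ v, Tendsto (fun t : ℝ => R (y + t • v) / t ^ k) (𝓝[≠] 0)
      (𝓝 (C * (L v) ^ k).re) := by
    intro v
    have hline : Tendsto (fun t : ℝ => y + t • v) (𝓝[≠] 0) (𝓝 y) :=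
      (tendsto_line y v).mono_left nhdsWithin_le_nhds
    have hder : HasDerivAt (fun t : ℝ => e (y + t • v)) (L v) 0 := by
      have h1 : HasFDerivAt e (L : Plane →L[ℝ] ℂ) (y + (0 : ℝ) • v) := by
        rw [hL, zero_smul, add_zero]
        exact he.deriv y hye
      have h2 : HasDerivAt (fun t : ℝ => y + t • v) v 0 :=
        (((hasDerivAt_id (0 : ℝ)).smul_const v).const_add y).congr_deriv (one_smul _ _)
      exact h1.comp_hasDerivAt 0 h2
    have h1 := (hlim _ _ hder (by simp [hz₀])).mul
      (((hqc.continuousAt (hU₁o.mem_nhds hyU₁)).tendsto).comp hline)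
    rw [hqy, mul_one] at h1
    refine h1.congr' ?_
    filter_upwards [hline.eventually (hU₁o.mem_nhds hyU₁)] with t ht
    rw [hRκ _ ht]
    simp only [Function.comp]
    ring
  -- Chosen so that the metric is `R² ν h`, with `ν` continuous and positive.
  let ν : Plane → ℝ := fun x => Complex.normSq (α x * w (e x)) / (h.a x * q x ^ 2)
  have hν : ∀ x ∈ U₂, 0 < ν x := fun x hx => by
    refine div_pos ?_ (mul_pos (H.pos x (hU₂U hx)) (pow_pos hx.2 2))
    rw [Complex.normSq_pos]
    exact mul_ne_zero (he.ne_zero x hx.1.1) hx.1.2.2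
  have hνc : ContinuousOn ν U₂ := by
    refine ContinuousOn.div ?_ ?_ fun x hx => ?_
    · exact Complex.continuous_normSq.comp_continuousOn
        ((hα₁.mul (hecont hwd)).mono inter_subset_left)
    · exact (H.smooth_a.continuousOn.mono hU₂U).mul ((hqc.mono inter_subset_left).pow 2)
    · exact (mul_pos (H.pos x (hU₂U hx)) (pow_pos hx.2 2)).ne'
  have hconf : ∀ x ∈ U₂, gram g 0 0 x = R x * (R x * (ν x * h.a x)) ∧
      gram g 0 1 x = R x * (R x * (ν x * h.b x)) ∧
      gram g 1 1 x = R x * (R x * (ν x * h.c x)) := fun x hx => by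
    obtain ⟨s, -, h00, h01, h11⟩ := H.conf x (hU₂U hx)
    have ha := (H.pos x (hU₂U hx)).ne'
    have hq : q x ≠ 0 := hx.2.ne'
    have hs : s = R x * (R x * ν x) := by
      have h1 := hgram x hx.1
      rw [h00] at h1
      rw [hRκ x hx.1]
      simp only [ν]
      field_simp
      linear_combination h1
    rw [h00, h01, h11, hs]
    exact ⟨by ring, by ring, by ring⟩
  -- Division by `R` is applied twice: first `R ν u` is smooth, then `ν u`.
  have key : ∀ {P u : Plane → ℝ}, ContDiffOn ℝ ∞ P U → ContinuousOn u U →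
      (∀ x ∈ U₂, P x = R x * (R x * (ν x * u x))) →
      ∃ U' ⊆ U₂, IsOpen U' ∧ y ∈ U' ∧ ContDiffOn ℝ ∞ (fun x => ν x * u x) U' := by
    intro P u hP hu hPu
    have hνu : ContinuousOn (fun x => ν x * u x) U₂ := hνc.mul (hu.mono hU₂U)
    obtain ⟨U₃, h32, h3o, hy3, h3⟩ := exists_contDiffOn_of_mul_eq hU₂o hyU₂ hRs (hP.mono hU₂U)
      (hRs.continuousOn.mul hνu) hPu L hk hC hRlim
    obtain ⟨U₄, h43, h4o, hy4, h4⟩ := exists_contDiffOn_of_mul_eq h3o hy3 (hRs.mono h32) h3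
      (hνu.mono h32) (fun x _ => rfl) L hk hC hRlim
    exact ⟨U₄, h43.trans h32, h4o, hy4, h4⟩
  obtain ⟨Ua, ha2, hao, hya, ha⟩ := key (contDiffOn_gram H.isOpen H.smooth_g 0 0)
    H.smooth_a.continuousOn fun x hx => (hconf x hx).1
  obtain ⟨Ub, hb2, hbo, hyb, hb⟩ := key (contDiffOn_gram H.isOpen H.smooth_g 0 1)
    H.smooth_b.continuousOn fun x hx => (hconf x hx).2.1
  obtain ⟨Uc, hc2, hco, hyc, hc⟩ := key (contDiffOn_gram H.isOpen H.smooth_g 1 1)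
    H.smooth_c.continuousOn fun x hx => (hconf x hx).2.2
  exact ⟨Ua ∩ Ub ∩ Uc, fun x hx => hU₂U (ha2 hx.1.1), (hao.inter hbo).inter hco,
    ⟨⟨hya, hyb⟩, hyc⟩, contDiffOn_of_smul_conf (fun x hx => hν x (ha2 hx.1.1))
      (fun x hx => H.det x (hU₂U (ha2 hx.1.1))) (ha.mono fun x hx => hx.1.1)
      (hb.mono fun x hx => hx.1.2) (hc.mono fun x hx => hx.2)⟩

end Singular

end CMCFace

namespace CMCFace

open Filter Topology Set
open scoped Matrix.Norms.Operator

/-! ### From the face on `M` to planar faces in charts. -/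

section Local

theorem PlanarFace.mono {h : ConfClass} {g : Plane → Fin 4 → ℝ} {U U' V : Set Plane}
    (H : PlanarFace h g U V) (hU' : IsOpen U') (hUU : U' ⊆ U) : PlanarFace h g U' V where
  isOpen := hU'
  dense := hUU.trans H.dense
  smooth_g := H.smooth_g.mono hUU
  smooth_a := H.smooth_a.mono hUU
  smooth_b := H.smooth_b.mono hUU
  smooth_c := H.smooth_c.mono hUU
  pos := fun x hx => H.pos x (hUU hx)
  det := fun x hx => H.det x (hUU hx)
  unit := fun x hx => H.unit x (hUU hx)
  cmc := fun x hx => H.cmc x ⟨hUU hx.1, hx.2⟩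

/-- The conformal class of a metric, normalised to have determinant 1. -/
noncomputable def ConfClass.ofMetric (a b c : Plane → ℝ) : ConfClass where
  a x := a x / √(a x * c x - b x ^ 2)
  b x := b x / √(a x * c x - b x ^ 2)
  c x := c x / √(a x * c x - b x ^ 2)

theorem ConfClass.contDiffOn_ofMetric {a b c : Plane → ℝ} {U : Set Plane} {n : ℕ∞ω}
    (ha : ContDiffOn ℝ n a U) (hb : ContDiffOn ℝ n b U) (hc : ContDiffOn ℝ n c U)
    (hd : ∀ x ∈ U, 0 < a x * c x - b x ^ 2) :
    ContDiffOn ℝ n (ofMetric a b c).a U ∧ ContDiffOn ℝ n (ofMetric a b c).b U ∧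
      ContDiffOn ℝ n (ofMetric a b c).c U := by
  have h1 : ContDiffOn ℝ n (fun x => √(a x * c x - b x ^ 2)) U :=
    ((ha.mul hc).sub (hb.pow 2)).sqrt fun x hx => (hd x hx).ne'
  have h2 : ∀ x ∈ U, √(a x * c x - b x ^ 2) ≠ 0 := fun x hx => (Real.sqrt_pos.2 (hd x hx)).ne'
  exact ⟨ha.div h1 h2, hb.div h1 h2, hc.div h1 h2⟩

theorem ConfClass.det_ofMetric {a b c : Plane → ℝ} {x : Plane} (hd : 0 < a x * c x - b x ^ 2) :
    (ofMetric a b c).a x * (ofMetric a b c).c x - (ofMetric a b c).b x ^ 2 = 1 := by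
  have h1 := Real.sq_sqrt hd.le
  have h2 := (Real.sqrt_pos.2 hd).ne'
  simp only [ofMetric]
  field_simp
  linear_combination -h1

theorem ConfClass.ofMetric_eq {a b c : Plane → ℝ} {x : Plane} (hd : 0 < a x * c x - b x ^ 2) :
    a x = √(a x * c x - b x ^ 2) * (ofMetric a b c).a x ∧
    b x = √(a x * c x - b x ^ 2) * (ofMetric a b c).b x ∧
    c x = √(a x * c x - b x ^ 2) * (ofMetric a b c).c x := by
  have h2 := (Real.sqrt_pos.2 hd).ne'
  simp only [ofMetric]
  refine ⟨?_, ?_, ?_⟩ <;> rw [mul_div_cancel₀ _ h2]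

theorem nonneg_of_dense {u : Plane → ℝ} {U V : Set Plane} (hU : IsOpen U) (hd : U ⊆ closure V)
    (hu : ContinuousOn u U) (h : ∀ x ∈ U ∩ V, 0 ≤ u x) : ∀ x ∈ U, 0 ≤ u x := by
  intro x hx
  have := eqOn_of_dense hU hd hu (hu.sup continuousOn_const)
    (fun x hx => (max_eq_left (h x hx)).symm) x hx
  rw [this]
  exact le_max_right _ _

variable {M : Type*} [TopologicalSpace M] {f : M → Fin 4 → ℝ} {W : Set M}

theorem target_subset_closure {X : Type*} [TopologicalSpace X] (hW : Dense W)
    (e : OpenPartialHomeomorph M X) :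
    e.target ⊆ closure (e.target ∩ e.symm ⁻¹' W) := by
  intro x hx
  rw [mem_closure_iff_nhds]
  intro t ht
  have h1 : e.source ∩ e ⁻¹' t ∈ 𝓝 (e.symm x) :=
    inter_mem (e.open_source.mem_nhds (e.map_target hx))
      ((e.continuousAt (e.map_target hx)).preimage_mem_nhds (by rwa [e.right_inv hx]))
  obtain ⟨q, hq, hqW⟩ := mem_closure_iff_nhds.1 (hW (e.symm x)) _ h1
  exact ⟨e q, hq.2, e.map_source hq.1, by rw [mem_preimage, e.left_inv hq.1]; exact hqW⟩

theorem firstForm_symm {e : OpenPartialHomeomorph M Plane} {x : Plane} (hx : x ∈ e.target)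
    (i j : Fin 2) : firstForm e f (e.symm x) i j = gram (f ∘ e.symm) i j x := by
  simp only [firstForm, Matrix.of_apply, pd, gram, pderiv, e.right_inv hx]

theorem pd_symm {e : OpenPartialHomeomorph M Plane} {x : Plane} (hx : x ∈ e.target) (i : Fin 2) :
    pd e f i (e.symm x) = pderiv i (f ∘ e.symm) x := by
  simp only [pd, pderiv, e.right_inv hx]

theorem pd₂_symm {e : OpenPartialHomeomorph M Plane} {x : Plane} (hx : x ∈ e.target)
    (i j : Fin 2) : pd₂ e f i j (e.symm x) = pderiv i (pderiv j (f ∘ e.symm)) x := by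
  simp only [pd₂, e.right_inv hx]
  rfl

theorem gram_comm (g : Plane → Fin 4 → ℝ) (i j : Fin 2) (x : Plane) :
    gram g i j x = gram g j i x := lorentz_comm _ _

theorem gram_pos_of_posDef {e : OpenPartialHomeomorph M Plane} {x : Plane} (hx : x ∈ e.target)
    (h : (firstForm e f (e.symm x)).PosDef) : 0 < gram (f ∘ e.symm) 0 0 x ∧
      0 < gram (f ∘ e.symm) 0 0 x * gram (f ∘ e.symm) 1 1 x - gram (f ∘ e.symm) 0 1 x ^ 2 := by
  have h1 := h.diag_pos (i := 0)
  have h2 := h.det_pos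
  rw [Matrix.det_fin_two] at h2
  simp only [firstForm_symm hx, gram_comm _ 1 0] at h1 h2
  exact ⟨h1, by rw [sq]; exact h2⟩

theorem normal_equation {e : OpenPartialHomeomorph M Plane} {x : Plane} (hx : x ∈ e.target)
    (hg : ContDiffAt ℝ 2 (f ∘ e.symm) x) (h : (firstForm e f (e.symm x)).PosDef)
    {N : Fin 4 → ℝ} (hN : meanCurvature e f (e.symm x) N = 1) :
    gram (f ∘ e.symm) 1 1 x * lorentz (pderiv 0 (pderiv 0 (f ∘ e.symm)) x) N
      - 2 * gram (f ∘ e.symm) 0 1 x * lorentz (pderiv 0 (pderiv 1 (f ∘ e.symm)) x) N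
      + gram (f ∘ e.symm) 0 0 x * lorentz (pderiv 1 (pderiv 1 (f ∘ e.symm)) x) N
      = 2 * (gram (f ∘ e.symm) 0 0 x * gram (f ∘ e.symm) 1 1 x - gram (f ∘ e.symm) 0 1 x ^ 2) := by
  obtain ⟨-, hd⟩ := gram_pos_of_posDef hx h
  rw [meanCurvature, Matrix.inv_def, Ring.inverse_eq_inv', Matrix.det_fin_two,
    Matrix.adjugate_fin_two, Matrix.trace_fin_two] at hN
  simp only [Matrix.smul_apply, Matrix.mul_apply, Fin.sum_univ_two,
    firstForm_symm hx, secondForm, Matrix.of_apply, pd₂_symm hx, gram_comm _ 1 0,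
    Matrix.cons_val', Matrix.cons_val_zero, Matrix.cons_val_one, Matrix.cons_val_fin_one,
    smul_eq_mul] at hN
  rw [pderiv_comm hg 1 0] at hN
  rw [← sq] at hN
  field_simp at hN
  linear_combination hN

variable [ChartedSpace Plane M] [IsManifold (𝓡 2) ∞ M]

theorem contDiffOn_comp_chart_symm {E : Type*} [NormedAddCommGroup E] [NormedSpace ℝ E] {u : M → E}
    {U : Set M} {n : ℕ∞ω} (hn : n ≤ ∞) (hu : ContMDiffOn (𝓡 2) 𝓘(ℝ, E) n u U)
    {e : OpenPartialHomeomorph M Plane} (he : e ∈ atlas Plane M) :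
    ContDiffOn ℝ n (u ∘ e.symm) (e.target ∩ e.symm ⁻¹' U) := by
  rw [← contMDiffOn_iff_contDiffOn]
  have h1 : ContMDiffOn (𝓡 2) (𝓡 2) ∞ e.symm e.target :=
    contMDiffOn_symm_of_mem_maximalAtlas (IsManifold.subset_maximalAtlas he)
  exact hu.comp ((h1.of_le hn).mono inter_subset_left) fun x hx => hx.2

theorem IsCMC1Face.contDiffOn (hf : IsCMC1Face f W) {e : OpenPartialHomeomorph M Plane}
    (he : e ∈ atlas Plane M) : ContDiffOn ℝ ∞ (f ∘ e.symm) e.target :=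
  (contDiffOn_comp_chart_symm le_rfl hf.smooth.contMDiffOn (U := univ) he).mono
    fun _ hx => ⟨hx, trivial⟩

theorem IsCMC1Face.planarFace (hf : IsCMC1Face f W) {e : OpenPartialHomeomorph M Plane}
    (he : e ∈ atlas Plane M) {U : Set Plane} (hU : IsOpen U) (hUe : U ⊆ e.target) {h : ConfClass}
    (ha : ContDiffOn ℝ 1 h.a U) (hb : ContDiffOn ℝ 1 h.b U) (hc : ContDiffOn ℝ 1 h.c U)
    (hpos : ∀ x ∈ U, 0 < h.a x) (hdet : ∀ x ∈ U, h.a x * h.c x - h.b x ^ 2 = 1)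
    (hconf : ∀ x ∈ U, e.symm x ∈ W → ∃ s : ℝ, 0 < s ∧ gram (f ∘ e.symm) 0 0 x = s * h.a x ∧
      gram (f ∘ e.symm) 0 1 x = s * h.b x ∧ gram (f ∘ e.symm) 1 1 x = s * h.c x) :
    PlanarFace h (f ∘ e.symm) U (e.target ∩ e.symm ⁻¹' W) where
  isOpen := hU
  dense := hUe.trans (target_subset_closure hf.dense e)
  smooth_g := (hf.contDiffOn he).mono hUe
  smooth_a := ha
  smooth_b := hb
  smooth_c := hc
  pos := hpos
  det := hdet
  unit := fun x _ => hf.mem_deSitter _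
  cmc := by
    rintro x ⟨hxU, hxe, hxW⟩
    have hg : ContDiffAt ℝ ∞ (f ∘ e.symm) x :=
      (hf.contDiffOn he).contDiffAt (e.open_target.mem_nhds hxe)
    obtain ⟨hpd, N, ⟨hN1, hN2, hN3, hN4⟩, hN⟩ := hf.cmc1 _ hxW e he (e.map_target hxe)
    have hn := hU.mem_nhds hxU
    refine ⟨hg.of_le (by norm_cast), .of_forall fun x => hf.mem_deSitter _,
      (ha.contDiffAt hn).differentiableAt one_ne_zero,
      (hb.contDiffAt hn).differentiableAt one_ne_zero,
      (hc.contDiffAt hn).differentiableAt one_ne_zero, hpos x hxU, ?_, ?_, N, hN1, hN2, ?_, ?_, ?_⟩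
    · filter_upwards [hn] with z hz using hdet z hz
    · filter_upwards [hn, (e.isOpen_inter_preimage_symm hf.isOpen).mem_nhds ⟨hxe, hxW⟩]
        with z hz hzW using hconf z hz hzW.2
    · exact fun i => by rw [← pd_symm hxe]; exact hN3 i
    · rw [← pd_symm hxe, ← pd_symm hxe]
      exact hN4
    · exact normal_equation hxe (hg.of_le (by norm_cast)) hpd hN

/-- The points of a coordinate domain at which the induced metric is positive definite. -/
def posSet (e : OpenPartialHomeomorph M Plane) (f : M → Fin 4 → ℝ) : Set Plane :=
  (e.target ∩ {x | 0 < gram (f ∘ e.symm) 0 0 x}) ∩ {x | 0 < gram (f ∘ e.symm) 0 0 x *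
    gram (f ∘ e.symm) 1 1 x - gram (f ∘ e.symm) 0 1 x ^ 2}

/-- The conformal class of the induced metric. -/
noncomputable def inducedClass (e : OpenPartialHomeomorph M Plane) (f : M → Fin 4 → ℝ) :
    ConfClass :=
  .ofMetric (gram (f ∘ e.symm) 0 0) (gram (f ∘ e.symm) 0 1) (gram (f ∘ e.symm) 1 1)

theorem IsCMC1Face.planarFace_gram (hf : IsCMC1Face f W) {e : OpenPartialHomeomorph M Plane}
    (he : e ∈ atlas Plane M) :
    PlanarFace (inducedClass e f) (f ∘ e.symm) (posSet e f) (e.target ∩ e.symm ⁻¹' W) ∧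
      ContDiffOn ℝ ∞ (inducedClass e f).a (posSet e f) ∧
      ContDiffOn ℝ ∞ (inducedClass e f).b (posSet e f) ∧
      ContDiffOn ℝ ∞ (inducedClass e f).c (posSet e f) := by
  have hgr : ∀ i j, ContDiffOn ℝ ∞ (gram (f ∘ e.symm) i j) e.target := fun i j =>
    contDiffOn_gram e.open_target (hf.contDiffOn he) i j
  have hdc : ContDiffOn ℝ ∞ (fun x => gram (f ∘ e.symm) 0 0 x * gram (f ∘ e.symm) 1 1 x
      - gram (f ∘ e.symm) 0 1 x ^ 2) e.target :=
    ((hgr 0 0).mul (hgr 1 1)).sub ((hgr 0 1).pow 2)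
  have hU1 := (hgr 0 0).continuousOn.isOpen_inter_preimage e.open_target
    (isOpen_Ioi (a := (0 : ℝ)))
  have hUo : IsOpen (posSet e f) :=
    (hdc.continuousOn.mono inter_subset_left).isOpen_inter_preimage hU1 isOpen_Ioi
  have hUe : posSet e f ⊆ e.target := fun x hx => hx.1.1
  obtain ⟨ha, hb, hc⟩ := ConfClass.contDiffOn_ofMetric ((hgr 0 0).mono hUe)
    ((hgr 0 1).mono hUe) ((hgr 1 1).mono hUe) fun x hx => hx.2
  exact ⟨hf.planarFace he hUo hUe (ha.of_le (by norm_cast)) (hb.of_le (by norm_cast))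
    (hc.of_le (by norm_cast)) (fun x hx => div_pos hx.1.2 (Real.sqrt_pos.2 hx.2))
    (fun x hx => ConfClass.det_ofMetric hx.2) (fun x hx _ => ⟨_, Real.sqrt_pos.2 hx.2,
      ConfClass.ofMetric_eq hx.2⟩), ha, hb, hc⟩

/-- Near each point the conformal class of a CMC 1 face extends smoothly across the singular
set. -/
theorem IsCMC1Face.exists_planarFace (hf : IsCMC1Face f W) (p : M) :
    ∃ (h : ConfClass) (U : Set Plane), chartAt Plane p p ∈ U ∧ U ⊆ (chartAt Plane p).target ∧
      PlanarFace h (f ∘ (chartAt Plane p).symm) U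
        ((chartAt Plane p).target ∩ (chartAt Plane p).symm ⁻¹' W) ∧
      ContDiffOn ℝ ∞ h.a U ∧ ContDiffOn ℝ ∞ h.b U ∧ ContDiffOn ℝ ∞ h.c U ∧
      ∀ x ∈ U, ∃ i, pderiv i (f ∘ (chartAt Plane p).symm) x ≠ 0 := by
  set e := chartAt Plane p with he_def
  have he : e ∈ atlas Plane M := chart_mem_atlas Plane p
  have hpe : p ∈ e.source := mem_chart_source Plane p
  have hye := e.map_source hpe
  set g := f ∘ e.symm with hg
  have hgs := hf.contDiffOn he
  have hgr : ∀ i j, ContDiffOn ℝ ∞ (gram g i j) e.target := fun i j =>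
    contDiffOn_gram e.open_target hgs i j
  have hsy : e.symm (e p) = p := e.left_inv hpe
  suffices hsuff : ∃ (h : ConfClass) (U : Set Plane), e p ∈ U ∧ U ⊆ e.target ∧
      PlanarFace h g U (e.target ∩ e.symm ⁻¹' W) ∧
      ContDiffOn ℝ ∞ h.a U ∧ ContDiffOn ℝ ∞ h.b U ∧ ContDiffOn ℝ ∞ h.c U ∧
      ∃ i, pderiv i g (e p) ≠ 0 by
    obtain ⟨h, U, hyU, hUe, H, ha, hb, hc, i, hi⟩ := hsuff
    have ho : IsOpen (U ∩ {x | pderiv i g x ≠ 0}) :=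
      (ContDiffOn.pderiv H.isOpen H.smooth_g le_rfl i : ContDiffOn ℝ ∞ _ U).continuousOn
        |>.isOpen_inter_preimage H.isOpen isOpen_ne
    exact ⟨h, U ∩ {x | pderiv i g x ≠ 0}, ⟨hyU, hi⟩, inter_subset_left.trans hUe,
      H.mono ho inter_subset_left, ha.mono inter_subset_left, hb.mono inter_subset_left,
      hc.mono inter_subset_left, fun x hx => ⟨i, hx.2⟩⟩
  by_cases hsing : IsSingularPt f p
  · obtain ⟨-, ⟨U₀, hU₀, hpU₀, hU₀e, β, γ, -, hβ, hγ, hγp, hγβ⟩, i, hi⟩ := hf.admissible p hsing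
    rw [← he_def] at hU₀e hγβ hi
    set U := e.target ∩ e.symm ⁻¹' U₀ with hU
    have hUo : IsOpen U := e.isOpen_inter_preimage_symm hU₀
    have hyU : e p ∈ U := ⟨hye, by rw [mem_preimage, hsy]; exact hpU₀⟩
    have hγs : ∀ i j, ContDiffOn ℝ 1 (fun x => γ (e.symm x) i j) U := fun i j =>
      contDiffOn_comp_chart_symm (by norm_cast) (hγ i j) he
    have hγ00 : ∀ x ∈ U, 0 < γ (e.symm x) 0 0 := fun x hx => (hγp _ hx.2).diag_pos
    have hγd : ∀ x ∈ U, 0 < γ (e.symm x) 0 0 * γ (e.symm x) 1 1 - γ (e.symm x) 0 1 ^ 2 := by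
      intro x hx
      have h1 := (hγp _ hx.2).det_pos
      have h2 := (hγp _ hx.2).isHermitian.apply 0 1
      rw [Matrix.det_fin_two] at h1
      rw [star_trivial] at h2
      rw [h2] at h1
      rwa [sq]
    let h := ConfClass.ofMetric (fun x => γ (e.symm x) 0 0) (fun x => γ (e.symm x) 0 1)
      (fun x => γ (e.symm x) 1 1)
    obtain ⟨ha, hb, hc⟩ := ConfClass.contDiffOn_ofMetric (hγs 0 0) (hγs 0 1) (hγs 1 1) hγd
    have H : PlanarFace h g U (e.target ∩ e.symm ⁻¹' W) := by
      refine hf.planarFace he hUo inter_subset_left ha hb hc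
        (fun x hx => div_pos (hγ00 x hx) (Real.sqrt_pos.2 (hγd x hx)))
        (fun x hx => ConfClass.det_ofMetric (hγd x hx)) fun x hx hxW => ?_
      have hβx := hβ _ ⟨hx.2, hxW⟩
      have h1 : ∀ i j, γ (e.symm x) i j = β (e.symm x) * gram g i j x := fun i j => by
        rw [hγβ _ ⟨hx.2, hxW⟩, Matrix.smul_apply, firstForm_symm hx.1, smul_eq_mul]
      obtain ⟨e0, e1, e2⟩ := ConfClass.ofMetric_eq (a := fun x => γ (e.symm x) 0 0)
        (b := fun x => γ (e.symm x) 0 1) (c := fun x => γ (e.symm x) 1 1) (hγd x hx)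
      refine ⟨√(γ (e.symm x) 0 0 * γ (e.symm x) 1 1 - γ (e.symm x) 0 1 ^ 2) / β (e.symm x),
        div_pos (Real.sqrt_pos.2 (hγd x hx)) hβx, ?_, ?_, ?_⟩
      · rw [div_mul_eq_mul_div, eq_div_iff hβx.ne', ← e0, h1, mul_comm]
      · rw [div_mul_eq_mul_div, eq_div_iff hβx.ne', ← e1, h1, mul_comm]
      · rw [div_mul_eq_mul_div, eq_div_iff hβx.ne', ← e2, h1, mul_comm]
    have hi' : pderiv i g (e p) ≠ 0 := hi
    -- The metric at the point is `s h`, of determinant `s²`. Degeneracy therefore means `s = 0`, so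
    -- the whole metric vanishes there.
    have h00 : gram g 0 0 (e p) = 0 := by
      obtain ⟨s, -, h0, h1, h2⟩ := H.conf (e p) hyU
      have h3 : (firstForm e f (e.symm (e p))).det = 0 := by rw [hsy]; exact hsing
      rw [Matrix.det_fin_two] at h3
      simp only [firstForm_symm hye, gram_comm _ 1 0] at h3
      change gram g 0 0 (e p) * gram g 1 1 (e p) - gram g 0 1 (e p) * gram g 0 1 (e p) = 0 at h3
      rw [h0, h1, h2] at h3
      have h4 : s ^ 2 = 0 := by linear_combination h3 - s ^ 2 * H.det (e p) hyU
      rw [h0, pow_eq_zero_iff two_ne_zero |>.1 h4, zero_mul]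
    obtain ⟨U', hU'U, hU'o, hyU', ha', hb', hc'⟩ :=
      H.contDiffOn_conf_of_singular hyU h00 ⟨i, hi'⟩
    exact ⟨h, U', hyU', hU'U.trans inter_subset_left, H.mono hU'o hU'U, ha', hb', hc', i, hi'⟩
  -- A nonsingular point need not lie in `W`. There the metric is a limit of positive definite ones
  -- with nonzero determinant, hence itself positive definite.
  · have hdense : e.target ⊆ closure (e.target ∩ e.symm ⁻¹' W) := target_subset_closure hf.dense e
    have hpos : ∀ x ∈ e.target ∩ (e.target ∩ e.symm ⁻¹' W), 0 < gram g 0 0 x ∧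
        0 < gram g 0 0 x * gram g 1 1 x - gram g 0 1 x ^ 2 := fun x hx =>
      gram_pos_of_posDef hx.1 (hf.cmc1 _ hx.2.2 e he (e.map_target hx.1)).1
    have hdc : ContDiffOn ℝ ∞ (fun x => gram g 0 0 x * gram g 1 1 x - gram g 0 1 x ^ 2) e.target :=
      ((hgr 0 0).mul (hgr 1 1)).sub ((hgr 0 1).pow 2)
    have h1 := nonneg_of_dense e.open_target hdense (hgr 0 0).continuousOn
      (fun x hx => (hpos x hx).1.le) (e p) hye
    have h2 := nonneg_of_dense e.open_target hdense hdc.continuousOn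
      (fun x hx => (hpos x hx).2.le) (e p) hye
    have h3 : gram g 0 0 (e p) * gram g 1 1 (e p) - gram g 0 1 (e p) ^ 2 ≠ 0 := by
      intro h0
      refine hsing ?_
      rw [IsSingularPt, ← he_def, ← hsy, Matrix.det_fin_two]
      simp only [firstForm_symm hye, gram_comm _ 1 0]
      rw [← sq]
      exact h0
    have h4 : gram g 0 0 (e p) ≠ 0 := by
      intro h0
      have h5 := lt_of_le_of_ne h2 h3.symm
      rw [h0] at h5
      nlinarith [sq_nonneg (gram g 0 1 (e p))]
    obtain ⟨H, ha, hb, hc⟩ := hf.planarFace_gram he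
    exact ⟨inducedClass e f, posSet e f, ⟨⟨hye, lt_of_le_of_ne h1 h4.symm⟩, lt_of_le_of_ne h2 h3.symm⟩,
      fun x hx => hx.1.1, H, ha, hb, hc, 0, fun h0 => h4 (by rw [gram, h0]; simp [lorentz])⟩

end Local

end CMCFace

namespace CMCFace

open Filter Topology Set
open scoped Matrix.Norms.Operator

/-! ### Smooth complex charts adapted to the face. -/

section AdaptedCharts

/-- The Jacobian of a linear map from the coordinate plane to `ℂ`. -/
noncomputable def jac (D : Plane →L[ℝ] ℂ) : ℝ :=
  (D (bvec 0)).re * (D (bvec 1)).im - (D (bvec 0)).im * (D (bvec 1)).re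

theorem det_plane (T : Plane →L[ℝ] Plane) :
    T.det = T (bvec 0) 0 * T (bvec 1) 1 - T (bvec 1) 0 * T (bvec 0) 1 := by
  rw [ContinuousLinearMap.det, ← LinearMap.det_toMatrix (EuclideanSpace.basisFun (Fin 2) ℝ).toBasis,
    Matrix.det_fin_two]
  simp [LinearMap.toMatrix_apply, bvec]

theorem jac_comp (D : Plane →L[ℝ] ℂ) (T : Plane →L[ℝ] Plane) :
    jac (D.comp T) = jac D * T.det := by
  rw [det_plane]
  simp only [jac, ContinuousLinearMap.comp_apply]
  rw [clm_plane_apply D (T (bvec 0)), clm_plane_apply D (T (bvec 1))]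
  simp
  ring

theorem jac_oneForm (α μ : ℂ) : jac (oneForm α (μ * α)) = Complex.normSq α * μ.im := by
  simp only [jac, oneForm_apply, bvec, Complex.normSq_apply]
  simp
  ring

variable {M : Type*} [TopologicalSpace M] [ChartedSpace Plane M]

/-- `c` is a smooth complex-valued coordinate of `M`. -/
structure IsSmoothCoord (c : OpenPartialHomeomorph M ℂ) : Prop where
  smooth : ContMDiffOn (𝓡 2) 𝓘(ℝ, ℂ) ∞ c c.source
  smooth_symm : ContMDiffOn 𝓘(ℝ, ℂ) (𝓡 2) ∞ c.symm c.target

/-- A smooth complex coordinate which is compatible with the orientation and the conformal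
structure of `f` on `W`. -/
structure IsAdaptedChart (f : M → Fin 4 → ℝ) (W : Set M) (c : OpenPartialHomeomorph M ℂ) : Prop
    extends IsSmoothCoord c where
  positive : ∀ e ∈ atlas Plane M, ∀ x ∈ c.source ∩ e.source, 0 < jac (fderiv ℝ (c ∘ e.symm) (e x))
  conf : ∀ x ∈ W ∩ c.source, ∃ l : ℝ, 0 < l ∧ ∀ v w : ℂ,
    lorentz (fderiv ℝ (f ∘ c.symm) (c x) v) (fderiv ℝ (f ∘ c.symm) (c x) w) = l * inner ℝ v w

/-- `F` is a null lift of `f` in the coordinate `c`, with derivative `F'`. -/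
structure IsLocalLift (f : M → Fin 4 → ℝ) (c : OpenPartialHomeomorph M ℂ)
    (F F' : ℂ → Matrix (Fin 2) (Fin 2) ℂ) : Prop where
  deriv : ∀ z ∈ c.target, HasDerivAt F (F' z) z
  deriv_ne : ∀ z ∈ c.target, F' z ≠ 0
  det_deriv : ∀ z ∈ c.target, (F' z).det = 0
  det : ∀ z ∈ c.target, (F z).det = 1
  lift : ∀ z ∈ c.target, toHerm (f (c.symm z)) = F z * e₃ * (F z)ᴴ

theorem lorentz_clm (D : Plane →L[ℝ] (Fin 4 → ℝ)) (u v : Plane) : lorentz (D u) (D v) =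
    u 0 * v 0 * lorentz (D (bvec 0)) (D (bvec 0))
      + (u 0 * v 1 + u 1 * v 0) * lorentz (D (bvec 0)) (D (bvec 1))
      + u 1 * v 1 * lorentz (D (bvec 1)) (D (bvec 1)) := by
  rw [clm_plane_apply D u, clm_plane_apply D v]
  simp only [lorentz_add_left, lorentz_add_right, lorentz_smul_left, lorentz_smul_right,
    lorentz_comm (D (bvec 1)) (D (bvec 0))]
  ring

theorem inner_add_mul_mul (p q r s : ℝ) (μ α : ℂ) :
    inner ℝ (((p : ℂ) + q * μ) * α) (((r : ℂ) + s * μ) * α) =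
      Complex.normSq α * ((p + q * μ.re) * (r + s * μ.re) + q * s * μ.im ^ 2) := by
  rw [Complex.inner, Complex.normSq_apply]
  simp
  ring

/-- The quadratic form of `h` is `a |dx₀ + μ dx₁|² = (a / |α|²) |dz|²`, because `ac = b² + 1`. -/
theorem IsHoloCoord.conformal {h : ConfClass} {g : Plane → Fin 4 → ℝ}
    {e : OpenPartialHomeomorph Plane ℂ} {α : Plane → ℂ} (he : IsHoloCoord h e α) {x : Plane}
    (hx : x ∈ e.source) (hg : DifferentiableAt ℝ g x) (ha : 0 < h.a x)
    (hdet : h.a x * h.c x - h.b x ^ 2 = 1) {s : ℝ} (hs : 0 < s) (h00 : gram g 0 0 x = s * h.a x)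
    (h01 : gram g 0 1 x = s * h.b x) (h11 : gram g 1 1 x = s * h.c x) :
    ∃ l : ℝ, 0 < l ∧ ∀ v w : ℂ, lorentz (fderiv ℝ (g ∘ e.symm) (e x) v)
      (fderiv ℝ (g ∘ e.symm) (e x) w) = l * inner ℝ v w := by
  have hxs := e.left_inv hx
  obtain ⟨T, hT, hTα⟩ := he.exists_hasFDerivAt_symm (e.map_source hx) (by rwa [hxs])
  rw [hxs] at hTα
  have hα := he.ne_zero x hx
  have hD : fderiv ℝ (g ∘ e.symm) (e x) = (fderiv ℝ g x).comp T := by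
    have h1 : HasFDerivAt g (fderiv ℝ g x) (e.symm (e x)) := by rw [hxs]; exact hg.hasFDerivAt
    exact (h1.comp (e x) hT).fderiv
  refine ⟨s * h.a x / Complex.normSq (α x), div_pos (mul_pos hs ha) (Complex.normSq_pos.2 hα),
    fun v w => ?_⟩
  rw [hD, ContinuousLinearMap.comp_apply, ContinuousLinearMap.comp_apply, lorentz_clm]
  change _ * gram g 0 0 x + _ * gram g 0 1 x + _ * gram g 1 1 x = _
  rw [h00, h01, h11]
  have hin : inner ℝ v w = Complex.normSq (α x) * ((T v 0 + T v 1 * (h.b x / h.a x)) *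
      (T w 0 + T w 1 * (h.b x / h.a x)) + T v 1 * T w 1 / h.a x ^ 2) := by
    have hre : (h.slope x).re = h.b x / h.a x := by
      rw [ConfClass.slope, Complex.div_ofReal_re]; simp
    have h1 := inner_add_mul_mul (T v 0) (T v 1) (T w 0) (T w 1) (h.slope x) (α x)
    rw [hTα, hTα, hre, ConfClass.slope_im] at h1
    rw [h1]
    ring
  rw [hin]
  have hn : Complex.normSq (α x) ≠ 0 := (Complex.normSq_pos.2 hα).ne'
  field_simp
  linear_combination (T v 1 * T w 1) * hdet

variable [IsManifold (𝓡 2) ∞ M] {f : M → Fin 4 → ℝ} {W : Set M}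

/-- With the conformal class now smooth, the isothermal coordinate and its inverse are smooth. The
coordinate is restricted to a disc on which the null lift exists. -/
theorem IsCMC1Face.exists_adaptedChart (hor : IsOrientedAtlas M) (hf : IsCMC1Face f W) (p : M) :
    ∃ (c : OpenPartialHomeomorph M ℂ) (F F' : ℂ → Matrix (Fin 2) (Fin 2) ℂ), p ∈ c.source ∧
      IsAdaptedChart f W c ∧ IsLocalLift f c F F' := by
  obtain ⟨h, U, hyU, hUe, H, ha, hb, hc, hd⟩ := hf.exists_planarFace p
  set e := chartAt Plane p with he_def
  have he : e ∈ atlas Plane M := chart_mem_atlas Plane p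
  have hpe : p ∈ e.source := mem_chart_source Plane p
  set g := f ∘ e.symm with hg
  obtain ⟨k, α, hyk, hkU, hk, -, hks, hks'⟩ := H.exists_coord hyU (hd _ hyU) (n := ∞)
    (by norm_cast) le_rfl ha hb hc
  obtain ⟨ρ, hρ, hρt, F, hF⟩ := H.exists_lift hk hkU hyk
  let c := e.trans (k.trans (OpenPartialHomeomorph.ofSet (Metric.ball (k (e p)) ρ)
    Metric.isOpen_ball))
  have hcs : ∀ x ∈ c.source, x ∈ e.source ∧ e x ∈ k.source := fun x hx => by
    simp only [c, OpenPartialHomeomorph.trans_source] at hx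
    exact ⟨hx.1, hx.2.1⟩
  have hct : ∀ z ∈ c.target, z ∈ Metric.ball (k (e p)) ρ := fun z hz => by
    simp only [c, OpenPartialHomeomorph.trans_target] at hz
    exact hz.1.1
  have hcoe : ∀ x, c x = k (e x) := fun x => rfl
  have hcoes : ∀ z, c.symm z = e.symm (k.symm z) := fun z => rfl
  have hes : ContMDiffOn (𝓡 2) (𝓡 2) ∞ e e.source :=
    contMDiffOn_of_mem_maximalAtlas (IsManifold.subset_maximalAtlas he)
  have hes' : ContMDiffOn (𝓡 2) (𝓡 2) ∞ e.symm e.target :=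
    contMDiffOn_symm_of_mem_maximalAtlas (IsManifold.subset_maximalAtlas he)
  refine ⟨c, F, fun z => (α (k.symm z))⁻¹ • h.form₁ g 1 (k.symm z) * F z, ?_, ⟨⟨?_, ?_⟩, ?_, ?_⟩,
    ⟨?_, ?_, ?_, ?_, ?_⟩⟩
  · simp only [c, OpenPartialHomeomorph.trans_source]
    exact ⟨hpe, hyk, Metric.mem_ball_self hρ⟩
  · exact (contMDiffOn_iff_contDiffOn.2 hks).comp (hes.mono fun x hx => (hcs x hx).1)
      fun x hx => (hcs x hx).2
  · exact hes'.comp ((contMDiffOn_iff_contDiffOn.2 hks').mono fun z hz => hρt (hct z hz))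
      fun z hz => hUe (hkU (k.map_target (hρt (hct z hz))))
  · rintro e' he' x ⟨hxc, hxe'⟩
    obtain ⟨hxe, hxk⟩ := hcs x hxc
    have h1 : DifferentiableAt ℝ (e ∘ e'.symm) (e' x) := by
      have h2 := contDiffOn_comp_chart_symm le_rfl hes he'
      refine (h2.contDiffAt ((e'.isOpen_inter_preimage_symm e.open_source).mem_nhds
        ⟨e'.map_source hxe', ?_⟩)).differentiableAt (by simp)
      rw [mem_preimage, e'.left_inv hxe']
      exact hxe
    have h2 : HasFDerivAt (c ∘ e'.symm) ((oneForm (α (e x)) (h.slope (e x) * α (e x))).comp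
        (fderiv ℝ (e ∘ e'.symm) (e' x))) (e' x) := by
      have h3 : HasFDerivAt k (oneForm (α (e x)) (h.slope (e x) * α (e x)))
          ((e ∘ e'.symm) (e' x)) := by
        rw [Function.comp, e'.left_inv hxe']
        exact hk.deriv _ hxk
      exact h3.comp (e' x) h1.hasFDerivAt
    -- The Jacobian in the chart at `p` is `|α|² / a > 0`; oriented chart changes preserve the sign.
    rw [h2.fderiv, jac_comp, jac_oneForm, ConfClass.slope_im]
    exact mul_pos (mul_pos (Complex.normSq_pos.2 (hk.ne_zero _ hxk))
      (one_div_pos.2 (H.pos _ (hkU hxk)))) (hor e' he' e he x ⟨hxe', hxe⟩)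
  · rintro x ⟨hxW, hxc⟩
    obtain ⟨hxe, hxk⟩ := hcs x hxc
    have hxU := hkU hxk
    obtain ⟨s, hs, h00, h01, h11⟩ := (H.cmc (e x) ⟨hxU, hUe hxU, by
      rw [mem_preimage, e.left_inv hxe]; exact hxW⟩).conf.self_of_nhds
    exact hk.conformal hxk ((H.smooth_g.contDiffAt (H.isOpen.mem_nhds hxU)).differentiableAt
      (by simp)) (H.pos _ hxU) (H.det _ hxU) hs h00 h01 h11
  · exact fun z hz => (hF z (hct z hz)).1
  · intro z hz h0
    have hzt := hρt (hct z hz)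
    have hzU := hkU (k.map_target hzt)
    have hα := hk.ne_zero _ (k.map_target hzt)
    refine H.form₁_ne_zero hzU (hd _ hzU) ?_
    have hFF : F z * (F z).adjugate = 1 := by
      rw [Matrix.mul_adjugate, (hF z (hct z hz)).2.1, one_smul]
    have h1 : (α (k.symm z))⁻¹ • h.form₁ g 1 (k.symm z) = 0 := by
      rw [← mul_one (_ • _), ← hFF, ← mul_assoc, h0, zero_mul]
    exact (smul_eq_zero.1 h1).resolve_left (inv_ne_zero hα)
  · intro z hz
    rw [Matrix.det_mul, Matrix.det_smul, H.det_form₁ (hkU (k.map_target (hρt (hct z hz))))]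
    simp
  · exact fun z hz => (hF z (hct z hz)).2.1
  · exact fun z hz => (hF z (hct z hz)).2.2

end AdaptedCharts

end CMCFace

namespace CMCFace

open Filter Topology Set

/-! ### Coordinate changes and the complex structure. -/

section Transition

/-- The Jacobian of a real linear endomorphism of `ℂ`. -/
noncomputable def jacC (D : ℂ →L[ℝ] ℂ) : ℝ :=
  (D 1).re * (D Complex.I).im - (D 1).im * (D Complex.I).re

theorem clm_complex_apply {E : Type*} [NormedAddCommGroup E] [NormedSpace ℝ E] (D : ℂ →L[ℝ] E)
    (v : ℂ) : D v = v.re • D 1 + v.im • D Complex.I := by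
  rw [← map_smul, ← map_smul, ← map_add]
  congr 1
  apply Complex.ext <;> simp

theorem jac_comp_complex (D : ℂ →L[ℝ] ℂ) (A : Plane →L[ℝ] ℂ) :
    jac (D.comp A) = jacC D * jac A := by
  simp only [jac, jacC, ContinuousLinearMap.comp_apply]
  rw [clm_complex_apply D (A (bvec 0)), clm_complex_apply D (A (bvec 1))]
  simp
  ring

/-- A conformal linear map of the plane with positive determinant is complex linear: with columns
`(p, q)` and `(s, t)` one gets `(t - p)² + (s + q)² = 0`. -/
theorem cauchyRiemann_of_conformal {D : ℂ →L[ℝ] ℂ} {l l' : ℝ} (hl' : 0 < l')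
    (h : ∀ v w : ℂ, l * inner ℝ v w = l' * inner ℝ (D v) (D w)) (hD : 0 < jacC D) :
    D Complex.I = Complex.I • D 1 := by
  have h1 := h 1 1
  have h2 := h Complex.I Complex.I
  have h3 := h 1 Complex.I
  simp only [Complex.inner, Complex.mul_re, Complex.conj_re, Complex.conj_im, Complex.one_re,
    Complex.one_im, Complex.I_re, Complex.I_im] at h1 h2 h3
  set p := (D 1).re
  set q := (D 1).im
  set s := (D Complex.I).re
  set t := (D Complex.I).im
  have hD' : 0 < p * t - q * s := hD
  have e1 : p ^ 2 + q ^ 2 = s ^ 2 + t ^ 2 := by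
    have : l' * (p ^ 2 + q ^ 2) = l' * (s ^ 2 + t ^ 2) := by linear_combination h2 - h1
    exact mul_left_cancel₀ hl'.ne' this
  have e2 : p * s + q * t = 0 := by
    have : l' * (p * s + q * t) = l' * 0 := by linear_combination -h3
    exact mul_left_cancel₀ hl'.ne' this
  have e3 : p * t - q * s = p ^ 2 + q ^ 2 := by
    have h4 : (p * t - q * s) ^ 2 = (p ^ 2 + q ^ 2) ^ 2 := by
      linear_combination -(p ^ 2 + q ^ 2) * e1 - (p * s + q * t) * e2
    exact (pow_left_inj₀ hD'.le (by positivity) two_ne_zero).1 h4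
  have e4 : (t - p) ^ 2 + (s + q) ^ 2 = 0 := by linear_combination -e1 - 2 * e3
  have e5 : t = p := by nlinarith [sq_nonneg (t - p), sq_nonneg (s + q)]
  have e6 : s = -q := by nlinarith [sq_nonneg (t - p), sq_nonneg (s + q)]
  apply Complex.ext
  · simpa using e6
  · simpa using e5

variable {M : Type*} [TopologicalSpace M] {f : M → Fin 4 → ℝ} {W : Set M}

theorem mem_trans_source {c c' : OpenPartialHomeomorph M ℂ} {z : ℂ} :
    z ∈ (c.symm.trans c').source ↔ z ∈ c.target ∧ c.symm z ∈ c'.source := by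
  rw [OpenPartialHomeomorph.trans_source, OpenPartialHomeomorph.symm_source]
  rfl

theorem mem_trans_source' {c c' : OpenPartialHomeomorph M ℂ} {x : M} (hx : x ∈ c.source)
    (hx' : x ∈ c'.source) : c x ∈ (c.symm.trans c').source :=
  mem_trans_source.2 ⟨c.map_source hx, by rwa [c.left_inv hx]⟩

theorem exists_hasDerivAt_transition {c c' : OpenPartialHomeomorph M ℂ}
    (hc : DifferentiableOn ℂ (c' ∘ c.symm) (c.symm.trans c').source)
    (hc' : DifferentiableOn ℂ (c ∘ c'.symm) (c'.symm.trans c).source) {x : M}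
    (hx : x ∈ c.source) (hx' : x ∈ c'.source) : ∃ t : ℂ, t ≠ 0 ∧
      HasDerivAt (c' ∘ c.symm) t (c x) ∧ HasDerivAt (c ∘ c'.symm) t⁻¹ (c' x) := by
  have h1 := (hc.differentiableAt ((c.symm.trans c').open_source.mem_nhds
    (mem_trans_source' hx hx'))).hasDerivAt
  have h2 := (hc'.differentiableAt ((c'.symm.trans c).open_source.mem_nhds
    (mem_trans_source' hx' hx))).hasDerivAt
  have h3 : HasDerivAt (c ∘ c'.symm) (deriv (c ∘ c'.symm) (c' x)) ((c' ∘ c.symm) (c x)) := by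
    rw [Function.comp, c.left_inv hx]
    exact h2
  have h4 := h3.comp (c x) h1
  have h5 : HasDerivAt ((c ∘ c'.symm) ∘ (c' ∘ c.symm)) 1 (c x) := by
    refine (hasDerivAt_id (c x)).congr_of_eventuallyEq ?_
    filter_upwards [(c.symm.trans c').open_source.mem_nhds (mem_trans_source' hx hx')] with z hz
    obtain ⟨hz1, hz2⟩ := mem_trans_source.1 hz
    simp only [Function.comp, id]
    rw [c'.left_inv hz2, c.right_inv hz1]
  have h6 := h4.unique h5
  refine ⟨_, right_ne_zero_of_mul_eq_one h6, h1, ?_⟩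
  rw [← eq_inv_of_mul_eq_one_left h6]
  exact h2

theorem hasFDerivAt_comp_symm {E : Type*} [NormedAddCommGroup E] [NormedSpace ℝ E] {u : M → E}
    {c c' : OpenPartialHomeomorph M ℂ} {x : M} (hx : x ∈ c.source) (hx' : x ∈ c'.source)
    (hu : DifferentiableAt ℝ (u ∘ c'.symm) (c' x)) {D : ℂ →L[ℝ] ℂ}
    (hD : HasFDerivAt (c' ∘ c.symm) D (c x)) :
    HasFDerivAt (u ∘ c.symm) ((fderiv ℝ (u ∘ c'.symm) (c' x)).comp D) (c x) := by
  have h1 : HasFDerivAt (u ∘ c'.symm) (fderiv ℝ (u ∘ c'.symm) (c' x)) ((c' ∘ c.symm) (c x)) := by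
    rw [Function.comp, c.left_inv hx]
    exact hu.hasFDerivAt
  refine (h1.comp (c x) hD).congr_of_eventuallyEq ?_
  filter_upwards [(c.symm.trans c').open_source.mem_nhds (mem_trans_source' hx hx')] with z hz
  simp only [Function.comp]
  rw [c'.left_inv (mem_trans_source.1 hz).2]

theorem hasFDerivAt_comp_chart_symm {c c' : OpenPartialHomeomorph M ℂ}
    {e : OpenPartialHomeomorph M Plane} {x : M} (hx : x ∈ c.source) (hxe : x ∈ e.source)
    {D : ℂ →L[ℝ] ℂ} (hD : HasFDerivAt (c' ∘ c.symm) D (c x))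
    (hc : DifferentiableAt ℝ (c ∘ e.symm) (e x)) :
    HasFDerivAt (c' ∘ e.symm) (D.comp (fderiv ℝ (c ∘ e.symm) (e x))) (e x) := by
  have h1 : HasFDerivAt (c' ∘ c.symm) D ((c ∘ e.symm) (e x)) := by
    rw [Function.comp, e.left_inv hxe]
    exact hD
  refine (h1.comp (e x) hc.hasFDerivAt).congr_of_eventuallyEq ?_
  filter_upwards [(e.isOpen_inter_preimage_symm c.open_source).mem_nhds
    ⟨e.map_source hxe, by rw [mem_preimage, e.left_inv hxe]; exact hx⟩] with z hz
  simp only [Function.comp]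
  rw [c.left_inv hz.2]

variable [ChartedSpace Plane M]

theorem IsSmoothCoord.contDiffOn_transition {c c' : OpenPartialHomeomorph M ℂ}
    (hc : IsSmoothCoord c) (hc' : IsSmoothCoord c') :
    ContDiffOn ℝ ∞ (c' ∘ c.symm) (c.symm.trans c').source :=
  contMDiffOn_iff_contDiffOn.1 (hc'.smooth.comp (hc.smooth_symm.mono fun _ hz =>
    (mem_trans_source.1 hz).1) fun _ hz => (mem_trans_source.1 hz).2)

theorem IsSmoothCoord.contDiffOn_comp_symm {c : OpenPartialHomeomorph M ℂ} (hc : IsSmoothCoord c)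
    {E : Type*} [NormedAddCommGroup E] [NormedSpace ℝ E] {u : M → E}
    (hu : ContMDiff (𝓡 2) 𝓘(ℝ, E) ∞ u) : ContDiffOn ℝ ∞ (u ∘ c.symm) c.target :=
  contMDiffOn_iff_contDiffOn.1 (hu.comp_contMDiffOn hc.smooth_symm)

variable [IsManifold (𝓡 2) ∞ M]

theorem IsSmoothCoord.differentiableAt_comp_chart_symm {c : OpenPartialHomeomorph M ℂ}
    (hc : IsSmoothCoord c) {e : OpenPartialHomeomorph M Plane} (he : e ∈ atlas Plane M) {x : M}
    (hx : x ∈ c.source) (hxe : x ∈ e.source) : DifferentiableAt ℝ (c ∘ e.symm) (e x) := by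
  refine ((contDiffOn_comp_chart_symm le_rfl hc.smooth he).contDiffAt
    ((e.isOpen_inter_preimage_symm c.open_source).mem_nhds
      ⟨e.map_source hxe, ?_⟩)).differentiableAt (by simp)
  rw [mem_preimage, e.left_inv hxe]
  exact hx

/-- The coordinate changes between adapted charts are holomorphic. -/
theorem IsAdaptedChart.differentiableOn (hf : ContMDiff (𝓡 2) 𝓘(ℝ, Fin 4 → ℝ) ∞ f) (hW : Dense W)
    {c c' : OpenPartialHomeomorph M ℂ}
    (hc : IsAdaptedChart f W c) (hc' : IsAdaptedChart f W c') :
    DifferentiableOn ℂ (c' ∘ c.symm) (c.symm.trans c').source := by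
  have hS := (c.symm.trans c').open_source
  have hτ := hc.toIsSmoothCoord.contDiffOn_transition hc'.toIsSmoothCoord
  have hcr : ∀ z ∈ (c.symm.trans c').source, fderiv ℝ (c' ∘ c.symm) z Complex.I =
      Complex.I • fderiv ℝ (c' ∘ c.symm) z 1 := by
    have hdc : ContinuousOn (fderiv ℝ (c' ∘ c.symm)) (c.symm.trans c').source :=
      (hτ.fderiv_of_isOpen (m := ∞) hS le_rfl).continuousOn
    -- Conformality is known only on `W`. The coordinate change being smooth, the Cauchy-Riemann
    -- equations extend to the closure.
    refine eqOn_of_dense hS (V := c.target ∩ c.symm ⁻¹' W)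
      (fun z hz => target_subset_closure hW c (mem_trans_source.1 hz).1)
      (hdc.clm_apply continuousOn_const) ((hdc.clm_apply continuousOn_const).const_smul Complex.I)
      fun z hz => ?_
    obtain ⟨hz, hzt, hzW⟩ := hz
    set x := c.symm z with hx
    have hxc : x ∈ c.source := c.map_target hzt
    have hxc' : x ∈ c'.source := (mem_trans_source.1 hz).2
    have hcx : c x = z := c.right_inv hzt
    have hD : HasFDerivAt (c' ∘ c.symm) (fderiv ℝ (c' ∘ c.symm) z) (c x) := by
      rw [hcx]
      exact ((hτ.contDiffAt (hS.mem_nhds hz)).differentiableAt (by simp)).hasFDerivAt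
    obtain ⟨l, -, hl⟩ := hc.conf x ⟨hzW, hxc⟩
    obtain ⟨l', hl', hll⟩ := hc'.conf x ⟨hzW, hxc'⟩
    refine cauchyRiemann_of_conformal (l := l) hl' (fun v w => ?_) ?_
    · have hfd := ((hc'.toIsSmoothCoord.contDiffOn_comp_symm hf).contDiffAt
        (c'.open_target.mem_nhds (c'.map_source hxc'))).differentiableAt (by simp)
      rw [← hl, ← hll, (hasFDerivAt_comp_symm hxc hxc' hfd hD).fderiv]
      rfl
    · have he := chart_mem_atlas Plane x
      have hxe := mem_chart_source Plane x
      have h1 := hc.positive _ he x ⟨hxc, hxe⟩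
      have h2 := hc'.positive _ he x ⟨hxc', hxe⟩
      rw [(hasFDerivAt_comp_chart_symm hxc hxe hD
        (hc.toIsSmoothCoord.differentiableAt_comp_chart_symm he hxc hxe)).fderiv,
        jac_comp_complex] at h2
      exact (pos_iff_pos_of_mul_pos h2).2 h1
  intro z hz
  exact (differentiableAt_complex_iff_differentiableAt_real.2
    ⟨(hτ.contDiffAt (hS.mem_nhds hz)).differentiableAt (by simp), hcr z hz⟩).differentiableWithinAt

theorem jacC_smul_one (t : ℂ) :
    jacC ((ContinuousLinearMap.toSpanSingleton ℂ t).restrictScalars ℝ) = Complex.normSq t := by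
  simp [jacC, Complex.normSq_apply]

/-- A chart with holomorphic coordinate changes to adapted charts is adapted. -/
theorem isAdaptedChart_of_differentiableOn (hf : ContMDiff (𝓡 2) 𝓘(ℝ, Fin 4 → ℝ) ∞ f)
    (hcov : ∀ x, ∃ c, IsAdaptedChart f W c ∧ x ∈ c.source) {c : OpenPartialHomeomorph M ℂ}
    (hc : ∀ c', IsAdaptedChart f W c' →
      DifferentiableOn ℂ (c' ∘ c.symm) (c.symm.trans c').source ∧
      DifferentiableOn ℂ (c ∘ c'.symm) (c'.symm.trans c).source) : IsAdaptedChart f W c := by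
  have hdiff : ∀ {τ : ℂ → ℂ} {S : Set ℂ}, IsOpen S → DifferentiableOn ℂ τ S →
      ContDiffOn ℝ ∞ τ S := fun hS hτ => (hτ.contDiffOn hS).restrict_scalars ℝ
  have hsm : IsSmoothCoord c := by
    constructor
    · intro x hx
      obtain ⟨c', hc', hxc'⟩ := hcov x
      have hS := (c'.symm.trans c).open_source
      have h1 : ContMDiffOn (𝓡 2) 𝓘(ℝ, ℂ) ∞ ((c ∘ c'.symm) ∘ c') (c'.source ∩ c.source) :=
        (contMDiffOn_iff_contDiffOn.2 (hdiff hS (hc c' hc').2)).comp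
          (hc'.smooth.mono inter_subset_left) fun y hy => mem_trans_source' hy.1 hy.2
      have h2 : ContMDiffOn (𝓡 2) 𝓘(ℝ, ℂ) ∞ c (c'.source ∩ c.source) :=
        h1.congr fun y hy => by simp only [Function.comp]; rw [c'.left_inv hy.1]
      exact (h2.contMDiffAt ((c'.open_source.inter c.open_source).mem_nhds
        ⟨hxc', hx⟩)).contMDiffWithinAt
    · intro z hz
      obtain ⟨c', hc', hxc'⟩ := hcov (c.symm z)
      have hS := (c.symm.trans c').open_source
      have h1 : ContMDiffOn 𝓘(ℝ, ℂ) (𝓡 2) ∞ (c'.symm ∘ (c' ∘ c.symm)) (c.symm.trans c').source :=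
        hc'.smooth_symm.comp (contMDiffOn_iff_contDiffOn.2 (hdiff hS (hc c' hc').1))
          fun y hy => c'.map_source (mem_trans_source.1 hy).2
      have h2 : ContMDiffOn 𝓘(ℝ, ℂ) (𝓡 2) ∞ c.symm (c.symm.trans c').source :=
        h1.congr fun y hy => by
          simp only [Function.comp]; rw [c'.left_inv (mem_trans_source.1 hy).2]
      exact (h2.contMDiffAt (hS.mem_nhds (mem_trans_source.2 ⟨hz, hxc'⟩))).contMDiffWithinAt
  have key : ∀ c', IsAdaptedChart f W c' → ∀ x ∈ c.source, x ∈ c'.source → ∃ t : ℂ, t ≠ 0 ∧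
      HasDerivAt (c' ∘ c.symm) t (c x) ∧ HasDerivAt (c ∘ c'.symm) t⁻¹ (c' x) :=
    fun c' hc' x hx hx' => exists_hasDerivAt_transition (hc c' hc').1 (hc c' hc').2 hx hx'
  refine ⟨hsm, ?_, ?_⟩
  · rintro e he x ⟨hx, hxe⟩
    obtain ⟨c', hc', hx'⟩ := hcov x
    obtain ⟨t, ht, -, h2⟩ := key c' hc' x hx hx'
    have h3 := hc'.positive e he x ⟨hx', hxe⟩
    rw [(hasFDerivAt_comp_chart_symm hx' hxe (h2.hasFDerivAt.restrictScalars ℝ)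
      (hc'.toIsSmoothCoord.differentiableAt_comp_chart_symm he hx' hxe)).fderiv,
      jac_comp_complex, jacC_smul_one]
    exact mul_pos (Complex.normSq_pos.2 (inv_ne_zero ht)) h3
  · rintro x ⟨hxW, hx⟩
    obtain ⟨c', hc', hx'⟩ := hcov x
    obtain ⟨t, ht, h1, -⟩ := key c' hc' x hx hx'
    obtain ⟨l, hl, hll⟩ := hc'.conf x ⟨hxW, hx'⟩
    have hfd := ((hc'.toIsSmoothCoord.contDiffOn_comp_symm hf).contDiffAt
        (c'.open_target.mem_nhds (c'.map_source hx'))).differentiableAt (by simp)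
    refine ⟨l * Complex.normSq t, mul_pos hl (Complex.normSq_pos.2 ht), fun v w => ?_⟩
    rw [(hasFDerivAt_comp_symm hx hx' hfd (h1.hasFDerivAt.restrictScalars ℝ)).fderiv,
      ContinuousLinearMap.comp_apply, ContinuousLinearMap.comp_apply, hll, mul_assoc]
    congr 1
    simp [Complex.inner, Complex.normSq_apply]
    ring

/-- The complex structure of the adapted charts. -/
def adaptedStructure (hf : ContMDiff (𝓡 2) 𝓘(ℝ, Fin 4 → ℝ) ∞ f) (hW : Dense W)
    (hcov : ∀ x, ∃ c, IsAdaptedChart f W c ∧ x ∈ c.source) : ComplexStructure M where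
  charts := {c | IsAdaptedChart f W c}
  cover := hcov
  smooth := fun _ hc => ⟨hc.smooth, hc.smooth_symm⟩
  holo := fun _ hc _ hc' => IsAdaptedChart.differentiableOn hf hW hc hc'
  maximal := fun _ hc => isAdaptedChart_of_differentiableOn hf hcov hc

/-- All charts of `J` are adapted, and an adapted chart is compatible with all of them, so
maximality of `J` puts it in `J`. -/
theorem eq_adaptedStructure (hf : ContMDiff (𝓡 2) 𝓘(ℝ, Fin 4 → ℝ) ∞ f) (hW : Dense W)
    (hcov : ∀ x, ∃ c, IsAdaptedChart f W c ∧ x ∈ c.source) (J : ComplexStructure M)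
    (hJ : J.IsPositive) (hJf : J.IsConformalOn f W) : J = adaptedStructure hf hW hcov := by
  have hsub : ∀ c ∈ J.charts, IsAdaptedChart f W c := fun c hc =>
    ⟨⟨(J.smooth c hc).1, (J.smooth c hc).2⟩, hJ c hc, hJf c hc⟩
  ext c
  refine ⟨hsub c, fun hc => J.maximal c fun c' hc' => ?_⟩
  exact ⟨IsAdaptedChart.differentiableOn hf hW hc (hsub c' hc'),
    IsAdaptedChart.differentiableOn hf hW (hsub c' hc') hc⟩

end Transition

end CMCFace

namespace CMCFace

open Filter Topology Set
open scoped Matrix.Norms.Operator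

/-! ### No null lift for the opposite orientation. -/

section Orientation

variable {h : ConfClass} {g : Plane → Fin 4 → ℝ} {U V : Set Plane}

theorem pderiv_mul_comp {u φ : Plane → ℂ} {a : ℂ → ℂ} {a' : ℂ} {y : Plane}
    (hu : DifferentiableAt ℝ u y) (hφ : DifferentiableAt ℝ φ y) (ha : HasDerivAt a a' (φ y))
    (k : Fin 2) : pderiv k (fun x => u x * a (φ x)) y =
      pderiv k u y * a (φ y) + u y * (pderiv k φ y * a') := by
  have hd : DifferentiableAt ℝ (fun x => u x * a (φ x)) y :=
    hu.mul ((ha.hasFDerivAt.restrictScalars ℝ).differentiableAt.comp y hφ)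
  have hy : φ (y + (0 : ℝ) • bvec k) = φ y := by simp
  have h1 := (hφ.hasDerivAt_line k)
  have h2 : HasDerivAt (fun t : ℝ => a (φ (y + t • bvec k))) (pderiv k φ y • a') 0 := by
    rw [← hy] at ha
    exact ha.scomp (0 : ℝ) h1
  have h3 := ((hu.hasDerivAt_line k).mul h2).unique (hd.hasDerivAt_line k)
  rw [← h3]
  simp

/-- The form with `ε = -1` is the (0,1)-part of `dg g⁻¹`. When `p₀ dx₀ + p₁ dx₁` has type (0,1),
this projection kills the adjoint term and keeps the other one. -/
theorem ConfClass.form_neg_of_lift {x : Plane} (ha : h.a x ≠ 0)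
    (hdet : h.a x * h.c x - h.b x ^ 2 = 1) (hg : lorentz (g x) (g x) = 1) {p₀ p₁ : ℂ}
    (hp : p₁ = starRingEnd ℂ (h.slope x) * p₀) {A : Matrix (Fin 2) (Fin 2) ℂ}
    (h0 : toHerm (pderiv 0 g x) = p₀ • (A * toHerm (g x)) + (p₀ • (A * toHerm (g x)))ᴴ)
    (h1 : toHerm (pderiv 1 g x) = p₁ • (A * toHerm (g x)) + (p₁ • (A * toHerm (g x)))ᴴ) :
    h.form₁ g (-1) x = p₀ • A ∧ h.form₂ g (-1) x = p₁ • A := by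
  have haC : (h.a x : ℂ) ≠ 0 := by exact_mod_cast ha
  have hc : (h.c x : ℂ) = (h.b x ^ 2 + 1) / h.a x := by
    rw [eq_div_iff haC]
    have : h.c x * h.a x = h.b x ^ 2 + 1 := by linarith
    exact_mod_cast this
  have hinv : ∀ B : Matrix (Fin 2) (Fin 2) ℂ, B * toHerm (g x) * toHermInv (g x) = B := fun B => by
    rw [mul_assoc, toHerm_mul_toHermInv hg, mul_one]
  set Y := A * toHerm (g x) with hY
  have hs : starRingEnd ℂ (h.slope x) = (h.b x - Complex.I) / h.a x := by
    simp [ConfClass.slope, sub_eq_add_neg]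
  rw [hs] at hp
  have hI : Complex.I ^ 2 = -1 := Complex.I_sq
  constructor
  · rw [← hinv (p₀ • A), smul_mul_assoc, ← hY, ConfClass.form₁, ← smul_mul_assoc]
    congr 1
    rw [ConfClass.star₁, toHerm_sub, toHerm_smul, toHerm_smul, h0, h1, hp]
    simp only [← Complex.coe_smul, Matrix.conjTranspose_smul, smul_add, smul_sub, smul_smul]
    ext i j
    simp
    field_simp
    ring_nf
    simp only [hI]
    ring
  · rw [← hinv (p₁ • A), smul_mul_assoc, ← hY, ConfClass.form₂, ← smul_mul_assoc]
    congr 1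
    rw [ConfClass.star₂, toHerm_sub, toHerm_smul, toHerm_smul, h0, h1, hp]
    simp only [← Complex.coe_smul, Matrix.conjTranspose_smul, smul_add, smul_sub, smul_smul, hc]
    ext i j
    simp
    field_simp
    ring_nf
    simp only [hI]
    ring

/-- The face has no null lift which is holomorphic for the opposite orientation. -/
theorem PlanarFace.false_of_antiholomorphic_lift (H : PlanarFace h g U V) {O : Set Plane}
    (hO : IsOpen O) (hOU : O ⊆ U) {y : Plane} (hy : y ∈ O) (hyV : y ∈ V) {φ : Plane → ℂ}
    (hφ : ContDiffOn ℝ 2 φ O)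
    (hφa : ∀ x ∈ O, pderiv 1 φ x = starRingEnd ℂ (h.slope x) * pderiv 0 φ x)
    {S : Set ℂ} (hS : IsOpen S) (hOS : MapsTo φ O S) {Ψ : ℂ → Matrix (Fin 2) (Fin 2) ℂ}
    (hΨ : ∀ i j, DifferentiableOn ℂ (fun z => Ψ z i j) S) (hdet : ∀ z ∈ S, (Ψ z).det = 1)
    (hg : ∀ x ∈ O, toHerm (g x) = Ψ (φ x) * e₃ * (Ψ (φ x))ᴴ) : False := by
  set Ψ' : ℂ → Matrix (Fin 2) (Fin 2) ℂ := fun z => Matrix.of fun i j =>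
    deriv (fun z => Ψ z i j) z with hΨ'
  have hΨd : ∀ z ∈ S, HasDerivAt Ψ (Ψ' z) z := fun z hz => hasDerivAt_matrix fun i j =>
    ((hΨ i j).differentiableAt (hS.mem_nhds hz)).hasDerivAt
  set A : ℂ → Matrix (Fin 2) (Fin 2) ℂ := fun z => Ψ' z * (Ψ z).adjugate with hA
  have hφd : ∀ x ∈ O, DifferentiableAt ℝ φ x := fun x hx =>
    (hφ.contDiffAt (hO.mem_nhds hx)).differentiableAt (by simp)
  have hgd : ∀ x ∈ O, DifferentiableAt ℝ g x := fun x hx =>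
    (H.smooth_g.contDiffAt (H.isOpen.mem_nhds (hOU hx))).differentiableAt (by simp)
  have hpd : ∀ x ∈ O, ∀ k, toHerm (pderiv k g x) = pderiv k φ x • (A (φ x) * toHerm (g x)) +
      (pderiv k φ x • (A (φ x) * toHerm (g x)))ᴴ := by
    intro x hx k
    have hx0 : φ (x + (0 : ℝ) • bvec k) = φ x := by simp
    have hAΨ : A (φ x) * Ψ (φ x) = Ψ' (φ x) := by
      rw [hA, mul_assoc, Matrix.adjugate_mul, hdet _ (hOS hx), one_smul, mul_one]
    have h1 : HasDerivAt (fun t : ℝ => Ψ (φ (x + t • bvec k))) (pderiv k φ x • Ψ' (φ x)) 0 := by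
      have h2 := hΨd _ (hOS hx)
      rw [← hx0] at h2
      exact (h2.scomp (0 : ℝ) ((hφd x hx).hasDerivAt_line k)).congr_deriv (by rw [hx0])
    have h2 := starCLM.hasFDerivAt.comp_hasDerivAt (0 : ℝ) h1
    have h3 := (h1.mul_const e₃).mul h2
    have h4 : HasDerivAt (fun t : ℝ => toHerm (g (x + t • bvec k))) _ 0 :=
      h3.congr_of_eventuallyEq (by
        filter_upwards [(tendsto_line x (bvec k)).eventually (hO.mem_nhds hx)] with t ht
        exact hg _ ht)
    rw [(hasDerivAt_toHerm_line (hgd x hx) k).unique h4]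
    simp only [Function.comp, zero_smul, add_zero]
    change pderiv k φ x • Ψ' (φ x) * e₃ * (Ψ (φ x))ᴴ
      + Ψ (φ x) * e₃ * (pderiv k φ x • Ψ' (φ x))ᴴ = _
    have he : e₃ᴴ = e₃ := by
      ext i j
      fin_cases i <;> fin_cases j <;> simp [e₃]
    rw [hg x hx, ← hAΨ]
    simp only [Matrix.conjTranspose_smul, Matrix.conjTranspose_mul, smul_mul_assoc, mul_smul_comm,
      mul_assoc, he, Matrix.conjTranspose_conjTranspose]
  have hform : ∀ x ∈ O, h.form₁ g (-1) x = pderiv 0 φ x • A (φ x) ∧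
      h.form₂ g (-1) x = pderiv 1 φ x • A (φ x) := fun x hx =>
    ConfClass.form_neg_of_lift (H.pos x (hOU hx)).ne' (H.det x (hOU hx)) (H.unit x (hOU hx))
      (hφa x hx) (hpd x hx 0) (hpd x hx 1)
  refine (H.cmc y ⟨hOU hy, hyV⟩).not_closed ?_
  obtain ⟨hc1, hc2⟩ := H.contDiffOn_form (n := 1) (by norm_cast) H.smooth_a H.smooth_b
    H.smooth_c (-1)
  have hn := H.isOpen.mem_nhds (hOU hy)
  have hd1 := (hc1.contDiffAt hn).differentiableAt one_ne_zero
  have hd2 := (hc2.contDiffAt hn).differentiableAt one_ne_zero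
  have hφ2 : ContDiffAt ℝ 2 φ y := hφ.contDiffAt (hO.mem_nhds hy)
  ext i j
  rw [← pderiv_entry hd1, ← pderiv_entry hd2]
  have hAd : DifferentiableAt ℂ (fun z => A z i j) (φ y) := by
    have hSn := hS.mem_nhds (hOS hy)
    have h1 : ∀ i j, DifferentiableAt ℂ (fun z => Ψ z i j) (φ y) := fun i j =>
      (hΨ i j).differentiableAt hSn
    have h2 : ∀ i j, DifferentiableAt ℂ (fun z => Ψ' z i j) (φ y) := fun i j =>
      ((hΨ i j).deriv hS).differentiableAt hSn
    have h3 : ∀ i j, DifferentiableAt ℂ (fun z => (Ψ z).adjugate i j) (φ y) := by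
      intro i j
      fin_cases i <;> fin_cases j <;> simp only [Matrix.adjugate_fin_two] <;>
        first | exact h1 _ _ | exact (h1 _ _).neg
    simp only [hA, Matrix.mul_apply, Fin.sum_univ_two]
    exact ((h2 i 0).mul (h3 0 j)).add ((h2 i 1).mul (h3 1 j))
  have hcongr : ∀ (k : Fin 2) {u v : Plane → ℂ}, (∀ x ∈ O, u x = v x) →
      pderiv k u y = pderiv k v y := fun k u v huv => by
    have : u =ᶠ[𝓝 y] v := by filter_upwards [hO.mem_nhds hy] with x hx using huv x hx
    rw [pderiv, pderiv, this.fderiv_eq]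
  -- On `O` the form is `A(φ) dφ` with `A` holomorphic, hence closed, contrary to
  -- `CMC1At.not_closed`.
  rw [hcongr 0 (v := fun x => pderiv 1 φ x * A (φ x) i j) fun x hx => by rw [(hform x hx).2]; rfl,
    hcongr 1 (v := fun x => pderiv 0 φ x * A (φ x) i j) fun x hx => by rw [(hform x hx).1]; rfl,
    pderiv_mul_comp (differentiableAt_pderiv hφ2 1) (hφd y hy) hAd.hasDerivAt,
    pderiv_mul_comp (differentiableAt_pderiv hφ2 0) (hφd y hy) hAd.hasDerivAt,
    pderiv_comm hφ2 0 1]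
  ring

end Orientation

end CMCFace

namespace CMCFace

open Filter Topology Set

/-! ### A null lift forces the orientation. -/

section Uniqueness

/-- Determinants give `l · jac = ± s`; the negative Jacobian selects `-s`. The remaining equations
are then linear and give the (0,1)-relation. -/
theorem eq_conj_slope_mul {h : ConfClass} {x : Plane} (ha : 0 < h.a x)
    (hdet : h.a x * h.c x - h.b x ^ 2 = 1) {s l : ℝ} (hs : 0 < s) (hl : 0 < l) {p q : ℂ}
    (hpp : s * h.a x = l * inner ℝ p p) (hpq : s * h.b x = l * inner ℝ p q)
    (hqq : s * h.c x = l * inner ℝ q q) (hj : p.re * q.im - p.im * q.re < 0) :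
    q = starRingEnd ℂ (h.slope x) * p := by
  simp only [Complex.inner, Complex.mul_re, Complex.conj_re, Complex.conj_im] at hpp hpq hqq
  have h1 : l * (p.re * q.im - p.im * q.re) = -s := by
    have h2 : (l * (p.re * q.im - p.im * q.re)) ^ 2 = (-s) ^ 2 := by
      linear_combination s ^ 2 * hdet - l * (q.re ^ 2 + q.im ^ 2) * hpp
        - s * h.a x * hqq + (s * h.b x + l * (p.re * q.re + p.im * q.im)) * hpq
    rcases sq_eq_sq_iff_eq_or_eq_neg.1 h2 with h3 | h3
    · exact h3
    · have := mul_neg_of_pos_of_neg hl hj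
      linarith
  have hS : s ≠ 0 := hs.ne'
  have hA : h.a x ≠ 0 := ha.ne'
  have key : (h.a x : ℂ) * q = (h.b x - Complex.I) * p := by
    have h3 : s * (h.a x * q.re) = s * (h.b x * p.re + p.im) := by
      linear_combination q.re * hpp - p.re * hpq - p.im * h1
    have h4 : s * (h.a x * q.im) = s * (h.b x * p.im - p.re) := by
      linear_combination q.im * hpp - p.im * hpq + p.re * h1
    apply Complex.ext
    · simpa using mul_left_cancel₀ hS h3
    · simpa [sub_eq_add_neg] using mul_left_cancel₀ hS h4
  have hs : starRingEnd ℂ (h.slope x) = (h.b x - Complex.I) / h.a x := by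
    simp [ConfClass.slope, sub_eq_add_neg]
  have hAC : (h.a x : ℂ) ≠ 0 := by exact_mod_cast hA
  rw [hs]
  field_simp
  linear_combination key

variable {M : Type*} [TopologicalSpace M] [ChartedSpace Plane M] [IsManifold (𝓡 2) ∞ M]
  {f : M → Fin 4 → ℝ} {W : Set M}

theorem IsSmoothCoord.jac_ne_zero {c : OpenPartialHomeomorph M ℂ} (hc : IsSmoothCoord c)
    {e : OpenPartialHomeomorph M Plane} (he : e ∈ atlas Plane M) {x : M} (hx : x ∈ c.source)
    (hxe : x ∈ e.source) : jac (fderiv ℝ (c ∘ e.symm) (e x)) ≠ 0 := by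
  have h1 := hc.differentiableAt_comp_chart_symm he hx hxe
  have h2 : DifferentiableAt ℝ (e ∘ c.symm) (c x) := by
    have hes : ContMDiffOn (𝓡 2) (𝓡 2) ∞ e e.source :=
      contMDiffOn_of_mem_maximalAtlas (IsManifold.subset_maximalAtlas he)
    have h3 : ContMDiffOn 𝓘(ℝ, ℂ) (𝓡 2) ∞ (e ∘ c.symm) (c.target ∩ c.symm ⁻¹' e.source) :=
      hes.comp (hc.smooth_symm.mono inter_subset_left) fun z hz => hz.2
    refine ((contMDiffOn_iff_contDiffOn.1 h3).contDiffAt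
      ((c.isOpen_inter_preimage_symm e.open_source).mem_nhds
      ⟨c.map_source hx, ?_⟩)).differentiableAt (by simp)
    rw [mem_preimage, c.left_inv hx]
    exact hxe
  have h3 : HasFDerivAt (c ∘ e.symm) (fderiv ℝ (c ∘ e.symm) (e x)) ((e ∘ c.symm) (c x)) := by
    rw [Function.comp, c.left_inv hx]
    exact h1.hasFDerivAt
  have h4 := h3.comp (c x) h2.hasFDerivAt
  have h5 : HasFDerivAt ((c ∘ e.symm) ∘ (e ∘ c.symm)) (ContinuousLinearMap.id ℝ ℂ) (c x) := by
    refine (hasFDerivAt_id (c x)).congr_of_eventuallyEq ?_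
    filter_upwards [(c.isOpen_inter_preimage_symm e.open_source).mem_nhds
      ⟨c.map_source hx, by rw [mem_preimage, c.left_inv hx]; exact hxe⟩] with z hz
    simp only [Function.comp, id]
    rw [e.left_inv hz.2, c.right_inv hz.1]
  have h6 := h4.unique h5
  intro h0
  -- Inserting `oneForm 1 i`, an identification of the plane with `ℂ` of Jacobian 1, lets the
  -- product formula apply and yields `1 = 0`.
  have h7 := jac_comp (fderiv ℝ (c ∘ e.symm) (e x))
    ((fderiv ℝ (e ∘ c.symm) (c x)).comp (oneForm 1 (Complex.I * 1)))
  rw [← ContinuousLinearMap.comp_assoc, h6, ContinuousLinearMap.id_comp, jac_oneForm, h0] at h7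
  simp at h7

theorem IsSmoothCoord.gram_eq {c : OpenPartialHomeomorph M ℂ} (hc : IsSmoothCoord c)
    (hf : ContMDiff (𝓡 2) 𝓘(ℝ, Fin 4 → ℝ) ∞ f)
    {e : OpenPartialHomeomorph M Plane} (he : e ∈ atlas Plane M) {x : M} (hx : x ∈ c.source)
    (hxe : x ∈ e.source) (i : Fin 2) : pderiv i (f ∘ e.symm) (e x) =
      fderiv ℝ (f ∘ c.symm) (c x) (pderiv i (c ∘ e.symm) (e x)) := by
  have h1 := hc.differentiableAt_comp_chart_symm he hx hxe
  have h2 : HasFDerivAt (f ∘ c.symm) (fderiv ℝ (f ∘ c.symm) (c x)) ((c ∘ e.symm) (e x)) := by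
    rw [Function.comp, e.left_inv hxe]
    exact (((hc.contDiffOn_comp_symm hf).contDiffAt
      (c.open_target.mem_nhds (c.map_source hx))).differentiableAt (by simp)).hasFDerivAt
  have h3 : HasFDerivAt (f ∘ e.symm) ((fderiv ℝ (f ∘ c.symm) (c x)).comp
      (fderiv ℝ (c ∘ e.symm) (e x))) (e x) := by
    refine (h2.comp (e x) h1.hasFDerivAt).congr_of_eventuallyEq ?_
    filter_upwards [(e.isOpen_inter_preimage_symm c.open_source).mem_nhds
      ⟨e.map_source hxe, by rw [mem_preimage, e.left_inv hxe]; exact hx⟩] with z hz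
    simp only [Function.comp]
    rw [c.left_inv hz.2]
  rw [pderiv, h3.fderiv]
  rfl

/-- A conformal structure for which the face has a holomorphic null lift induces the given
orientation. -/
theorem isPositive_of_isNullLift (hf : IsCMC1Face f W) {J : ComplexStructure M}
    (hJ : J.IsConformalOn f W) {Mt : Type*} [TopologicalSpace Mt] {ϱ : Mt → M}
    (hϱ : IsLocalHomeomorph ϱ) (hsurj : Function.Surjective ϱ)
    {F : Mt → Matrix.SpecialLinearGroup (Fin 2) ℂ} (hF : J.IsNullLift f ϱ F) : J.IsPositive := by
  rintro c hc e he x ⟨hxc, hxe⟩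
  change 0 < jac (fderiv ℝ (c ∘ e.symm) (e x))
  have hcs : IsSmoothCoord c := ⟨(J.smooth c hc).1, (J.smooth c hc).2⟩
  by_contra hcon
  have hneg := lt_of_le_of_ne (not_lt.1 hcon) (hcs.jac_ne_zero he hxc hxe)
  set φ := c ∘ e.symm with hφdef
  set N := e.target ∩ e.symm ⁻¹' c.source with hN
  have hNo : IsOpen N := e.isOpen_inter_preimage_symm c.open_source
  have hφ : ContDiffOn ℝ ∞ φ N := contDiffOn_comp_chart_symm le_rfl hcs.smooth he
  have hdφ : ContinuousOn (fderiv ℝ φ) N := (hφ.fderiv_of_isOpen (m := ∞) hNo le_rfl).continuousOn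
  have hdi : ∀ i, ContinuousOn (fun z => fderiv ℝ φ z (bvec i)) N := fun i =>
    hdφ.clm_apply continuousOn_const
  have hjac : ContinuousOn (fun z => jac (fderiv ℝ φ z)) N :=
    ((Complex.continuous_re.comp_continuousOn (hdi 0)).mul
      (Complex.continuous_im.comp_continuousOn (hdi 1))).sub
    ((Complex.continuous_im.comp_continuousOn (hdi 0)).mul
      (Complex.continuous_re.comp_continuousOn (hdi 1)))
  set O₁ := N ∩ {z | jac (fderiv ℝ φ z) < 0} with hO₁
  have hO₁o : IsOpen O₁ := hjac.isOpen_inter_preimage hNo isOpen_Iio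
  have hxO : e x ∈ O₁ := ⟨⟨e.map_source hxe, by rw [mem_preimage, e.left_inv hxe]; exact hxc⟩, hneg⟩
  -- A negative Jacobian persists nearby, so the point may be moved into `W`, where the metric is
  -- definite. A local sheet of `ϱ` then brings the lift down to a neighbourhood.
  obtain ⟨y, hyO, hye, hyW⟩ := mem_closure_iff_nhds.1
    (target_subset_closure hf.dense e (e.map_source hxe)) _ (hO₁o.mem_nhds hxO)
  obtain ⟨y₀, hy₀⟩ := hsurj (e.symm y)
  obtain ⟨s, hys, rfl⟩ := hϱ y₀
  obtain ⟨hlift, hherm⟩ := hF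
  obtain ⟨hG, -⟩ := hlift s (fun _ _ => rfl) c hc
  obtain ⟨H, -, -, -⟩ := hf.planarFace_gram he
  set O := (O₁ ∩ posSet e f) ∩ (e.target ∩ e.symm ⁻¹' (s.target ∩ W)) with hO
  have hOo : IsOpen O := (hO₁o.inter H.isOpen).inter
    (e.isOpen_inter_preimage_symm (s.open_target.inter hf.isOpen))
  have hpos : ∀ z ∈ e.target, e.symm z ∈ W → 0 < gram (f ∘ e.symm) 0 0 z ∧
      0 < gram (f ∘ e.symm) 0 0 z * gram (f ∘ e.symm) 1 1 z - gram (f ∘ e.symm) 0 1 z ^ 2 :=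
    fun z hz hzW => gram_pos_of_posDef hz (hf.cmc1 _ hzW e he (e.map_target hz)).1
  have hyO' : y ∈ O := ⟨⟨hyO, ⟨hye, (hpos y hye hyW).1⟩, (hpos y hye hyW).2⟩, hye, by
    rw [← hy₀]; exact s.map_source hys, hyW⟩
  have hmem : ∀ z ∈ O, φ z ∈ (s.trans c).target := by
    intro z hz
    rw [OpenPartialHomeomorph.trans_target]
    refine ⟨c.map_source hz.1.1.1.2, ?_⟩
    rw [mem_preimage, hφdef, Function.comp, c.left_inv hz.1.1.1.2]
    exact hz.2.2.1
  refine H.false_of_antiholomorphic_lift hOo (fun z hz => hz.1.2) hyO' ⟨hye, hyW⟩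
    (φ := φ) ((hφ.mono fun z hz => hz.1.1.1).of_le (by norm_cast)) ?_ (s.trans c).open_target hmem
    (Ψ := fun z => (F ((s.trans c).symm z)).1) hG (fun z _ => (F ((s.trans c).symm z)).2) ?_
  · intro z hz
    have hzU : z ∈ posSet e f := hz.1.2
    have hze := hz.2.1
    have hzc : e.symm z ∈ c.source := hz.1.1.1.2
    obtain ⟨σ, hσ, h00, h01, h11⟩ := (H.cmc z ⟨hzU, hze, hz.2.2.2⟩).conf.self_of_nhds
    obtain ⟨l, hl, hll⟩ := hJ c hc _ ⟨hz.2.2.2, hzc⟩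
    have hgi := fun i => hcs.gram_eq hf.smooth he hzc (e.map_target hze) i
    rw [e.right_inv hze] at hgi
    have hgr : ∀ i j, gram (f ∘ e.symm) i j z = l * inner ℝ (pderiv i φ z) (pderiv j φ z) :=
      fun i j => by rw [gram, hgi, hgi, hll]
    refine eq_conj_slope_mul (H.pos z hzU) (H.det z hzU) hσ hl (by rw [← h00, hgr])
      (by rw [← h01, hgr]) (by rw [← h11, hgr]) hz.1.1.2
  · intro z hz
    have h1 : s ((s.trans c).symm (φ z)) = e.symm z := by
      change s (s.symm (c.symm (c (e.symm z)))) = _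
      rw [c.left_inv hz.1.1.1.2, s.right_inv hz.2.2.1]
    have := hherm ((s.trans c).symm (φ z))
    rwa [h1] at this

end Uniqueness

end CMCFace

namespace CMCFace

open Filter Topology Set
open scoped Matrix.Norms.Operator

/-! ### Flat bundles and global frames on a simply connected covering. -/

section Covering

/-- `IsCoveringMap` allows empty fibres. Near a missed point the whole evenly covered neighbourhood
is missed, so the range is clopen. -/
theorem surjective_of_isCoveringMap {X Y : Type*} [TopologicalSpace X] [TopologicalSpace Y]
    [Nonempty X] [ConnectedSpace Y] {p : X → Y} (hp : IsCoveringMap p) : Function.Surjective p := by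
  have ho : IsOpen (range p) := hp.isLocalHomeomorph.isOpenMap.isOpen_range
  have hc : IsClosed (range p) := by
    rw [← isOpen_compl_iff, isOpen_iff_mem_nhds]
    intro y hy
    obtain ⟨-, U, hyU, hU, -, H, -⟩ := hp y
    filter_upwards [hU.mem_nhds hyU] with z hz
    rintro ⟨x, rfl⟩
    exact hy ⟨_, (H ⟨x, hz⟩).2.2⟩
  rw [← range_eq_univ]
  exact IsClopen.eq_univ ⟨hc, ho⟩ (range_nonempty p)

theorem locallyPathConnectedSpace_of_isLocalHomeomorph (H : Type*) {X Y : Type*}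
    [TopologicalSpace H] [LocallyPathConnectedSpace H] [TopologicalSpace X] [TopologicalSpace Y]
    [ChartedSpace H Y] {p : X → Y} (hp : IsLocalHomeomorph p) : LocallyPathConnectedSpace X := by
  choose s hs _ using hp
  let _ : ChartedSpace H X :=
    { atlas := range fun x => (s x).trans (chartAt H (s x x))
      chartAt := fun x => (s x).trans (chartAt H (s x x))
      mem_chart_source := fun x => by
        rw [OpenPartialHomeomorph.trans_source]
        exact ⟨hs x, mem_chart_source H (s x x)⟩
      chart_mem_atlas := fun x => ⟨x, rfl⟩ }
  exact ChartedSpace.locallyPathConnectedSpace H X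

/-- The group `G`, with the discrete topology. -/
def Discrete (G : Type*) : Type _ := G

instance (G : Type*) : TopologicalSpace (Discrete G) := ⊥

instance (G : Type*) : DiscreteTopology (Discrete G) := ⟨rfl⟩

instance (G : Type*) [Group G] : Group (Discrete G) := inferInstanceAs (Group G)

variable {G X Y : Type*} [Group G] [TopologicalSpace X] [TopologicalSpace Y]

/-- The flat bundle defined by local frames with locally constant transition functions. -/
noncomputable def flatBundle [TopologicalSpace G] [DiscreteTopology G] (U : Y → Set Y)
    (hU : ∀ i, IsOpen (U i)) (hmem : ∀ i, i ∈ U i) (L : Y → Y → G)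
    (hL : ∀ i j, ∀ x ∈ U i ∩ U j, ∀ᶠ y in 𝓝 x, (L j y)⁻¹ * L i y = (L j x)⁻¹ * L i x) :
    FiberBundleCore Y Y G where
  baseSet := U
  isOpen_baseSet := hU
  indexAt := id
  mem_baseSet_at := hmem
  coordChange i j x v := (L j x)⁻¹ * L i x * v
  coordChange_self i x _ v := by rw [inv_mul_cancel, one_mul]
  continuousOn_coordChange i j := by
    rintro ⟨x, v⟩ ⟨hx, -⟩
    refine ContinuousAt.continuousWithinAt ?_
    have hev : (fun p : Y × G => (L j p.1)⁻¹ * L i p.1 * p.2)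
        =ᶠ[𝓝 (x, v)] fun _ => (L j x)⁻¹ * L i x * v := by
      rw [nhds_prod_eq, nhds_discrete G]
      filter_upwards [(hL i j x hx).prod_mk (show ∀ᶠ w : G in pure v, w = v from rfl)]
        with p hp
      rw [hp.1, hp.2]
    exact continuousAt_const.congr hev.symm
  coordChange_comp i j k x _ v := by group

/-- On a simply connected covering space, local frames with locally constant transition functions
can be adjusted by locally constant factors to a global frame. -/
theorem exists_global_frame [SimplyConnectedSpace X] [LocallyPathConnectedSpace X] {p : X → Y}
    (hp : Continuous p) (U : Y → Set Y) (hU : ∀ i, IsOpen (U i)) (hmem : ∀ i, i ∈ U i)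
    (L : Y → Y → G) (hL : ∀ i j, ∀ x ∈ U i ∩ U j,
      ∀ᶠ y in 𝓝 x, (L j y)⁻¹ * L i y = (L j x)⁻¹ * L i x) (x₀ : X) :
    ∃ F : X → G, F x₀ = L (p x₀) (p x₀) ∧ ∀ x i, p x ∈ U i →
      ∀ᶠ y in 𝓝 x, (L i (p y))⁻¹ * F y = (L i (p x))⁻¹ * F x := by
  let Z := flatBundle (G := Discrete G) U hU hmem L hL
  -- A bundle with discrete fibre is a covering of `Y`, so `p` lifts to it from the simply connected
  -- `X`, starting at the identity over `p x₀`.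
  have hcov : IsCoveringMap (Bundle.TotalSpace.proj : Z.TotalSpace → Y) :=
    FiberBundle.isCoveringMap (F := Discrete G) (E := Z.Fiber)
  obtain ⟨Φ, ⟨hΦ0, hΦ⟩, -⟩ := hcov.existsUnique_continuousMap_lifts ⟨p, hp⟩ x₀
    (⟨p x₀, (1 : Discrete G)⟩ : Z.TotalSpace) rfl
  have hΦp : ∀ x, (Φ x).1 = p x := fun x => congrFun hΦ x
  let v : X → G := fun x => (Φ x).2
  -- Here `v x` is the coordinate of the lift in the frame indexed by `p x`. Thus `(L i)⁻¹ F` is its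
  -- coordinate in the trivialisation `i`: continuous with discrete values, hence locally constant.
  refine ⟨fun x => L (p x) (p x) * v x, ?_, fun x i hx => ?_⟩
  · have : v x₀ = 1 := by
      simp only [v]
      rw [hΦ0]
      rfl
    simp only [this, mul_one]
  · have hc : ContinuousAt (fun y => (Z.localTriv i (Φ y)).2) x := by
      refine continuousAt_snd.comp (ContinuousAt.comp ?_ Φ.continuous.continuousAt)
      refine (Z.localTriv i).continuousOn.continuousAt ((Z.localTriv i).open_source.mem_nhds ?_)
      rw [Z.mem_localTriv_source, ← Z.baseSet_at]
      change (Φ x).1 ∈ U i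
      rwa [hΦp]
    have hv : ∀ y, (Z.localTriv i (Φ y)).2 = ((L i (p y))⁻¹ * (L (p y) (p y) * v y) : G) := by
      intro y
      rw [Z.localTriv_apply]
      change ((L i (Φ y).1)⁻¹ * L (Φ y).1 (Φ y).1 * v y : G) = _
      rw [hΦp, mul_assoc]
    have h1 := hc.eventually (show ∀ᶠ w in 𝓝 ((Z.localTriv i (Φ x)).2),
      w = (Z.localTriv i (Φ x)).2 by rw [nhds_discrete]; rfl)
    filter_upwards [h1] with y hy
    rw [← hv, ← hv]
    exact hy

end Covering

/-! ### Rigidity of null lifts. -/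

section Rigidity

/-- A function which is both holomorphic and antiholomorphic is locally constant. -/
theorem eventually_eq_of_differentiableOn_conj {a b : ℂ → ℂ} {S : Set ℂ} (hS : IsOpen S)
    (ha : DifferentiableOn ℂ a S) (hb : DifferentiableOn ℂ b S)
    (hab : ∀ z ∈ S, b z = starRingEnd ℂ (a z)) {z : ℂ} (hz : z ∈ S) :
    ∀ᶠ w in 𝓝 z, a w = a z := by
  obtain ⟨r, hr, hrS⟩ := Metric.isOpen_iff.1 hS z hz
  have hd : ∀ w ∈ Metric.ball z r, deriv a w = 0 := by
    intro w hw
    have hn := hS.mem_nhds (hrS hw)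
    have h1 := (ha.differentiableAt hn).hasDerivAt.hasFDerivAt.restrictScalars ℝ
    have h2 := (hb.differentiableAt hn).hasDerivAt.hasFDerivAt.restrictScalars ℝ
    have h3 : HasFDerivAt b _ w :=
      ((Complex.conjCLE : ℂ →L[ℝ] ℂ).hasFDerivAt.comp w h1).congr_of_eventuallyEq (by
        filter_upwards [hn] with u hu using hab u hu)
    have h4 := h3.unique h2
    have h5 := DFunLike.congr_fun h4 1
    have h6 := DFunLike.congr_fun h4 Complex.I
    simp at h5 h6
    rw [← h5] at h6
    have h7 : Complex.I * starRingEnd ℂ (deriv a w) = 0 := by linear_combination -h6 / 2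
    simpa using h7
  filter_upwards [Metric.ball_mem_nhds z hr] with w hw
  exact Metric.isOpen_ball.is_const_of_deriv_eq_zero (convex_ball z r).isPreconnected
    (ha.mono hrS) hd hw (Metric.mem_ball_self hr)

/-- The stabiliser of `e₃` in `SL(2, ℂ)` is `SU(1, 1)`: the hypothesis reads `e₃ C* = adj(C) e₃`.
For a holomorphic `C` this makes each entry the conjugate of a holomorphic function. -/
theorem entries_of_unitary {C : Matrix (Fin 2) (Fin 2) ℂ} (hC : C.det = 1)
    (hCe : C * e₃ * Cᴴ = e₃) :
    C 1 1 = starRingEnd ℂ (C 0 0) ∧ C 1 0 = starRingEnd ℂ (C 0 1) := by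
  have h1 : C.adjugate * (C * e₃ * Cᴴ) = e₃ * Cᴴ := by
    rw [mul_assoc, ← mul_assoc C.adjugate, Matrix.adjugate_mul, hC, one_smul, one_mul]
  rw [hCe] at h1
  have h2 := congrFun (congrFun h1 0) 0
  have h3 := congrFun (congrFun h1 1) 0
  simp [e₃, Matrix.adjugate_fin_two, Matrix.mul_apply, Fin.sum_univ_two] at h2 h3
  exact ⟨h2, h3⟩

variable {M : Type*} [TopologicalSpace M] {f : M → Fin 4 → ℝ}

/-- Two null lifts of the same face differ by a locally constant factor. -/
theorem IsLocalLift.eventually_eq {c c' : OpenPartialHomeomorph M ℂ}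
    {F F₁ F' F₁' : ℂ → Matrix (Fin 2) (Fin 2) ℂ} (hF : IsLocalLift f c F F₁)
    (hF' : IsLocalLift f c' F' F₁')
    (hτ : DifferentiableOn ℂ (c' ∘ c.symm) (c.symm.trans c').source) {x : M} (hx : x ∈ c.source)
    (hx' : x ∈ c'.source) : ∀ᶠ y in 𝓝 x,
      (F' (c' y)).adjugate * F (c y) = (F' (c' x)).adjugate * F (c x) := by
  set S := (c.symm.trans c').source with hS
  have hSo : IsOpen S := (c.symm.trans c').open_source
  set C : ℂ → Matrix (Fin 2) (Fin 2) ℂ := fun z => (F' (c' (c.symm z))).adjugate * F z with hC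
  have hxS : c x ∈ S := mem_trans_source' hx hx'
  have hFd : ∀ i j, DifferentiableOn ℂ (fun z => F z i j) S := fun i j z hz =>
    (HasDerivAt.entry (hF.deriv z (mem_trans_source.1 hz).1) i j)
      |>.differentiableAt.differentiableWithinAt
  have hF'd : ∀ i j, DifferentiableOn ℂ (fun z => F' (c' (c.symm z)) i j) S := fun i j => by
    have h1 : DifferentiableOn ℂ (fun w => F' w i j) c'.target := fun w hw =>
      (HasDerivAt.entry (hF'.deriv w hw) i j).differentiableAt.differentiableWithinAt
    exact h1.comp hτ fun z hz => c'.map_source (mem_trans_source.1 hz).2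
  have hadj : ∀ i j, DifferentiableOn ℂ (fun z => (F' (c' (c.symm z))).adjugate i j) S := by
    intro i j
    fin_cases i <;> fin_cases j <;> simp only [Matrix.adjugate_fin_two] <;>
      first | exact hF'd _ _ | exact (hF'd _ _).neg
  have hCd : ∀ i j, DifferentiableOn ℂ (fun z => C z i j) S := by
    intro i j
    simp only [hC, Matrix.mul_apply, Fin.sum_univ_two]
    exact ((hadj i 0).mul (hFd 0 j)).add ((hadj i 1).mul (hFd 1 j))
  have hCe : ∀ z ∈ S, C z 1 1 = starRingEnd ℂ (C z 0 0) ∧ C z 1 0 = starRingEnd ℂ (C z 0 1) := by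
    intro z hz
    obtain ⟨hz1, hz2⟩ := mem_trans_source.1 hz
    have hw := c'.map_source hz2
    have hdet' := hF'.det _ hw
    have hl := hF.lift z hz1
    have hl' := hF'.lift _ hw
    rw [c'.left_inv hz2, hl] at hl'
    set P := F' (c' (c.symm z))
    have hP : P.adjugate * P = 1 := by rw [Matrix.adjugate_mul, hdet', one_smul]
    have hPs : Pᴴ * (P.adjugate)ᴴ = 1 := by
      rw [← Matrix.conjTranspose_mul, hP, Matrix.conjTranspose_one]
    refine entries_of_unitary ?_ ?_
    · simp only [hC]
      rw [Matrix.det_mul, Matrix.det_adjugate, hdet', hF.det z hz1]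
      simp
    · simp only [hC]
      calc P.adjugate * F z * e₃ * (P.adjugate * F z)ᴴ
          = P.adjugate * (F z * e₃ * (F z)ᴴ) * (P.adjugate)ᴴ := by
            rw [Matrix.conjTranspose_mul]; simp only [mul_assoc]
        _ = (P.adjugate * P) * e₃ * (Pᴴ * (P.adjugate)ᴴ) := by rw [hl']; simp only [mul_assoc]
        _ = e₃ := by rw [hP, hPs, one_mul, mul_one]
  have h00 := eventually_eq_of_differentiableOn_conj hSo (hCd 0 0) (hCd 1 1)
    (fun z hz => (hCe z hz).1) hxS
  have h01 := eventually_eq_of_differentiableOn_conj hSo (hCd 0 1) (hCd 1 0)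
    (fun z hz => (hCe z hz).2) hxS
  have hev : ∀ᶠ z in 𝓝 (c x), C z = C (c x) := by
    filter_upwards [h00, h01, hSo.mem_nhds hxS] with z h1 h2 hz
    ext i j
    fin_cases i <;> fin_cases j
    · exact h1
    · exact h2
    · change C z 1 0 = C (c x) 1 0
      rw [(hCe z hz).2, (hCe _ hxS).2, h2]
    · change C z 1 1 = C (c x) 1 1
      rw [(hCe z hz).1, (hCe _ hxS).1, h1]
  filter_upwards [(c.continuousAt hx).eventually hev, c.open_source.mem_nhds hx] with y hy hyc
  simp only [hC] at hy
  rwa [c.left_inv hyc, c.left_inv hx] at hy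

end Rigidity

end CMCFace

namespace CMCFace

open Filter Topology Set
open scoped Matrix.Norms.Operator

/-! ### The global null lift. -/

section NullLift

variable {M : Type*} [TopologicalSpace M] [ChartedSpace Plane M] [IsManifold (𝓡 2) ∞ M]
  {f : M → Fin 4 → ℝ} {W : Set M}

/-- The null lift on the universal cover. -/
theorem exists_isNullLift (hor : IsOrientedAtlas M) (hf : IsCMC1Face f W)
    (hcov : ∀ x, ∃ c, IsAdaptedChart f W c ∧ x ∈ c.source) {Mt : Type*} [TopologicalSpace Mt]
    [SimplyConnectedSpace Mt] {ϱ : Mt → M} (hϱ : IsCoveringMap ϱ) :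
    ∃ F : Mt → Matrix.SpecialLinearGroup (Fin 2) ℂ,
      (adaptedStructure hf.smooth hf.dense hcov).IsNullLift f ϱ F := by
  choose c F F' hmem hc hF using hf.exists_adaptedChart hor
  have hτ : ∀ {c c'}, IsAdaptedChart f W c → IsAdaptedChart f W c' →
      DifferentiableOn ℂ (c' ∘ c.symm) (c.symm.trans c').source :=
    fun h h' => h.differentiableOn hf.smooth hf.dense h'
  have : LocallyPathConnectedSpace Mt :=
    locallyPathConnectedSpace_of_isLocalHomeomorph Plane hϱ.isLocalHomeomorph
  classical
  let L : M → M → Matrix.SpecialLinearGroup (Fin 2) ℂ := fun i x =>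
    if hx : x ∈ (c i).source then ⟨F i (c i x), (hF i).det _ ((c i).map_source hx)⟩ else 1
  have hLc : ∀ i x, x ∈ (c i).source → (L i x).1 = F i (c i x) := fun i x hx => by
    have h1 : L i x = ⟨F i (c i x), (hF i).det _ ((c i).map_source hx)⟩ := dif_pos hx
    rw [h1]
  have hinv : ∀ A B : Matrix.SpecialLinearGroup (Fin 2) ℂ,
      (A⁻¹ * B).1 = A.1.adjugate * B.1 := fun A B => rfl
  have hL : ∀ i j, ∀ x ∈ (c i).source ∩ (c j).source,
      ∀ᶠ y in 𝓝 x, (L j y)⁻¹ * L i y = (L j x)⁻¹ * L i x := by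
    rintro i j x ⟨hi, hj⟩
    filter_upwards [(hF i).eventually_eq (hF j) (hτ (hc i) (hc j)) hi hj,
      (c i).open_source.mem_nhds hi, (c j).open_source.mem_nhds hj] with y hy hyi hyj
    apply Subtype.ext
    rw [hinv, hinv, hLc i y hyi, hLc j y hyj, hLc i x hi, hLc j x hj]
    exact hy
  obtain ⟨y₀⟩ : Nonempty Mt := inferInstance
  obtain ⟨Φ, hΦ0, hΦ⟩ := exists_global_frame hϱ.continuous (fun i => (c i).source)
    (fun i => (c i).open_source) hmem L hL y₀
  have hloc : ∀ y i, ϱ y ∈ (c i).source → ∃ σ : Matrix.SpecialLinearGroup (Fin 2) ℂ,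
      ∀ᶠ y' in 𝓝 y, ϱ y' ∈ (c i).source ∧ (Φ y').1 = F i (c i (ϱ y')) * σ.1 := by
    intro y i hi
    refine ⟨(L i (ϱ y))⁻¹ * Φ y, ?_⟩
    filter_upwards [hΦ y i hi, (hϱ.continuous.tendsto y).eventually
      ((c i).open_source.mem_nhds hi)] with y' h1 h2
    refine ⟨h2, ?_⟩
    rw [← h1, ← hLc i _ h2]
    change _ = (L i (ϱ y') * ((L i (ϱ y'))⁻¹ * Φ y')).1
    rw [mul_inv_cancel_left]
  have hlift : ∀ i x, x ∈ (c i).source → toHerm (f x) = F i (c i x) * e₃ * (F i (c i x))ᴴ := by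
    intro i x hx
    have := (hF i).lift _ ((c i).map_source hx)
    rwa [(c i).left_inv hx] at this
  have hherm : ∀ y, toHerm (f (ϱ y)) = (Φ y).1 * e₃ * ((Φ y).1)ᴴ := by
    -- Locally `Φ` is a null lift times a constant `σ`, and the identity holds at a point exactly
    -- when `σ e₃ σ* = e₃`. So its truth is locally constant, and it holds at `y₀` by the choice of
    -- initial value.
    set T := {y | toHerm (f (ϱ y)) = (Φ y).1 * e₃ * ((Φ y).1)ᴴ} with hT
    have hTev : ∀ y, ∀ᶠ y' in 𝓝 y, (y' ∈ T ↔ y ∈ T) := by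
      intro y
      obtain ⟨σ, hσ⟩ := hloc y (ϱ y) (hmem _)
      have key : ∀ y', ϱ y' ∈ (c (ϱ y)).source ∧ (Φ y').1 = F (ϱ y) (c (ϱ y) (ϱ y')) * σ.1 →
          (y' ∈ T ↔ e₃ = σ.1 * e₃ * (σ.1)ᴴ) := by
        rintro y' ⟨h1, h2⟩
        change toHerm (f (ϱ y')) = (Φ y').1 * e₃ * ((Φ y').1)ᴴ ↔ _
        rw [hlift _ _ h1, h2]
        have hdet := (hF (ϱ y)).det _ ((c (ϱ y)).map_source h1)
        set P := F (ϱ y) (c (ϱ y) (ϱ y'))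
        have hP : P.adjugate * P = 1 := by rw [Matrix.adjugate_mul, hdet, one_smul]
        have hPs : Pᴴ * (P.adjugate)ᴴ = 1 := by
          rw [← Matrix.conjTranspose_mul, hP, Matrix.conjTranspose_one]
        have hcan : ∀ B, P.adjugate * (P * B * Pᴴ) * (P.adjugate)ᴴ = B := fun B => by
          calc P.adjugate * (P * B * Pᴴ) * (P.adjugate)ᴴ
              = (P.adjugate * P) * B * (Pᴴ * (P.adjugate)ᴴ) := by simp only [mul_assoc]
            _ = B := by rw [hP, hPs, one_mul, mul_one]
        have hr : P * σ.1 * e₃ * (P * σ.1)ᴴ = P * (σ.1 * e₃ * (σ.1)ᴴ) * Pᴴ := by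
          rw [Matrix.conjTranspose_mul]
          simp only [mul_assoc]
        rw [hr]
        constructor
        · intro h3
          exact (hcan e₃).symm.trans ((congrArg (fun B => P.adjugate * B * (P.adjugate)ᴴ) h3).trans
            (hcan _))
        · intro h3
          rw [← h3]
      filter_upwards [hσ] with y' hy'
      rw [key y' hy', key y hσ.self_of_nhds]
    have hTo : IsOpen T := isOpen_iff_mem_nhds.2 fun y hy => by
      filter_upwards [hTev y] with y' h1 using h1.2 hy
    have hTc : IsClosed T := by
      rw [← isOpen_compl_iff, isOpen_iff_mem_nhds]
      intro y hy
      filter_upwards [hTev y] with y' h1 using fun h2 => hy (h1.1 h2)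
    have hT0 : y₀ ∈ T := by
      change toHerm (f (ϱ y₀)) = (Φ y₀).1 * e₃ * ((Φ y₀).1)ᴴ
      rw [hΦ0, hLc _ _ (hmem _)]
      exact hlift _ _ (hmem _)
    have hTu := IsClopen.eq_univ ⟨hTc, hTo⟩ ⟨y₀, hT0⟩
    intro y
    have : y ∈ T := by rw [hTu]; trivial
    exact this
  refine ⟨Φ, fun s hs c' hc' => ?_, hherm⟩
  change IsAdaptedChart f W c' at hc'
  intro k G
  -- In any sheet and chart, `G` is a local lift composed with a holomorphic coordinate change and
  -- multiplied by `σ`. Its derivative `t F' σ` is nonzero and null because `t ≠ 0` and `σ` is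
  -- invertible.
  have hder : ∀ z ∈ k.target, ∃ D : Matrix (Fin 2) (Fin 2) ℂ, HasDerivAt G D z ∧ D ≠ 0 ∧
      D.det = 0 := by
    intro z hz
    have hz' : z ∈ c'.target ∧ c'.symm z ∈ s.target := by
      have := hz
      rw [OpenPartialHomeomorph.trans_target] at this
      exact this
    have hϱk : ∀ w ∈ k.target, ϱ (k.symm w) = c'.symm w := by
      intro w hw
      rw [OpenPartialHomeomorph.trans_target] at hw
      have hw2 : c'.symm w ∈ s.target := hw.2
      change ϱ (s.symm (c'.symm w)) = _
      rw [← hs (s.map_target hw2), s.right_inv hw2]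
    set x := c'.symm z with hx
    have hxc' : x ∈ c'.source := c'.map_target hz'.1
    have hϱz : ϱ (k.symm z) = x := hϱk z hz
    obtain ⟨σ, hσ⟩ := hloc (k.symm z) x (by rw [hϱz]; exact hmem x)
    obtain ⟨t, ht, h1, -⟩ := exists_hasDerivAt_transition (hτ hc' (hc x)) (hτ (hc x) hc') hxc'
      (hmem x)
    rw [hx, c'.right_inv hz'.1, ← hx] at h1
    have hw := (c x).map_source (hmem x)
    have h2 : HasDerivAt (F x) (F' x (c x x)) ((c x ∘ c'.symm) z) := (hF x).deriv _ hw
    have h3 := (h2.scomp z h1).mul_const σ.1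
    have h4 : HasDerivAt G (t • F' x (c x x) * σ.1) z := by
      refine h3.congr_of_eventuallyEq ?_
      filter_upwards [(k.symm.continuousAt hz).eventually hσ, k.open_target.mem_nhds hz]
        with w h5 h6
      rw [hϱk w h6] at h5
      exact h5.2
    refine ⟨_, h4, fun h0 => ?_, ?_⟩
    · refine (hF x).deriv_ne _ hw ?_
      have h5 : σ.1 * σ.1.adjugate = 1 := by rw [Matrix.mul_adjugate, σ.2, one_smul]
      have h6 : t • F' x (c x x) = 0 := by
        rw [← mul_one (t • _), ← h5, ← mul_assoc, h0, zero_mul]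
      exact (smul_eq_zero.1 h6).resolve_left ht
    · rw [Matrix.det_mul, Matrix.det_smul, (hF x).det_deriv _ hw]
      simp
  refine ⟨fun i j z hz => ?_, fun z hz => ?_⟩
  · obtain ⟨D, hD, -, -⟩ := hder z hz
    exact (HasDerivAt.entry hD i j).differentiableAt.differentiableWithinAt
  · obtain ⟨D, hD, hD0, hDd⟩ := hder z hz
    have hDe : (Matrix.of fun i j => deriv (fun u => G u i j) z) = D := by
      ext i j
      exact (HasDerivAt.entry hD i j).deriv
    rw [hDe]
    exact ⟨hD0, hDd⟩

end NullLift

end CMCFace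

theorem mainTheorem5 {M : Type*} [TopologicalSpace M] [T2Space M] [SecondCountableTopology M]
    [ConnectedSpace M] [ChartedSpace CMCFace.Plane M] [IsManifold (𝓡 2) ∞ M]
    (hor : CMCFace.IsOrientedAtlas M)
    (f : M → Fin 4 → ℝ) (W : Set M) (hf : CMCFace.IsCMC1Face f W) :
    ∃ J : CMCFace.ComplexStructure M,
      J.IsPositive ∧ J.IsConformalOn f W ∧
      (∀ J' : CMCFace.ComplexStructure M, J'.IsPositive → J'.IsConformalOn f W → J' = J) ∧
      ∀ (Mt : Type*) [TopologicalSpace Mt] [SimplyConnectedSpace Mt] (ϱ : Mt → M),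
        IsCoveringMap ϱ →
          (∃ F : Mt → Matrix.SpecialLinearGroup (Fin 2) ℂ, J.IsNullLift f ϱ F) ∧
          ∀ J' : CMCFace.ComplexStructure M, J'.IsConformalOn f W →
            (∃ F : Mt → Matrix.SpecialLinearGroup (Fin 2) ℂ, J'.IsNullLift f ϱ F) → J' = J := by
  have hcov : ∀ x, ∃ c, CMCFace.IsAdaptedChart f W c ∧ x ∈ c.source := fun x => by
    obtain ⟨c, -, -, hx, hc, -⟩ := hf.exists_adaptedChart hor x
    exact ⟨c, hc, hx⟩
  refine ⟨CMCFace.adaptedStructure hf.smooth hf.dense hcov, fun c hc => hc.positive,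
    fun c hc => hc.conf, CMCFace.eq_adaptedStructure hf.smooth hf.dense hcov, ?_⟩
  intro Mt _ _ ϱ hϱ
  refine ⟨CMCFace.exists_isNullLift hor hf hcov hϱ, ?_⟩
  -- The null lift makes `J'` positive, which reduces this uniqueness to the oriented one.
  rintro J' hJ' ⟨F, hF⟩
  exact CMCFace.eq_adaptedStructure hf.smooth hf.dense hcov J'
    (CMCFace.isPositive_of_isNullLift hf hJ' hϱ.isLocalHomeomorph
      (CMCFace.surjective_of_isCoveringMap hϱ) hF) hJ'
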